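/- **Setting.** Let $G$ be a compact, second countable Hausdorff group (e.g. a compact Lie group or a finite group), with normalized Haar measure, and let a lattice be a finite oriented graph with vertex set $\mathcal V$ and edge set $\mathcal E$. Put $\mathcal H_{\rm kin}=\bigotimes_{e\in\mathcal E}L^2(G)=L^2(G^{\mathcal E})$. For any finite system of $G$-valued oriented links, $\mathbf h:\mathcal V\to G$ acts by $U(\mathbf h)|a\rangle=|\mathbf h\cdot a\rangle$, $(\mathbf h\cdot a)_e=h_{t(e)}\,a_e\,h_{s(e)}^{-1}$, where $s(e),t(e)$ are the source and target of $e$. Each vertex is interior to a region $\Sigma$, on its corner $\partial\Sigma$, exterior, or on the global boundary $\mathcal B$; the last kind is not gauged, the other three are the bulk. Each edge is interior (endpoints interior or on $\partial\Sigma$), a corner edge (both endpoints on $\partial\Sigma$), or in the complement $\bar\Sigma$ (no interior endpoint). $\mathcal H_{\rm phys}\subset\mathcal H_{\rm kin}$ is the space of states invariant under all gauge transformations supported on bulk vertices. *Extrinsic frame $\Phi$*: for each $v\in\partial\Sigma$ a path of complement edges from some vertex of $\mathcal B$ to $v$, no edge being used twice. Its variables are the Wilson lines $g_v$ (path-ordered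 products) of these paths; $\mathcal H_\Phi=L^2(G^{\partial\Sigma})$, and gauge transformations on $\partial\Sigma$ act by $g_v\mapsto h_vg_v$. *Intrinsic frame $\tilde\Phi$*: a spanning tree of corner edges on $\partial\Sigma$ rooted at some $\mathcal N\in\partial\Sigma$, with the Wilson lines from $\mathcal N$ to $v\ne\mathcal N$ along the tree as variables; $\mathcal H_{\tilde\Phi}=L^2(G^{\partial\Sigma\setminus\{\mathcal N\}})$, with action $g_v\mapsto h_vg_vh_{\mathcal N}^{-1}$. The remaining variables are: sub, the interior edges and the corner edges off the tree; and compl, the complement edges off the lines of $\Phi$ together with, for each intermediate node of a line of $\Phi$, the Wilson line from $\mathcal B$ to that node. In these variables $\mathcal H_{\rm kin}=\mathcal H_{\rm sub}\otimes\mathcal H_{\rm compl}\otimes\mathcal H_{\tilde\Phi}\otimes\mathcal H_\Phi$ and $U=U_{\rm sub}\otimes U_{\rm compl}\otimes U_{\tilde\Phi}\otimes U_\Phi$. Let $\mathcal H^{\rm phys}_{\rm sub}$ and $\mathcal H^{\rm phys}_{\rm compl}$ be the subspaces invariant under gauge transformations at the interior, respectively exterior, vertices. The Page–Wootters reduction $\mathcal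 R_\Phi(\mathbf g)=\langle\mathbf g|_\Phi\otimes 1$, $\mathbf g\in G^{\partial\Sigma}$, is the value at $\mathbf g$ of the continuous representative of a physical state, viewed as a function of the variables of $\Phi$ with values in the Hilbert space of the other variables. $\mathcal R_{\tilde\Phi}(\mathring{\mathbf g})$, $\mathring{\mathbf g}\in G^{\partial\Sigma\setminus\{\mathcal N\}}$, is defined in the same way. All tensor products are Hilbert-space tensor products. **Theorem.** (1) $\mathcal R_\Phi(\mathbf g)$ is well defined on $\mathcal H_{\rm phys}$ for every $\mathbf g$ and is a unitary from $\mathcal H_{\rm phys}$ onto $\mathcal H^{\rm phys}_{\rm sub}\otimes\mathcal H^{\rm phys}_{\rm compl}\otimes\mathcal H_{\tilde\Phi}$. For all $\mathbf h,\mathbf g\in G^{\partial\Sigma}$, $$\mathcal R_\Phi(\mathbf h\mathbf g)=\big(U^{\rm phys}_{\rm sub}(\mathbf h)\otimes U^{\rm phys}_{\rm compl}(\mathbf h)\otimes U_{\tilde\Phi}(\mathbf h)\big)\,\mathcal R_\Phi(\mathbf g).$$ Hence any two of the maps $\mathcal R_\Phi(\mathbf g)$ differ by a multilocal unitary $u\otimes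 v\otimes w$, and they define one gauge-invariant tensor product structure on $\mathcal H_{\rm phys}$. (2) Let $\mathcal H^{\rm phys}_{\mathring\Sigma}\subset L^2(G^{\text{interior edges}})$ be the states invariant under gauge transformations at the interior vertices, and $\mathcal H_{\partial\Sigma\setminus\tilde\Phi}=L^2(G^{\text{corner edges off the tree}})$. Multiplication of wave functions is a unitary $\mathcal H^{\rm phys}_{\mathring\Sigma}\otimes\mathcal H_{\partial\Sigma\setminus\tilde\Phi}\cong\mathcal H^{\rm phys}_{\rm sub}$ which intertwines the actions of $G^{\partial\Sigma}$. Thus (1) refines to $\mathcal H_{\rm phys}\cong\mathcal H^{\rm phys}_{\mathring\Sigma}\otimes\mathcal H_{\partial\Sigma\setminus\tilde\Phi}\otimes\mathcal H_{\tilde\Phi}\otimes\mathcal H^{\rm phys}_{\rm compl}$. (3) Let $G$ be Abelian. Let $H$ be the group of uniform gauge transformations $(h,\dots,h)$ on $\partial\Sigma$, let $\mathcal H_\Phi^H$ be the $H$-invariant states of $\mathcal H_\Phi$, and let $(\mathcal H^{\rm phys}_{\rm compl}\otimes\mathcal H_\Phi)^H$ be the jointly $H$-invariant states. Then $H$ acts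 trivially on $\mathcal H^{\rm phys}_{\rm sub}$. For every $\mathring{\mathbf g}$, $\mathcal R_{\tilde\Phi}(\mathring{\mathbf g})$ is well defined on $\mathcal H_{\rm phys}$ and is a unitary from $\mathcal H_{\rm phys}$ onto $\mathcal H^{\rm phys}_{\rm sub}\otimes(\mathcal H^{\rm phys}_{\rm compl}\otimes\mathcal H_\Phi)^H$. There is a unitary $W:(\mathcal H^{\rm phys}_{\rm compl}\otimes\mathcal H_\Phi)^H\to\mathcal H^{\rm phys}_{\rm compl}\otimes\mathcal H_\Phi^H$, independent of $\mathring{\mathbf g}$, such that the unitaries $$(1\otimes W)\,\mathcal R_{\tilde\Phi}(\mathring{\mathbf g}):\ \mathcal H_{\rm phys}\to\mathcal H^{\rm phys}_{\rm sub}\otimes\mathcal H^{\rm phys}_{\rm compl}\otimes\mathcal H_\Phi^H$$ differ, for different $\mathring{\mathbf g}$, only by multilocal unitaries $u\otimes v\otimes w$. If moreover $H$ acts trivially on $\mathcal H^{\rm phys}_{\rm compl}$ (the complement carries no total charge), then $W^{-1}$ is the inclusion $k\otimes\chi\mapsto k\otimes\chi$, so $\mathcal R_{\tilde\Phi}(\mathring{\mathbf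 g})$ itself maps onto $\mathcal H^{\rm phys}_{\rm sub}\otimes\mathcal H^{\rm phys}_{\rm compl}\otimes\mathcal H_\Phi^H$. This holds, in particular, if no link of compl joins a vertex of $\mathcal B$ to a vertex off $\mathcal B$. -/

import Mathlib

open MeasureTheory
open scoped TensorProduct ComplexConjugate

/-! ## Hilbert-space tensor products -/

section HilbertTensor

/-- The Hilbert-space tensor product: the completion of the algebraic tensor product with
respect to the inner product `⟪a ⊗ b, c ⊗ d⟫ = ⟪a, c⟫ ⟪b, d⟫`. -/
def HTensor (A B : Type*) [NormedAddCommGroup A] [InnerProductSpace ℂ A]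
    [NormedAddCommGroup B] [InnerProductSpace ℂ B] : Type _ :=
  UniformSpace.Completion (A ⊗[ℂ] B)

variable {A B A' B' : Type*}
  [NormedAddCommGroup A] [InnerProductSpace ℂ A] [NormedAddCommGroup B] [InnerProductSpace ℂ B]
  [NormedAddCommGroup A'] [InnerProductSpace ℂ A'] [NormedAddCommGroup B'] [InnerProductSpace ℂ B']

noncomputable instance : NormedAddCommGroup (HTensor A B) :=
  inferInstanceAs (NormedAddCommGroup (UniformSpace.Completion (A ⊗[ℂ] B)))

noncomputable instance : InnerProductSpace ℂ (HTensor A B) :=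
  inferInstanceAs (InnerProductSpace ℂ (UniformSpace.Completion (A ⊗[ℂ] B)))

instance : CompleteSpace (HTensor A B) :=
  inferInstanceAs (CompleteSpace (UniformSpace.Completion (A ⊗[ℂ] B)))

/-- The simple tensor `a ⊗ b`. -/
noncomputable def htmul (a : A) (b : B) : HTensor A B :=
  ((a ⊗ₜ[ℂ] b : A ⊗[ℂ] B) : UniformSpace.Completion (A ⊗[ℂ] B))

theorem completionMap_coe {X Y : Type*} [NormedAddCommGroup X] [InnerProductSpace ℂ X]
    [NormedAddCommGroup Y] [InnerProductSpace ℂ Y] (u : X ≃ₗᵢ[ℂ] Y) (a : X) :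
    UniformSpace.Completion.map u (a : UniformSpace.Completion X) =
      ((u a : Y) : UniformSpace.Completion Y) :=
  UniformSpace.Completion.map_coe u.isometry.uniformContinuous a

theorem completionMap_leftInverse {X Y : Type*} [NormedAddCommGroup X] [InnerProductSpace ℂ X]
    [NormedAddCommGroup Y] [InnerProductSpace ℂ Y] (u : X ≃ₗᵢ[ℂ] Y)
    (x : UniformSpace.Completion X) :
    UniformSpace.Completion.map u.symm (UniformSpace.Completion.map u x) = x := by
  refine UniformSpace.Completion.induction_on x
    (isClosed_eq (UniformSpace.Completion.continuous_map.comp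
      UniformSpace.Completion.continuous_map) continuous_id) fun a => ?_
  rw [completionMap_coe, completionMap_coe, LinearIsometryEquiv.symm_apply_apply]

/-- The extension of a unitary to completions. -/
noncomputable def completionCongr {X Y : Type*} [NormedAddCommGroup X] [InnerProductSpace ℂ X]
    [NormedAddCommGroup Y] [InnerProductSpace ℂ Y] (u : X ≃ₗᵢ[ℂ] Y) :
    UniformSpace.Completion X ≃ₗᵢ[ℂ] UniformSpace.Completion Y where
  toFun := UniformSpace.Completion.map u
  invFun := UniformSpace.Completion.map u.symm
  map_add' x y := by
    have hc : Continuous (UniformSpace.Completion.map u) := UniformSpace.Completion.continuous_map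
    refine UniformSpace.Completion.induction_on₂ x y
      (isClosed_eq (hc.comp continuous_add)
        ((hc.comp continuous_fst).add (hc.comp continuous_snd))) fun a b => ?_
    rw [← UniformSpace.Completion.coe_add, completionMap_coe, completionMap_coe,
      completionMap_coe, map_add, UniformSpace.Completion.coe_add]
  map_smul' c x := by
    have hc : Continuous (UniformSpace.Completion.map u) := UniformSpace.Completion.continuous_map
    refine UniformSpace.Completion.induction_on x
      (isClosed_eq (hc.comp (continuous_const_smul c)) (hc.const_smul c)) fun a => ?_
    rw [← UniformSpace.Completion.coe_smul, completionMap_coe, completionMap_coe, map_smul,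
      UniformSpace.Completion.coe_smul, RingHom.id_apply]
  left_inv := completionMap_leftInverse u
  right_inv := completionMap_leftInverse u.symm
  norm_map' x := by
    change ‖UniformSpace.Completion.map u x‖ = ‖x‖
    refine UniformSpace.Completion.induction_on x
      (isClosed_eq (continuous_norm.comp UniformSpace.Completion.continuous_map)
        continuous_norm) fun a => ?_
    rw [completionMap_coe, UniformSpace.Completion.norm_coe, UniformSpace.Completion.norm_coe,
      LinearIsometryEquiv.norm_map]

/-- The unitary `u ⊗ w`. -/
noncomputable def HTensor.congr (u : A ≃ₗᵢ[ℂ] A') (w : B ≃ₗᵢ[ℂ] B') :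
    HTensor A B ≃ₗᵢ[ℂ] HTensor A' B' :=
  completionCongr (TensorProduct.congrIsometry u w)

/-- Two factorizations of `H` into three factors represent the same tensor product structure
if they differ by a multilocal unitary `u ⊗ v ⊗ w`. -/
def SameTPS {H A B C : Type*} [NormedAddCommGroup H] [InnerProductSpace ℂ H]
    [NormedAddCommGroup A] [InnerProductSpace ℂ A] [NormedAddCommGroup B] [InnerProductSpace ℂ B]
    [NormedAddCommGroup C] [InnerProductSpace ℂ C]
    (T T' : H ≃ₗᵢ[ℂ] HTensor A (HTensor B C)) : Prop :=
  ∃ (u : A ≃ₗᵢ[ℂ] A) (v : B ≃ₗᵢ[ℂ] B) (w : C ≃ₗᵢ[ℂ] C),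
    ∀ x, T' x = HTensor.congr u (HTensor.congr v w) (T x)

/-- The joint fixed vectors of a family of unitaries. -/
def fixedVectors {ι : Type*} (U : ι → A ≃ₗᵢ[ℂ] A) : Submodule ℂ A where
  carrier := {x | ∀ i, U i x = x}
  add_mem' {x y} hx hy i := by rw [map_add, hx i, hy i]
  zero_mem' i := map_zero _
  smul_mem' c x hx i := by rw [map_smul, hx i]

theorem isClosed_fixedVectors {ι : Type*} (U : ι → A ≃ₗᵢ[ℂ] A) :
    IsClosed (fixedVectors U : Set A) := by
  have : (fixedVectors U : Set A) = ⋂ i, {x | U i x = x} := by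
    ext x; simp [fixedVectors]
  rw [this]
  exact isClosed_iInter fun i => isClosed_eq (U i).continuous continuous_id

instance {ι : Type*} [CompleteSpace A] (U : ι → A ≃ₗᵢ[ℂ] A) : CompleteSpace (fixedVectors U) :=
  (isClosed_fixedVectors U).completeSpace_coe

end HilbertTensor

/-! ## Gauge transformations on the links of a finite oriented graph -/

section Links

/-- Normalized Haar measure on a compact group. -/
noncomputable abbrev haarProb (G : Type*) [Group G] [TopologicalSpace G] [IsTopologicalGroup G]
    [CompactSpace G] [MeasurableSpace G] [BorelSpace G] : Measure G :=
  Measure.haarMeasure (⊤ : TopologicalSpace.PositiveCompacts G)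

/-- Product Haar measure on configurations `D → G` of group-valued link variables. -/
noncomputable abbrev haarPi (G D : Type*) [Group G] [TopologicalSpace G] [IsTopologicalGroup G]
    [CompactSpace G] [MeasurableSpace G] [BorelSpace G] [Fintype D] : Measure (D → G) :=
  Measure.pi fun _ : D => haarProb G

/-- The Hilbert space `⨂_{d ∈ D} L²(G) = L²(G^D)`. -/
noncomputable abbrev LinkL2 (G D : Type*) [Group G] [TopologicalSpace G] [IsTopologicalGroup G]
    [CompactSpace G] [MeasurableSpace G] [BorelSpace G] [Fintype D] : Type _ :=
  Lp ℂ 2 (haarPi G D)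

/-- A system of oriented links (group-valued degrees of freedom `D`) between vertices `V`. -/
structure LinkSystem (V D : Type*) where
  src : D → V
  tgt : D → V

variable {V D G : Type*} [Group G]

/-- The action of `h : V → G` on link variables: `a_d ↦ h_{tgt d} a_d h_{src d}⁻¹`. -/
def LinkSystem.act (Γ : LinkSystem V D) (h : V → G) (a : D → G) : D → G :=
  fun d => h (Γ.tgt d) * a d * (h (Γ.src d))⁻¹

theorem LinkSystem.act_comp_act (Γ : LinkSystem V D) (h k : V → G) :
    Γ.act h ∘ Γ.act k = Γ.act (h * k) := by
  funext a d
  simp [LinkSystem.act, mul_assoc]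

theorem LinkSystem.act_one (Γ : LinkSystem V D) : Γ.act (1 : V → G) = id := by
  funext a d
  simp [LinkSystem.act]

variable [TopologicalSpace G] [IsTopologicalGroup G] [CompactSpace G]
  [SecondCountableTopology G] [T2Space G] [MeasurableSpace G] [BorelSpace G] [Fintype D]

instance haarProb_isProbabilityMeasure : IsProbabilityMeasure (haarProb G) :=
  ⟨by simpa using Measure.haarMeasure_self (K₀ := (⊤ : TopologicalSpace.PositiveCompacts G))⟩

instance haarProb_isMulRightInvariant : (haarProb G).IsMulRightInvariant where
  map_mul_right_eq_self g := by
    have : IsProbabilityMeasure (Measure.map (· * g) (haarProb G)) :=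
      Measure.isProbabilityMeasure_map (by fun_prop)
    exact Measure.isHaarMeasure_eq_of_isProbabilityMeasure _ _

theorem LinkSystem.measurePreserving_act (Γ : LinkSystem V D) (h : V → G) :
    MeasurePreserving (Γ.act h) (haarPi G D) (haarPi G D) :=
  measurePreserving_pi (fun _ => haarProb G) (fun _ => haarProb G) fun d =>
    (measurePreserving_mul_right (haarProb G) ((h (Γ.src d))⁻¹)).comp
      (measurePreserving_mul_left (haarProb G) (h (Γ.tgt d)))

theorem LinkSystem.compLp_act_act (Γ : LinkSystem V D) (h k l : V → G) (hl : k * h = l)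
    (ψ : LinkL2 G D) :
    Lp.compMeasurePreserving (Γ.act h) (Γ.measurePreserving_act h)
      (Lp.compMeasurePreserving (Γ.act k) (Γ.measurePreserving_act k) ψ) =
    Lp.compMeasurePreserving (Γ.act l) (Γ.measurePreserving_act l) ψ := by
  subst hl
  have key : ∀ (f : (D → G) → D → G) (hf : MeasurePreserving f (haarPi G D) (haarPi G D)),
      Γ.act k ∘ Γ.act h = f →
      Lp.compMeasurePreserving (Γ.act h) (Γ.measurePreserving_act h)
        (Lp.compMeasurePreserving (Γ.act k) (Γ.measurePreserving_act k) ψ) =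
      Lp.compMeasurePreserving f hf ψ := by
    rintro f hf rfl
    exact (Lp.compMeasurePreserving_comp_apply ψ (Γ.measurePreserving_act k)
      (Γ.measurePreserving_act h)).symm
  exact key _ _ (Γ.act_comp_act k h)

theorem LinkSystem.compLp_act_one (Γ : LinkSystem V D) (l : V → G) (hl : l = 1)
    (ψ : LinkL2 G D) :
    Lp.compMeasurePreserving (Γ.act l) (Γ.measurePreserving_act l) ψ = ψ := by
  subst hl
  have key : ∀ (f : (D → G) → D → G) (hf : MeasurePreserving f (haarPi G D) (haarPi G D)),
      f = id → Lp.compMeasurePreserving f hf ψ = ψ := by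
    rintro f hf rfl
    exact Lp.compMeasurePreserving_id_apply ψ
  exact key _ _ Γ.act_one

/-- The unitary `U(h)` on `L²(G^D)`, `U(h)|a⟩ = |h · a⟩`, i.e. `(U(h)ψ)(a) = ψ(h⁻¹ · a)`. -/
noncomputable def LinkSystem.gaugeU (Γ : LinkSystem V D) (h : V → G) :
    LinkL2 G D ≃ₗᵢ[ℂ] LinkL2 G D where
  toFun ψ := Lp.compMeasurePreservingₗᵢ ℂ (Γ.act h⁻¹) (Γ.measurePreserving_act h⁻¹) ψ
  invFun ψ := Lp.compMeasurePreservingₗᵢ ℂ (Γ.act h) (Γ.measurePreserving_act h) ψ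
  map_add' := map_add _
  map_smul' := map_smul _
  left_inv ψ := (Γ.compLp_act_act h h⁻¹ 1 (inv_mul_cancel h) ψ).trans
    (Γ.compLp_act_one 1 rfl ψ)
  right_inv ψ := (Γ.compLp_act_act h⁻¹ h 1 (mul_inv_cancel h) ψ).trans
    (Γ.compLp_act_one 1 rfl ψ)
  norm_map' := LinearIsometry.norm_map _

theorem LinkSystem.gaugeU_mul (Γ : LinkSystem V D) (h k : V → G) (ψ : LinkL2 G D) :
    Γ.gaugeU (h * k) ψ = Γ.gaugeU h (Γ.gaugeU k ψ) :=
  (Γ.compLp_act_act h⁻¹ k⁻¹ (h * k)⁻¹ (mul_inv_rev h k).symm ψ).symm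

theorem LinkSystem.gaugeU_one (Γ : LinkSystem V D) (ψ : LinkL2 G D) :
    Γ.gaugeU (1 : V → G) ψ = ψ :=
  Γ.compLp_act_one (1 : V → G)⁻¹ inv_one ψ

/-- The states satisfying the Gauss constraint at every vertex of `S`: those invariant under
all gauge transformations supported on `S`. -/
noncomputable abbrev LinkSystem.gauss (Γ : LinkSystem V D) (G : Type*) [Group G] [TopologicalSpace G]
    [IsTopologicalGroup G] [CompactSpace G] [SecondCountableTopology G] [T2Space G]
    [MeasurableSpace G] [BorelSpace G] (S : Set V) : Submodule ℂ (LinkL2 G D) :=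
  fixedVectors fun h : {h : V → G // ∀ v ∉ S, h v = 1} => Γ.gaugeU h.1

theorem LinkSystem.gaugeU_mem_gauss (Γ : LinkSystem V D) (S : Set V) (h : V → G)
    {ψ : LinkL2 G D} (hψ : ψ ∈ Γ.gauss G S) : Γ.gaugeU h ψ ∈ Γ.gauss G S := by
  rintro ⟨k, hk⟩
  have h1 : k * h = h * (h⁻¹ * k * h) := by group
  change Γ.gaugeU k (Γ.gaugeU h ψ) = Γ.gaugeU h ψ
  rw [← Γ.gaugeU_mul, h1, Γ.gaugeU_mul]
  exact congrArg _ (hψ ⟨h⁻¹ * k * h, fun v hv => by simp [hk v hv]⟩)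

/-- The restriction of `U(h)` to the states satisfying the Gauss constraints on `S`. -/
noncomputable def LinkSystem.gaugeUPhys (Γ : LinkSystem V D) (S : Set V) (h : V → G) :
    Γ.gauss G S ≃ₗᵢ[ℂ] Γ.gauss G S where
  toFun ψ := ⟨Γ.gaugeU h ψ, Γ.gaugeU_mem_gauss S h ψ.2⟩
  invFun ψ := ⟨Γ.gaugeU h⁻¹ ψ, Γ.gaugeU_mem_gauss S h⁻¹ ψ.2⟩
  map_add' ψ φ := by ext1; simp
  map_smul' c ψ := by ext1; simp
  left_inv ψ := by
    ext1
    change Γ.gaugeU h⁻¹ (Γ.gaugeU h ψ) = ψ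
    rw [← Γ.gaugeU_mul, inv_mul_cancel, Γ.gaugeU_one]
  right_inv ψ := by
    ext1
    change Γ.gaugeU h (Γ.gaugeU h⁻¹ ψ) = ψ
    rw [← Γ.gaugeU_mul, mul_inv_cancel, Γ.gaugeU_one]
  norm_map' ψ := (Γ.gaugeU h).norm_map ψ

end Links

/-! ## A region of the lattice and its edge-mode frames -/

section Region

/-- The position of a vertex: inside the region, on its corner, outside the region in the bulk, or
on the global boundary of the lattice. -/
inductive VertexKind
  | interior | corner | exterior | boundary
  deriving DecidableEq

/-- The position of an edge: inside the region, on its corner, or in the complement. -/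
inductive EdgeKind
  | interior | corner | exterior
  deriving DecidableEq

/-- A finite region `Σ` with corner `∂Σ` in a lattice with global boundary. -/
structure Region {V E : Type*} (Γ : LinkSystem V E) where
  vk : V → VertexKind
  ek : E → EdgeKind
  interior_edge : ∀ e, ek e = .interior →
    (vk (Γ.src e) = .interior ∨ vk (Γ.src e) = .corner) ∧
    (vk (Γ.tgt e) = .interior ∨ vk (Γ.tgt e) = .corner)
  corner_edge : ∀ e, ek e = .corner → vk (Γ.src e) = .corner ∧ vk (Γ.tgt e) = .corner
  exterior_edge : ∀ e, ek e = .exterior →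
    vk (Γ.src e) ≠ .interior ∧ vk (Γ.tgt e) ≠ .interior

variable {V E : Type*} {Γ : LinkSystem V E}

/-- The corner vertices. -/
abbrev Region.Corner (R : Region Γ) : Type _ := {v : V // R.vk v = .corner}

/-- The vertices of a given kind. -/
def Region.verts (R : Region Γ) (κ : VertexKind) : Set V := {v | R.vk v = κ}

/-- The bulk vertices, i.e. all vertices off the global boundary; these are the vertices at which
small gauge transformations act. -/
def Region.bulk (R : Region Γ) : Set V := {v | R.vk v ≠ .boundary}

/-- The gauge transformation acting by `h` on the corner and trivially elsewhere. -/
def Region.cornerGauge {G : Type*} [Group G] (R : Region Γ) (h : R.Corner → G) : V → G :=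
  fun v => if hv : R.vk v = .corner then h ⟨v, hv⟩ else 1

/-- The corner-uniform gauge transformation `(g, …, g)`. -/
def Region.uniform {G : Type*} [Group G] (R : Region Γ) (g : G) : V → G :=
  R.cornerGauge fun _ => g

/-- The variable of the edge `e` traversed along (`true`) or against (`false`) its orientation. -/
def linkVar {G : Type*} [Group G] (e : E) (along : Bool) (a : E → G) : G :=
  if along then a e else (a e)⁻¹

/-- The edge `e`, traversed along (`true`) or against (`false`) its orientation, leads from
`v` to `w`. -/
def LinkSystem.Joins (Γ : LinkSystem V E) (e : E) (along : Bool) (v w : V) : Prop :=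
  if along then Γ.src e = v ∧ Γ.tgt e = w else Γ.tgt e = v ∧ Γ.src e = w

/-- An extrinsic edge-mode frame: for each corner vertex `v`, a Wilson line in the complement
from the global boundary to `v`, through the nodes `node v 0, …, node v (len v + 1) = v`; no edge
is used twice, neither within a line nor by different lines. -/
structure ExtrinsicFrame (R : Region Γ) where
  len : R.Corner → ℕ
  node : (v : R.Corner) → Fin (len v + 2) → V
  edge : (v : R.Corner) → Fin (len v + 1) → E
  along : (v : R.Corner) → Fin (len v + 1) → Bool
  start : ∀ v, R.vk (node v 0) = .boundary
  finish : ∀ v, node v (Fin.last _) = v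
  exterior : ∀ v i, R.ek (edge v i) = .exterior
  joins : ∀ v i, Γ.Joins (edge v i) (along v i) (node v i.castSucc) (node v i.succ)
  edge_disjoint : Function.Injective fun p : (v : R.Corner) × Fin (len v + 1) => edge p.1 p.2

/-- The Wilson line of the frame from the global boundary to `node v i`:
`g_i ⋯ g_1`, the first edge being the rightmost factor. -/
def ExtrinsicFrame.wilson {G : Type*} [Group G] {R : Region Γ} (Φ : ExtrinsicFrame R)
    (v : R.Corner) (a : E → G) : Fin (Φ.len v + 2) → G :=
  Fin.induction 1 fun i g => linkVar (Φ.edge v i) (Φ.along v i) a * g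

/-- An intrinsic edge-mode frame: a spanning tree of the corner rooted at a corner vertex. Each
other corner vertex is joined by a corner edge to its parent, which is one step closer to
the root along the tree. -/
structure IntrinsicFrame (R : Region Γ) where
  root : R.Corner
  parent : {v : R.Corner // v ≠ root} → R.Corner
  edge : {v : R.Corner // v ≠ root} → E
  along : {v : R.Corner // v ≠ root} → Bool
  corner : ∀ v, R.ek (edge v) = .corner
  joins : ∀ v, Γ.Joins (edge v) (along v) (parent v) v.1
  depth : R.Corner → ℕ
  depth_root : depth root = 0
  depth_parent : ∀ v, depth v.1 = depth (parent v) + 1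

variable [DecidableEq V]

/-- The Wilson line from the root to `v` along the tree, for `v` of depth `n`. -/
def IntrinsicFrame.wilsonAux {G : Type*} [Group G] {R : Region Γ} (Ψ : IntrinsicFrame R)
    (a : E → G) : ℕ → R.Corner → G
  | 0, _ => 1
  | n + 1, v => if hv : v ≠ Ψ.root then
      linkVar (Ψ.edge ⟨v, hv⟩) (Ψ.along ⟨v, hv⟩) a * Ψ.wilsonAux a n (Ψ.parent ⟨v, hv⟩) else 1

/-- The Wilson line from the root to `v` along the tree. -/
def IntrinsicFrame.wilson {G : Type*} [Group G] {R : Region Γ} (Ψ : IntrinsicFrame R)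
    (v : R.Corner) (a : E → G) : G :=
  Ψ.wilsonAux a (Ψ.depth v) v

end Region

/-! ## The refactorized lattice -/

section Refactorized

variable {V E : Type*} {Γ : LinkSystem V E} {R : Region Γ}

/-- The edges inside the region. -/
abbrev Region.IntDof (R : Region Γ) : Type _ := {e : E // R.ek e = .interior}

/-- The corner edges that do not belong to the tree of the intrinsic frame. -/
abbrev IntrinsicFrame.RestDof (Ψ : IntrinsicFrame R) : Type _ :=
  {e : E // R.ek e = .corner ∧ ∀ v, Ψ.edge v ≠ e}

/-- The degrees of freedom of the region other than the intrinsic frame. -/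
abbrev IntrinsicFrame.SubDof (Ψ : IntrinsicFrame R) : Type _ := R.IntDof ⊕ Ψ.RestDof

/-- The degrees of freedom of the complement other than the extrinsic frame: the edges off its
Wilson lines and the intermediate nodes of its Wilson lines. -/
abbrev ExtrinsicFrame.ComplDof (Φ : ExtrinsicFrame R) : Type _ :=
  {e : E // R.ek e = .exterior ∧ ∀ p : (v : R.Corner) × Fin (Φ.len v + 1), Φ.edge p.1 p.2 ≠ e} ⊕
    ((v : R.Corner) × Fin (Φ.len v))

/-- The degrees of freedom of the intrinsic frame, one for each corner vertex but the root. -/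
abbrev IntrinsicFrame.Dof (Ψ : IntrinsicFrame R) : Type _ := {v : R.Corner // v ≠ Ψ.root}

def Region.intLinks (R : Region Γ) : LinkSystem V R.IntDof where
  src e := Γ.src e.1
  tgt e := Γ.tgt e.1

def IntrinsicFrame.restLinks (Ψ : IntrinsicFrame R) : LinkSystem V Ψ.RestDof where
  src e := Γ.src e.1
  tgt e := Γ.tgt e.1

def IntrinsicFrame.subLinks (Ψ : IntrinsicFrame R) : LinkSystem V Ψ.SubDof where
  src := Sum.elim R.intLinks.src Ψ.restLinks.src
  tgt := Sum.elim R.intLinks.tgt Ψ.restLinks.tgt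

/-- A node variable is a Wilson line from the global boundary to its node. -/
def ExtrinsicFrame.complLinks (Φ : ExtrinsicFrame R) : LinkSystem V Φ.ComplDof where
  src := Sum.elim (fun e => Γ.src e.1) fun p => Φ.node p.1 0
  tgt := Sum.elim (fun e => Γ.tgt e.1) fun p => Φ.node p.1 p.2.succ.castSucc

def IntrinsicFrame.links (Ψ : IntrinsicFrame R) : LinkSystem V Ψ.Dof where
  src _ := Ψ.root
  tgt v := v.1

def ExtrinsicFrame.links (Φ : ExtrinsicFrame R) : LinkSystem V R.Corner where
  src v := Φ.node v 0
  tgt v := v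

variable {G : Type*} [Group G] [DecidableEq V]

/-- The new variables as functions of the original link variables. -/
def IntrinsicFrame.subVar (Ψ : IntrinsicFrame R) (a : E → G) : Ψ.SubDof → G :=
  Sum.elim (fun e => a e.1) fun e => a e.1

def ExtrinsicFrame.complVar (Φ : ExtrinsicFrame R) (a : E → G) : Φ.ComplDof → G :=
  Sum.elim (fun e => a e.1) fun p => Φ.wilson p.1 a p.2.succ.castSucc

def IntrinsicFrame.var (Ψ : IntrinsicFrame R) (a : E → G) : Ψ.Dof → G :=
  fun v => Ψ.wilson v.1 a

def ExtrinsicFrame.var (Φ : ExtrinsicFrame R) (a : E → G) : R.Corner → G :=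
  fun v => Φ.wilson v a (Fin.last _)

end Refactorized

/-! ## Hilbert spaces and Page–Wootters reductions -/

section PageWootters

variable {V E : Type*} [Fintype V] [DecidableEq V] [Fintype E] [DecidableEq E]
  {Γ : LinkSystem V E} {R : Region Γ}

section Spaces

variable (G : Type*) [Group G] [TopologicalSpace G] [IsTopologicalGroup G] [CompactSpace G]
  [SecondCountableTopology G] [T2Space G] [MeasurableSpace G] [BorelSpace G]

/-- The physical Hilbert space: the Gauss constraint holds at every bulk vertex. -/
noncomputable abbrev Region.Hphys (R : Region Γ) : Submodule ℂ (LinkL2 G E) := Γ.gauss G R.bulk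

/-- The interior of the region, with the Gauss constraint imposed at the interior vertices. -/
noncomputable abbrev Region.Hint (R : Region Γ) : Submodule ℂ (LinkL2 G R.IntDof) :=
  R.intLinks.gauss G (R.verts .interior)

/-- The region without its intrinsic frame, with the Gauss constraint imposed at the interior
vertices. -/
noncomputable abbrev IntrinsicFrame.Hsub (Ψ : IntrinsicFrame R) : Submodule ℂ (LinkL2 G Ψ.SubDof) :=
  Ψ.subLinks.gauss G (R.verts .interior)

/-- The complement without the extrinsic frame, with the Gauss constraint imposed at the bulk
vertices outside the region. -/
noncomputable abbrev ExtrinsicFrame.Hcompl (Φ : ExtrinsicFrame R) : Submodule ℂ (LinkL2 G Φ.ComplDof) :=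
  Φ.complLinks.gauss G (R.verts .exterior)

/-- The intrinsic frame. -/
abbrev IntrinsicFrame.H (Ψ : IntrinsicFrame R) : Type _ := LinkL2 G Ψ.Dof

/-- The extrinsic frame. -/
abbrev ExtrinsicFrame.H (_Φ : ExtrinsicFrame R) : Type _ := LinkL2 G R.Corner

/-- The states of the extrinsic frame invariant under corner-uniform gauge transformations. -/
noncomputable abbrev ExtrinsicFrame.Hinv (Φ : ExtrinsicFrame R) : Submodule ℂ (Φ.H G) :=
  fixedVectors fun g : G => Φ.links.gaugeU (R.uniform g)

/-- The states of complement and extrinsic frame which are jointly invariant under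
corner-uniform gauge transformations. -/
noncomputable abbrev ExtrinsicFrame.Hout (Φ : ExtrinsicFrame R) :
    Submodule ℂ (HTensor (Φ.Hcompl G) (Φ.H G)) :=
  fixedVectors fun g : G => HTensor.congr
    (Φ.complLinks.gaugeUPhys (R.verts .exterior) (R.uniform g)) (Φ.links.gaugeU (R.uniform g))

/-- The region carries no total charge. -/
def IntrinsicFrame.SubNeutral (Ψ : IntrinsicFrame R) : Prop :=
  ∀ (g : G) (f : Ψ.Hsub G), Ψ.subLinks.gaugeUPhys (R.verts .interior) (R.uniform g) f = f

/-- The complement carries no total charge. -/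
def ExtrinsicFrame.ComplNeutral (Φ : ExtrinsicFrame R) : Prop :=
  ∀ (g : G) (k : Φ.Hcompl G), Φ.complLinks.gaugeUPhys (R.verts .exterior) (R.uniform g) k = k

end Spaces

variable {G : Type*} [Group G] [TopologicalSpace G] [IsTopologicalGroup G] [CompactSpace G]
  [SecondCountableTopology G] [T2Space G] [MeasurableSpace G] [BorelSpace G]

/-- The overlap `(⟨f| ⊗ ⟨k| ⊗ ⟨l| ⊗ ⟨χ|) |ψ⟩` of a kinematical product state in the factorization
sub ⊗ compl ⊗ intrinsic frame ⊗ extrinsic frame with a state of the original lattice. -/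
noncomputable def frameOverlap (Φ : ExtrinsicFrame R) (Ψ : IntrinsicFrame R)
    (f : LinkL2 G Ψ.SubDof) (k : LinkL2 G Φ.ComplDof) (l : Ψ.H G) (χ : Φ.H G)
    (ψ : LinkL2 G E) : ℂ :=
  ∫ a : E → G, conj (f (Ψ.subVar a) * k (Φ.complVar a) * l (Ψ.var a) * χ (Φ.var a)) * ψ a
    ∂(haarPi G E)

/-- `T g = ⟨g|_Φ ⊗ 1` on the physical Hilbert space, where `⟨g|_Φ` is the generalized orientation
state: `g ↦ T g ψ` is the continuous function whose smearings `∫ conj (χ g) T g ψ dg` are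
`(⟨χ|_Φ ⊗ 1) ψ`. The matrix elements are taken with all kinematical product states; their overlap
with an element of the tensor product of the constrained spaces is that of the projections. -/
def IsExtrinsicPW (Φ : ExtrinsicFrame R) (Ψ : IntrinsicFrame R)
    (T : (R.Corner → G) → R.Hphys G → HTensor (Ψ.Hsub G) (HTensor (Φ.Hcompl G) (Ψ.H G))) : Prop :=
  ∀ ψ : R.Hphys G, Continuous (fun g => T g ψ) ∧
    ∀ (f : LinkL2 G Ψ.SubDof) (k : LinkL2 G Φ.ComplDof) (l : Ψ.H G) (χ : Φ.H G),
      ∫ g : R.Corner → G, conj (χ g) *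
          inner ℂ (htmul ((Ψ.Hsub G).orthogonalProjectionOnto f)
            (htmul ((Φ.Hcompl G).orthogonalProjectionOnto k) l)) (T g ψ) ∂(haarPi G R.Corner) =
        frameOverlap Φ Ψ f k l χ ψ

/-- `T g = ⟨g|_Φ̃ ⊗ 1` on the physical Hilbert space, for the intrinsic frame, with values in
`H_sub ⊗ (H_compl ⊗ H_Φ)^inv`. -/
def IsIntrinsicPW (Φ : ExtrinsicFrame R) (Ψ : IntrinsicFrame R)
    (T : (Ψ.Dof → G) → R.Hphys G → HTensor (Ψ.Hsub G) (Φ.Hout G)) : Prop :=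
  ∀ ψ : R.Hphys G, Continuous (fun g => T g ψ) ∧
    ∀ (f : LinkL2 G Ψ.SubDof) (k : LinkL2 G Φ.ComplDof) (l : Ψ.H G) (χ : Φ.H G),
      ∫ g : Ψ.Dof → G, conj (l g) *
          inner ℂ (htmul ((Ψ.Hsub G).orthogonalProjectionOnto f)
            ((Φ.Hout G).orthogonalProjectionOnto
              (htmul ((Φ.Hcompl G).orthogonalProjectionOnto k) χ))) (T g ψ) ∂(haarPi G Ψ.Dof) =
        frameOverlap Φ Ψ f k l χ ψ

end PageWootters

/-! Every Hilbert space involved is realised as a space of square-integrable wave functions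
invariant under a family of measure-preserving maps (`Represents`), and every unitary as composition
with such a map (`Implements`). Tensor products fit this picture by `Represents.tensor`: a function
of two variables that is invariant in each variable separately belongs to the Hilbert tensor product
of the two invariant subspaces.

The lattice variables are rewritten as pairs `(x, q)`, with `q` the frame. This is a change of
variables for Haar measure: every left translation of the new variables is induced by left and right
translations of the links (`exists_translation`), and Haar probability measure is unique. A frame
shift `h` acts by `q ↦ h q`, `x ↦ ρ h x`, so the dressed coordinate `ρ q⁻¹ x` is invariant under it.
A physical state is therefore a function `y` of the dressed coordinate alone
(`exists_comp_dressed`), and the remaining gauge transformations become constraints on `y`. Since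
`ψ(x, q) = y(ρ q⁻¹ x)`, the reduction at `g` is `y ∘ ρ g⁻¹`. It is thus a fixed unitary `ψ ↦ y`
followed by the representation operator of `g`; unitarity, equivariance and continuity in `g`
follow, and continuity makes the smeared values determine it (`exists_pageWootters`).

For the extrinsic frame the gauge group of the corner acts on `q` by all left translations. Dressing
absorbs it, and what remains is an interior transformation seen only by sub and an exterior one seen
only by compl (`extrinsicCoords_dressed_act`).

For the intrinsic frame only the corner transformations off the root are absorbed; the value at the
root survives as a uniform transformation. If `G` is Abelian, a constant transformation does nothing
to a link, so on sub the uniform corner transformation is equivalent to an interior one and is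
already constrained (`subLinks_act_part_mul`). It remains as a joint constraint on compl and the
extrinsic frame. To split this constraint, compl is dressed by the Wilson line of the extrinsic
frame ending at the root (`frameTwist`): afterwards only the extrinsic frame feels the uniform
transformation. Transformations trivial at the root commute with this dressing, so a change of frame
orientation stays multilocal. -/

/-! ### Maps on Hilbert tensor products and isometries with equal range. -/

section HTensorLemmas

variable {A B A' B' H : Type*}
  [NormedAddCommGroup A] [InnerProductSpace ℂ A] [NormedAddCommGroup B] [InnerProductSpace ℂ B]
  [NormedAddCommGroup A'] [InnerProductSpace ℂ A'] [NormedAddCommGroup B'] [InnerProductSpace ℂ B']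
  [NormedAddCommGroup H] [InnerProductSpace ℂ H]

theorem inner_htmul (a a' : A) (b b' : B) :
    inner ℂ (htmul a b) (htmul a' b') = inner ℂ a a' * inner ℂ b b' := by
  change inner ℂ ((a ⊗ₜ[ℂ] b : A ⊗[ℂ] B) : UniformSpace.Completion (A ⊗[ℂ] B))
    ((a' ⊗ₜ[ℂ] b' : A ⊗[ℂ] B) : UniformSpace.Completion (A ⊗[ℂ] B)) = _
  rw [UniformSpace.Completion.inner_coe, TensorProduct.inner_tmul]

/-- The isometric embedding of the algebraic tensor product. -/
noncomputable def HTensor.coeₗᵢ (A B : Type*) [NormedAddCommGroup A] [InnerProductSpace ℂ A]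
    [NormedAddCommGroup B] [InnerProductSpace ℂ B] : A ⊗[ℂ] B →ₗᵢ[ℂ] HTensor A B where
  toFun t := (t : UniformSpace.Completion (A ⊗[ℂ] B))
  map_add' := UniformSpace.Completion.coe_add
  map_smul' := UniformSpace.Completion.coe_smul
  norm_map' := UniformSpace.Completion.norm_coe

theorem HTensor.denseRange_coeₗᵢ : DenseRange (HTensor.coeₗᵢ A B) :=
  UniformSpace.Completion.denseRange_coe (α := A ⊗[ℂ] B)

/-- Two continuous linear maps on a Hilbert tensor product agree if they agree on simple tensors. -/
theorem HTensor.ext_clm {f g : HTensor A B →L[ℂ] H}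
    (h : ∀ a b, f (htmul a b) = g (htmul a b)) (x : HTensor A B) : f x = g x := by
  refine congrFun (HTensor.denseRange_coeₗᵢ.equalizer f.continuous g.continuous ?_) x
  funext t
  change f (HTensor.coeₗᵢ A B t) = g (HTensor.coeₗᵢ A B t)
  induction t with
  | zero => simp
  | tmul a b => exact h a b
  | add x y hx hy => rw [map_add, map_add, map_add, hx, hy]

/-- The isometry of the algebraic tensor product induced by a bilinear map which multiplies inner
products. -/
noncomputable def HTensor.liftAux (m : A →ₗ[ℂ] B →ₗ[ℂ] H)
    (hm : ∀ a b a' b', inner ℂ (m a b) (m a' b') = inner ℂ a a' * inner ℂ b b') :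
    A ⊗[ℂ] B →ₗᵢ[ℂ] H :=
  (TensorProduct.lift m).isometryOfInner fun x y => by
    induction x with
    | zero => simp
    | add x x' hx hx' => rw [map_add, inner_add_left, inner_add_left, hx, hx']
    | tmul a b =>
      induction y with
      | zero => simp
      | add y y' hy hy' => rw [map_add, inner_add_right, inner_add_right, hy, hy']
      | tmul a' b' => rw [TensorProduct.lift.tmul, TensorProduct.lift.tmul, hm,
          TensorProduct.inner_tmul]

theorem HTensor.extend_liftAux [CompleteSpace H] (m : A →ₗ[ℂ] B →ₗ[ℂ] H)
    (hm : ∀ a b a' b', inner ℂ (m a b) (m a' b') = inner ℂ a a' * inner ℂ b b') (t : A ⊗[ℂ] B) :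
    (HTensor.liftAux m hm).toContinuousLinearMap.extend
      (HTensor.coeₗᵢ A B).toContinuousLinearMap (HTensor.coeₗᵢ A B t) =
    HTensor.liftAux m hm t := by
  have h1 : DenseRange (HTensor.coeₗᵢ A B).toContinuousLinearMap := HTensor.denseRange_coeₗᵢ
  have h2 : IsUniformInducing (HTensor.coeₗᵢ A B).toContinuousLinearMap :=
    (HTensor.coeₗᵢ A B).isometry.isUniformInducing
  generalize (HTensor.liftAux m hm) = l
  have := ContinuousLinearMap.extend_eq l.toContinuousLinearMap h1 h2 t
  exact this

/-- The isometry induced by a bilinear map which multiplies inner products. -/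
noncomputable def HTensor.lift [CompleteSpace H] (m : A →ₗ[ℂ] B →ₗ[ℂ] H)
    (hm : ∀ a b a' b', inner ℂ (m a b) (m a' b') = inner ℂ a a' * inner ℂ b b') :
    HTensor A B →ₗᵢ[ℂ] H where
  toLinearMap := ((HTensor.liftAux m hm).toContinuousLinearMap.extend
      (HTensor.coeₗᵢ A B).toContinuousLinearMap).toLinearMap
  norm_map' x := by
    refine congrFun (HTensor.denseRange_coeₗᵢ.equalizer
      (ContinuousLinearMap.continuous _).norm continuous_norm ?_) x
    funext t
    exact (congrArg norm (HTensor.extend_liftAux m hm t)).trans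
      (((HTensor.liftAux m hm).norm_map t).trans ((HTensor.coeₗᵢ A B).norm_map t).symm)

theorem HTensor.lift_htmul [CompleteSpace H] (m : A →ₗ[ℂ] B →ₗ[ℂ] H)
    (hm : ∀ a b a' b', inner ℂ (m a b) (m a' b') = inner ℂ a a' * inner ℂ b b') (a : A) (b : B) :
    HTensor.lift m hm (htmul a b) = m a b :=
  (HTensor.extend_liftAux m hm (a ⊗ₜ[ℂ] b)).trans (TensorProduct.lift.tmul a b)

theorem HTensor.congr_htmul (u : A ≃ₗᵢ[ℂ] A') (w : B ≃ₗᵢ[ℂ] B') (a : A) (b : B) :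
    HTensor.congr u w (htmul a b) = htmul (u a) (w b) :=
  completionMap_coe (TensorProduct.congrIsometry u w) (a ⊗ₜ[ℂ] b)

/-- The restriction to the joint fixed vectors of `U` of a unitary which normalizes them. -/
noncomputable def fixedVectorsRestrict {ι : Type*} (U : ι → A ≃ₗᵢ[ℂ] A) (V : A ≃ₗᵢ[ℂ] A)
    (hV : ∀ i x, V (U i x) = U i (V x)) : fixedVectors U ≃ₗᵢ[ℂ] fixedVectors U where
  toFun x := ⟨V x, fun i => by rw [← hV, x.2 i]⟩
  invFun x := ⟨V.symm x, fun i => V.injective <| by rw [hV, V.apply_symm_apply, x.2 i]⟩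
  map_add' x y := by ext1; simp
  map_smul' c x := by ext1; simp
  left_inv x := by ext1; simp
  right_inv x := by ext1; simp
  norm_map' x := V.norm_map x

/-- Two isometries with the same range differ by a unitary. -/
theorem exists_linearIsometryEquiv_of_range {j : A →ₗᵢ[ℂ] H} {k : B →ₗᵢ[ℂ] H}
    (h : ∀ F, (∃ a, j a = F) ↔ ∃ b, k b = F) : ∃ W : A ≃ₗᵢ[ℂ] B, ∀ a, k (W a) = j a := by
  choose f hf using fun a => (h (j a)).1 ⟨a, rfl⟩
  choose g hg using fun b => (h (k b)).2 ⟨b, rfl⟩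
  refine ⟨{ toFun := f, invFun := g, map_add' := fun x y => k.injective ?_,
            map_smul' := fun c x => k.injective ?_, left_inv := fun x => j.injective ?_,
            right_inv := fun x => k.injective ?_, norm_map' := fun x => ?_ }, hf⟩
  · rw [map_add, hf, hf, hf, map_add]
  · rw [RingHom.id_apply, map_smul, hf, hf, map_smul]
  · rw [hg, hf]
  · rw [hf, hg]
  · change ‖f x‖ = ‖x‖
    rw [← k.norm_map, hf, j.norm_map]

end HTensorLemmas

/-! ### Product wave functions in the L² space of a product measure. -/

section L2Product

variable {X Y Z : Type*} [MeasurableSpace X] [MeasurableSpace Y] [MeasurableSpace Z]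
  {μ : Measure X} {ν : Measure Y} {τ : Measure Z}

theorem inner_Lp_eq_integral (f g : Lp ℂ 2 μ) : inner ℂ f g = ∫ x, conj (f x) * g x ∂μ := by
  rw [L2.inner_def]
  simp only [RCLike.inner_apply, mul_comm]

theorem comp_fst_ae_eq {f g : X → ℂ} (h : f =ᵐ[μ] g) :
    (fun p : X × Y => f p.1) =ᵐ[μ.prod ν] fun p => g p.1 :=
  Measure.quasiMeasurePreserving_fst.ae_eq_comp h

theorem comp_snd_ae_eq {f g : Y → ℂ} (h : f =ᵐ[ν] g) :
    (fun p : X × Y => f p.2) =ᵐ[μ.prod ν] fun p => g p.2 :=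
  Measure.quasiMeasurePreserving_snd.ae_eq_comp h

theorem memLp_two_mul_prod {f : X → ℂ} {g : Y → ℂ} (hf : MemLp f 2 μ) (hg : MemLp g 2 ν) :
    MemLp (fun p : X × Y => f p.1 * g p.2) 2 (μ.prod ν) := by
  have hm : AEStronglyMeasurable (fun p : X × Y => f p.1 * g p.2) (μ.prod ν) :=
    hf.1.comp_fst.mul hg.1.comp_snd
  rw [memLp_two_iff_integrable_sq_norm hm]
  have h1 := (memLp_two_iff_integrable_sq_norm hf.1).1 hf
  have h2 := (memLp_two_iff_integrable_sq_norm hg.1).1 hg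
  refine (h1.mul_prod h2).congr (Filter.Eventually.of_forall fun p => ?_)
  simp [mul_pow]

variable [IsProbabilityMeasure μ] [IsProbabilityMeasure ν] [IsProbabilityMeasure τ]

/-- The product wave function `f(x) g(y)`, as a bilinear map. -/
noncomputable def l2mul (μ : Measure X) (ν : Measure Y) [IsProbabilityMeasure μ]
    [IsProbabilityMeasure ν] : Lp ℂ 2 μ →ₗ[ℂ] Lp ℂ 2 ν →ₗ[ℂ] Lp ℂ 2 (μ.prod ν) :=
  LinearMap.mk₂ ℂ (fun f g => (memLp_two_mul_prod (Lp.memLp f) (Lp.memLp g)).toLp _)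
    (fun f f' g => by
      rw [← MemLp.toLp_add]
      refine MemLp.toLp_congr _ _ ?_
      filter_upwards [comp_fst_ae_eq (ν := ν) (Lp.coeFn_add f f')] with p hp
      rw [hp]; simp [add_mul])
    (fun c f g => by
      rw [← MemLp.toLp_const_smul]
      refine MemLp.toLp_congr _ _ ?_
      filter_upwards [comp_fst_ae_eq (ν := ν) (Lp.coeFn_smul c f)] with p hp
      rw [hp]; simp [mul_assoc])
    (fun f g g' => by
      rw [← MemLp.toLp_add]
      refine MemLp.toLp_congr _ _ ?_
      filter_upwards [comp_snd_ae_eq (μ := μ) (Lp.coeFn_add g g')] with p hp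
      rw [hp]; simp [mul_add])
    (fun c f g => by
      rw [← MemLp.toLp_const_smul]
      refine MemLp.toLp_congr _ _ ?_
      filter_upwards [comp_snd_ae_eq (μ := μ) (Lp.coeFn_smul c g)] with p hp
      rw [hp]; simp [mul_left_comm])

theorem coeFn_l2mul (f : Lp ℂ 2 μ) (g : Lp ℂ 2 ν) :
    (l2mul μ ν f g : X × Y → ℂ) =ᵐ[μ.prod ν] fun p => f p.1 * g p.2 :=
  (memLp_two_mul_prod (Lp.memLp f) (Lp.memLp g)).coeFn_toLp

theorem inner_l2mul (f f' : Lp ℂ 2 μ) (g g' : Lp ℂ 2 ν) :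
    inner ℂ (l2mul μ ν f g) (l2mul μ ν f' g') = inner ℂ f f' * inner ℂ g g' := by
  rw [inner_Lp_eq_integral, inner_Lp_eq_integral, inner_Lp_eq_integral, ← integral_prod_mul]
  refine integral_congr_ae ?_
  filter_upwards [coeFn_l2mul f g, coeFn_l2mul f' g'] with p h1 h2
  rw [h1, h2, map_mul]; ring

theorem norm_l2mul (f : Lp ℂ 2 μ) (g : Lp ℂ 2 ν) : ‖l2mul μ ν f g‖ = ‖f‖ * ‖g‖ := by
  have h := inner_l2mul f f g g
  rw [inner_self_eq_norm_sq_to_K, inner_self_eq_norm_sq_to_K, inner_self_eq_norm_sq_to_K] at h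
  have h' : ‖l2mul μ ν f g‖ ^ 2 = (‖f‖ * ‖g‖) ^ 2 := by
    rw [mul_pow]; exact_mod_cast h
  exact (pow_left_inj₀ (norm_nonneg _) (by positivity) two_ne_zero).1 h'

/-- The product wave function, as a continuous function of its second factor. -/
noncomputable def l2mulL (f : Lp ℂ 2 μ) : Lp ℂ 2 ν →L[ℂ] Lp ℂ 2 (μ.prod ν) :=
  (l2mul μ ν f).mkContinuous ‖f‖ fun g => (norm_l2mul f g).le

/-- The product wave function, as a continuous function of its first factor. -/
noncomputable def l2mulR (g : Lp ℂ 2 ν) : Lp ℂ 2 μ →L[ℂ] Lp ℂ 2 (μ.prod ν) :=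
  ((l2mul μ ν).flip g).mkContinuous ‖g‖ fun f => ((norm_l2mul f g).trans (mul_comm _ _)).le

theorem l2mulL_apply (f : Lp ℂ 2 μ) (g : Lp ℂ 2 ν) : l2mulL f g = l2mul μ ν f g := rfl

theorem l2mulR_apply (f : Lp ℂ 2 μ) (g : Lp ℂ 2 ν) : l2mulR g f = l2mul μ ν f g := rfl

/-- Product wave functions are total. -/
theorem eq_zero_of_inner_l2mul (F : Lp ℂ 2 (μ.prod ν))
    (h : ∀ f g, inner ℂ (l2mul μ ν f g) F = 0) : F = 0 := by
  have hint : Integrable F (μ.prod ν) := (Lp.memLp F).integrable one_le_two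
  -- Testing with indicator functions gives vanishing integrals over rectangles; the π-λ theorem
  -- extends this to all measurable sets. Complements are covered because the whole space is itself
  -- a rectangle.
  have hrect : ∀ s t, MeasurableSet s → MeasurableSet t →
      ∫ p in s ×ˢ t, F p ∂(μ.prod ν) = 0 := by
    intro s t hs ht
    rw [← h (indicatorConstLp 2 hs (measure_ne_top μ s) 1)
      (indicatorConstLp 2 ht (measure_ne_top ν t) 1), inner_Lp_eq_integral,
      ← integral_indicator (hs.prod ht)]
    refine integral_congr_ae ?_
    filter_upwards [coeFn_l2mul (indicatorConstLp 2 hs (measure_ne_top μ s) (1 : ℂ))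
      (indicatorConstLp 2 ht (measure_ne_top ν t) (1 : ℂ)),
      comp_fst_ae_eq (ν := ν) (indicatorConstLp_coeFn (p := 2) (hs := hs)
        (hμs := measure_ne_top μ s) (c := (1 : ℂ))),
      comp_snd_ae_eq (μ := μ) (indicatorConstLp_coeFn (p := 2) (hs := ht)
        (hμs := measure_ne_top ν t) (c := (1 : ℂ)))] with p h1 h2 h3
    rw [h1, h2, h3]
    by_cases hp1 : p.1 ∈ s <;> by_cases hp2 : p.2 ∈ t <;> simp [Set.indicator, hp1, hp2]
  have hall : ∀ S, MeasurableSet S → ∫ p in S, F p ∂(μ.prod ν) = 0 := by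
    intro S hS
    induction S, hS using MeasurableSpace.induction_on_inter generateFrom_prod.symm
      isPiSystem_prod with
    | empty => simp
    | basic S hS =>
      obtain ⟨s, hs, t, ht, rfl⟩ := hS
      exact hrect s t hs ht
    | compl S hS ih =>
      have := integral_add_compl hS hint
      rw [ih, zero_add] at this
      rw [this, ← setIntegral_univ, ← Set.univ_prod_univ, hrect _ _ .univ .univ]
    | iUnion f hd hf ih =>
      rw [integral_iUnion hf hd hint.integrableOn]
      simp [ih]
  refine Lp.ext ?_
  refine (hint.ae_eq_zero_of_forall_setIntegral_eq_zero fun S hS _ => hall S hS).trans ?_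
  exact (Lp.coeFn_zero ℂ 2 _).symm

/-- Triple product wave functions are total. -/
theorem eq_zero_of_inner_l2mul_l2mul (F : Lp ℂ 2 (μ.prod (ν.prod τ)))
    (h : ∀ f g k, inner ℂ (l2mul μ (ν.prod τ) f (l2mul ν τ g k)) F = 0) : F = 0 := by
  refine eq_zero_of_inner_l2mul F fun f G => ?_
  -- Contracting `F` with `f` in the first variable leaves a function of two variables, to which the
  -- two-factor statement applies.
  have : (l2mulL f).adjoint F = 0 := eq_zero_of_inner_l2mul _ fun g k => by
    rw [ContinuousLinearMap.adjoint_inner_right]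
    exact h f g k
  rw [← l2mulL_apply, ← ContinuousLinearMap.adjoint_inner_right, this, inner_zero_right]

end L2Product

/-! ### Hilbert spaces as invariant wave functions; tensor products of such representations. -/

section Representation

/-- If `m` intertwines isometries `U i` and `U' i`, then a vector fixed by all `U' i` which is
orthogonal to the image of the fixed vectors of `U` is orthogonal to the range of `m`. -/
theorem inner_eq_zero_of_fixed {H H' I : Type*} [NormedAddCommGroup H] [InnerProductSpace ℂ H]
    [CompleteSpace H] [NormedAddCommGroup H'] [InnerProductSpace ℂ H'] [CompleteSpace H']
    (m : H →L[ℂ] H') (U : I → H →ₗᵢ[ℂ] H) (U' : I → H' →ₗᵢ[ℂ] H')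
    (hm : ∀ i a, m (U i a) = U' i (m a)) {F : H'} (hF : ∀ i, U' i F = F)
    (h : ∀ a, (∀ i, U i a = a) → inner ℂ (m a) F = 0) (a : H) : inner ℂ (m a) F = 0 := by
  -- The contraction `m† F` is itself fixed, so it may be used as the test vector `a` and yields
  -- `‖m† F‖² = 0`. As the `U i` are only isometries, its invariance is read off from `‖U m† F - m†
  -- F‖² = 0` and not from a relation between adjoints.
  have hz : ∀ i, U i (m.adjoint F) = m.adjoint F := by
    intro i
    have key : inner ℂ (U i (m.adjoint F)) (m.adjoint F) =
        inner ℂ (m.adjoint F) (m.adjoint F) := by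
      rw [ContinuousLinearMap.adjoint_inner_right, ContinuousLinearMap.adjoint_inner_right, hm,
        ← (U' i).inner_map_map (m _) F, hF]
    have key' : inner ℂ (m.adjoint F) (U i (m.adjoint F)) =
        inner ℂ (m.adjoint F) (m.adjoint F) := by
      rw [← inner_conj_symm, key, inner_conj_symm]
    rw [← sub_eq_zero, ← inner_self_eq_zero (𝕜 := ℂ), inner_sub_left, inner_sub_right,
      inner_sub_right, (U i).inner_map_map, key, key']
    ring
  have h0 : m.adjoint F = 0 := by
    rw [← inner_self_eq_zero (𝕜 := ℂ), ContinuousLinearMap.adjoint_inner_right]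
    exact h _ hz
  rw [← ContinuousLinearMap.adjoint_inner_right, h0, inner_zero_right]

variable {X Y : Type*} [MeasurableSpace X] [MeasurableSpace Y] {μ : Measure X} {ν : Measure Y}
  {A B I J : Type*} [NormedAddCommGroup A] [InnerProductSpace ℂ A]
  [NormedAddCommGroup B] [InnerProductSpace ℂ B]

/-- The isometry `ι` identifies a Hilbert space with the wave functions which are invariant under
composition with all maps of the family `u`. -/
def Represents (ι : A →ₗᵢ[ℂ] Lp ℂ 2 μ) (u : I → X → X) : Prop :=
  ∀ F : Lp ℂ 2 μ, (∃ a, ι a = F) ↔ ∀ i, F ∘ u i =ᵐ[μ] F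

/-- In the representation `ι`, the map `V` is composition with `r`. -/
def Implements (ι : A →ₗᵢ[ℂ] Lp ℂ 2 μ) (V : A → A) (r : X → X) : Prop :=
  ∀ a, ι (V a) =ᵐ[μ] ι a ∘ r

/-- Composition with a measure-preserving map. -/
noncomputable abbrev compL {r : X → Y} (hr : MeasurePreserving r μ ν) :
    Lp ℂ 2 ν →ₗᵢ[ℂ] Lp ℂ 2 μ :=
  Lp.compMeasurePreservingₗᵢ ℂ r hr

theorem coeFn_compL {r : X → Y} (hr : MeasurePreserving r μ ν) (F : Lp ℂ 2 ν) :
    compL hr F =ᵐ[μ] F ∘ r :=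
  Lp.coeFn_compMeasurePreserving F hr

theorem compL_eq_iff {r : X → Y} (hr : MeasurePreserving r μ ν) (F : Lp ℂ 2 ν) (F' : Lp ℂ 2 μ) :
    compL hr F = F' ↔ F ∘ r =ᵐ[μ] F' :=
  ⟨fun h => (coeFn_compL hr F).symm.trans (h ▸ Filter.EventuallyEq.rfl),
    fun h => Lp.ext ((coeFn_compL hr F).trans h)⟩

theorem Implements.eq_compL {ι : A →ₗᵢ[ℂ] Lp ℂ 2 μ} {V : A → A} {r : X → X}
    (h : Implements ι V r) (hr : MeasurePreserving r μ μ) (a : A) : ι (V a) = compL hr (ι a) :=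
  Lp.ext ((h a).trans (coeFn_compL hr _).symm)

/-- The joint fixed vectors of unitaries, which are implemented by maps, are again represented by
invariant wave functions. -/
theorem Represents.fixedVectors {ι : A →ₗᵢ[ℂ] Lp ℂ 2 μ} {u : I → X → X} (h : Represents ι u)
    {V : J → A ≃ₗᵢ[ℂ] A} {v : J → X → X} (hV : ∀ j, Implements ι (V j) (v j)) :
    Represents (ι.comp (fixedVectors V).subtypeₗᵢ) (Sum.elim u v) := by
  intro F
  constructor
  · rintro ⟨a, rfl⟩
    rintro (i | j)
    · exact (h _).1 ⟨a, rfl⟩ i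
    · refine (hV j a).symm.trans ?_
      rw [show V j a = a from a.2 j]
      rfl
  · intro hF
    obtain ⟨a, rfl⟩ := (h F).2 fun i => hF (Sum.inl i)
    exact ⟨⟨a, fun j => ι.injective (Lp.ext ((hV j a).trans (hF (Sum.inr j))))⟩, rfl⟩

theorem represents_id : Represents (LinearIsometry.id : Lp ℂ 2 μ →ₗᵢ[ℂ] Lp ℂ 2 μ)
    (Empty.elim : Empty → X → X) :=
  fun F => ⟨fun _ => Empty.rec, fun _ => ⟨F, rfl⟩⟩

/-- `k` represents the functional `⟪F, ι ·⟫`. -/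
def IsDual (ι : A →ₗᵢ[ℂ] Lp ℂ 2 μ) (F : Lp ℂ 2 μ) (k : A) : Prop :=
  ∀ a, inner ℂ k a = inner ℂ F (ι a)

theorem isDual_id (F : Lp ℂ 2 μ) :
    IsDual (LinearIsometry.id : Lp ℂ 2 μ →ₗᵢ[ℂ] Lp ℂ 2 μ) F F := fun _ => rfl

/-- A physical state pairs with a kinematical one only through the projection of the latter. This is
the source of the projections in the matrix elements of `IsExtrinsicPW` and `IsIntrinsicPW`. -/
theorem isDual_orthogonalProjection (S : Submodule ℂ (Lp ℂ 2 μ)) [S.HasOrthogonalProjection]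
    (F : Lp ℂ 2 μ) : IsDual S.subtypeₗᵢ F (S.orthogonalProjectionOnto F) := fun a =>
  Submodule.inner_orthogonalProjectionOnto_eq_of_mem_right a F

theorem IsDual.restrict {ι : A →ₗᵢ[ℂ] Lp ℂ 2 μ} {F : Lp ℂ 2 μ} {k : A} (h : IsDual ι F k)
    (S : Submodule ℂ A) [S.HasOrthogonalProjection] :
    IsDual (ι.comp S.subtypeₗᵢ) F (S.orthogonalProjectionOnto k) := fun a =>
  (Submodule.inner_orthogonalProjectionOnto_eq_of_mem_right a k).trans (h a)

variable [IsProbabilityMeasure μ] [IsProbabilityMeasure ν]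

theorem compL_l2mul {r : X → X} {s : Y → Y} (hr : MeasurePreserving r μ μ)
    (hs : MeasurePreserving s ν ν) (f : Lp ℂ 2 μ) (g : Lp ℂ 2 ν) :
    compL (hr.prod hs) (l2mul μ ν f g) = l2mul μ ν (compL hr f) (compL hs g) := by
  refine Lp.ext ?_
  filter_upwards [coeFn_compL (hr.prod hs) (l2mul μ ν f g),
    (hr.prod hs).quasiMeasurePreserving.ae_eq_comp (coeFn_l2mul f g),
    coeFn_l2mul (compL hr f) (compL hs g), comp_fst_ae_eq (ν := ν) (coeFn_compL hr f),
    comp_snd_ae_eq (μ := μ) (coeFn_compL hs g)] with p h1 h2 h3 h4 h5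
  rw [h1, h2, h3, h4, h5]
  rfl

/-- The representation of a Hilbert tensor product by functions of two variables. -/
noncomputable def tensorRep (ι : A →ₗᵢ[ℂ] Lp ℂ 2 μ) (κ : B →ₗᵢ[ℂ] Lp ℂ 2 ν) :
    HTensor A B →ₗᵢ[ℂ] Lp ℂ 2 (μ.prod ν) :=
  HTensor.lift ((l2mul μ ν).compl₁₂ ι.toLinearMap κ.toLinearMap) fun a b a' b' => by
    change inner ℂ (l2mul μ ν (ι a) (κ b)) (l2mul μ ν (ι a') (κ b')) = _
    rw [inner_l2mul, ι.inner_map_map, κ.inner_map_map]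

theorem tensorRep_htmul (ι : A →ₗᵢ[ℂ] Lp ℂ 2 μ) (κ : B →ₗᵢ[ℂ] Lp ℂ 2 ν) (a : A) (b : B) :
    tensorRep ι κ (htmul a b) = l2mul μ ν (ι a) (κ b) :=
  HTensor.lift_htmul _ _ a b

theorem Implements.tensor {ι : A →ₗᵢ[ℂ] Lp ℂ 2 μ} {κ : B →ₗᵢ[ℂ] Lp ℂ 2 ν}
    {U : A ≃ₗᵢ[ℂ] A} {V : B ≃ₗᵢ[ℂ] B} {r : X → X} {s : Y → Y}
    (hU : Implements ι U r) (hV : Implements κ V s)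
    (hr : MeasurePreserving r μ μ) (hs : MeasurePreserving s ν ν) :
    Implements (tensorRep ι κ) (HTensor.congr U V) (Prod.map r s) := by
  intro x
  refine ((compL_eq_iff (hr.prod hs) _ _).1 (Eq.symm ?_)).symm
  refine HTensor.ext_clm
    (f := (tensorRep ι κ).toContinuousLinearMap.comp
      (HTensor.congr U V).toLinearIsometry.toContinuousLinearMap)
    (g := (compL (hr.prod hs)).toContinuousLinearMap.comp
      (tensorRep ι κ).toContinuousLinearMap) (fun a b => ?_) x
  change tensorRep ι κ (HTensor.congr U V (htmul a b)) =
    compL (hr.prod hs) (tensorRep ι κ (htmul a b))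
  rw [HTensor.congr_htmul, tensorRep_htmul, tensorRep_htmul, compL_l2mul, hU.eq_compL hr,
    hV.eq_compL hs]

/-- The substantial direction is that invariant functions lie in the range. The component of such a
function orthogonal to the range is still invariant and is orthogonal to products of invariant
functions; `inner_eq_zero_of_fixed`, applied once in each variable, makes it orthogonal to all
products, hence zero. No averaging is involved, so the families of maps need not be groups. -/
theorem Represents.tensor [CompleteSpace A] [CompleteSpace B]
    {ι : A →ₗᵢ[ℂ] Lp ℂ 2 μ} {κ : B →ₗᵢ[ℂ] Lp ℂ 2 ν}
    {u : I → X → X} {v : J → Y → Y} (hι : Represents ι u) (hκ : Represents κ v)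
    (hu : ∀ i, MeasurePreserving (u i) μ μ) (hv : ∀ j, MeasurePreserving (v j) ν ν) :
    Represents (tensorRep ι κ)
      (Sum.elim (fun i => Prod.map (u i) id) fun j => Prod.map id (v j)) := by
  have hu' := fun i => (hu i).prod (MeasurePreserving.id ν)
  have hv' := fun j => (MeasurePreserving.id μ).prod (hv j)
  have hid : ∀ g : Lp ℂ 2 ν, compL (MeasurePreserving.id ν) g = g := Lp.compMeasurePreserving_id_apply
  have hid' : ∀ f : Lp ℂ 2 μ, compL (MeasurePreserving.id μ) f = f :=
    Lp.compMeasurePreserving_id_apply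
  have hfix : ∀ (x : HTensor A B), (∀ i, compL (hu' i) (tensorRep ι κ x) = tensorRep ι κ x) ∧
      ∀ j, compL (hv' j) (tensorRep ι κ x) = tensorRep ι κ x := by
    refine fun x => ⟨fun i => ?_, fun j => ?_⟩
    · refine HTensor.ext_clm
        (f := (compL (hu' i)).toContinuousLinearMap.comp (tensorRep ι κ).toContinuousLinearMap)
        (g := (tensorRep ι κ).toContinuousLinearMap) (fun a b => ?_) x
      change compL (hu' i) (tensorRep ι κ (htmul a b)) = tensorRep ι κ (htmul a b)
      rw [tensorRep_htmul, compL_l2mul (hu i) (.id ν), hid, (compL_eq_iff (hu i) _ _).2 ((hι _).1 ⟨a, rfl⟩ i)]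
    · refine HTensor.ext_clm
        (f := (compL (hv' j)).toContinuousLinearMap.comp (tensorRep ι κ).toContinuousLinearMap)
        (g := (tensorRep ι κ).toContinuousLinearMap) (fun a b => ?_) x
      change compL (hv' j) (tensorRep ι κ (htmul a b)) = tensorRep ι κ (htmul a b)
      rw [tensorRep_htmul, compL_l2mul (.id μ) (hv j), hid', (compL_eq_iff (hv j) _ _).2 ((hκ _).1 ⟨b, rfl⟩ j)]
  intro F
  constructor
  · rintro ⟨x, rfl⟩
    rintro (i | j)
    · exact (compL_eq_iff (hu' i) _ _).1 ((hfix x).1 i)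
    · exact (compL_eq_iff (hv' j) _ _).1 ((hfix x).2 j)
  · intro hF
    -- The range of an isometry of a complete space is closed, so `F` can be projected onto it.
    let S : Submodule ℂ (Lp ℂ 2 (μ.prod ν)) := LinearMap.range (tensorRep ι κ).toLinearMap
    have hS : IsClosed (S : Set (Lp ℂ 2 (μ.prod ν))) := by
      change IsClosed (Set.range (tensorRep ι κ))
      exact (tensorRep ι κ).isometry.isClosedEmbedding.isClosed_range
    have : CompleteSpace S := hS.completeSpace_coe
    obtain ⟨x, hx⟩ : S.starProjection F ∈ S := S.starProjection_apply_mem F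
    change tensorRep ι κ x = _ at hx
    have hG : F - S.starProjection F = 0 := by
      have hGu : ∀ i, compL (hu' i) (F - S.starProjection F) = F - S.starProjection F := fun i => by
        rw [map_sub, ← hx, (hfix x).1 i, (compL_eq_iff (hu' i) F F).2 (hF (Sum.inl i))]
      have hGv : ∀ j, compL (hv' j) (F - S.starProjection F) = F - S.starProjection F := fun j => by
        rw [map_sub, ← hx, (hfix x).2 j, (compL_eq_iff (hv' j) F F).2 (hF (Sum.inr j))]
      have hperp : ∀ y, inner ℂ (tensorRep ι κ y) (F - S.starProjection F) = 0 := fun y =>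
        (Submodule.sub_starProjection_mem_orthogonal (K := S) F) _ ⟨y, rfl⟩
      generalize F - S.starProjection F = F₀ at hGu hGv hperp
      refine eq_zero_of_inner_l2mul F₀ fun f g => ?_
      rw [← l2mulR_apply]
      -- With `g` fixed this reduces to invariant `f`; the same is then done with `f` fixed to
      -- reduce to invariant `g`.
      refine inner_eq_zero_of_fixed (l2mulR g) (fun i => compL (hu i)) (fun i => compL (hu' i))
        (fun i f => by rw [l2mulR_apply, l2mulR_apply, compL_l2mul (hu i) (.id ν), hid]) hGu (fun f hf => ?_) f
      rw [l2mulR_apply, ← l2mulL_apply]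
      refine inner_eq_zero_of_fixed (l2mulL f) (fun j => compL (hv j)) (fun j => compL (hv' j))
        (fun j g => by rw [l2mulL_apply, l2mulL_apply, compL_l2mul (.id μ) (hv j), hid']) hGv (fun g hg => ?_) g
      obtain ⟨a, rfl⟩ := (hι f).2 fun i => (compL_eq_iff (hu i) f f).1 (hf i)
      obtain ⟨b, rfl⟩ := (hκ g).2 fun j => (compL_eq_iff (hv j) g g).1 (hg j)
      rw [l2mulL_apply, ← tensorRep_htmul]
      exact hperp _
    exact ⟨x, by rw [hx, ← sub_eq_zero, ← neg_sub, hG, neg_zero]⟩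

theorem IsDual.tensor {ι : A →ₗᵢ[ℂ] Lp ℂ 2 μ} {κ : B →ₗᵢ[ℂ] Lp ℂ 2 ν} {F : Lp ℂ 2 μ}
    {G : Lp ℂ 2 ν} {a : A} {b : B} (hF : IsDual ι F a) (hG : IsDual κ G b) :
    IsDual (tensorRep ι κ) (l2mul μ ν F G) (htmul a b) := fun x => by
  refine HTensor.ext_clm (f := innerSL ℂ (htmul a b))
    (g := (innerSL ℂ (l2mul μ ν F G)).comp (tensorRep ι κ).toContinuousLinearMap)
    (fun a' b' => ?_) x
  change inner ℂ (htmul a b) (htmul a' b') = inner ℂ (l2mul μ ν F G) (tensorRep ι κ (htmul a' b'))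
  rw [inner_htmul, tensorRep_htmul, inner_l2mul, hF, hG]

end Representation

/-! ### Abstract reduction relative to a reference frame. -/

section FrameReduction

/-- Coordinates `(x, q)` on a probability space `α`, where `q` takes values in a group `Q` (the
orientations of a reference frame) which acts on the values of `x`. -/
structure FrameCoords {α X Q : Type*} [MeasurableSpace α] [MeasurableSpace X] [MeasurableSpace Q]
    [Group Q] (m : Measure α) (μ : Measure X) (ν : Measure Q) where
  x : α → X
  q : α → Q
  measurePreserving : MeasurePreserving (fun a => (x a, q a)) m (μ.prod ν)
  measurableEmbedding : MeasurableEmbedding fun a => (x a, q a)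
  ρ : Q → X → X
  ρ_mul : ∀ h k y, ρ (h * k) y = ρ h (ρ k y)
  ρ_one : ∀ y, ρ 1 y = y
  measurable_ρ : Measurable (Function.uncurry ρ)
  measurePreserving_ρ : ∀ h, MeasurePreserving (ρ h) μ μ

namespace FrameCoords

variable {α X Q : Type*} [MeasurableSpace α] [MeasurableSpace X] [MeasurableSpace Q]
    [Group Q] {m : Measure α} {μ : Measure X} {ν : Measure Q} (fr : FrameCoords m μ ν)

theorem ρ_inv_ρ (h : Q) (y : X) : fr.ρ h⁻¹ (fr.ρ h y) = y := by
  rw [← fr.ρ_mul, inv_mul_cancel, fr.ρ_one]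

theorem ρ_ρ_inv (h : Q) (y : X) : fr.ρ h (fr.ρ h⁻¹ y) = y := by
  rw [← fr.ρ_mul, mul_inv_cancel, fr.ρ_one]

/-- The coordinates `x` relative to the frame. -/
def dressed (a : α) : X := fr.ρ (fr.q a)⁻¹ (fr.x a)

/-- The factor `h` acquired by `x` is cancelled by the one in `(h q)⁻¹ = q⁻¹ h⁻¹`. -/
theorem dressed_of_shift {s : α → α} {h : Q}
    (hs : ∀ a, fr.x (s a) = fr.ρ h (fr.x a) ∧ fr.q (s a) = h * fr.q a) (a : α) :
    fr.dressed (s a) = fr.dressed a := by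
  rw [dressed, (hs a).1, (hs a).2, mul_inv_rev, fr.ρ_mul, fr.ρ_inv_ρ]
  rfl

variable [MeasurableInv Q]

/-- The passage to relative coordinates. -/
def untwist : X × Q ≃ᵐ X × Q where
  toFun p := (fr.ρ p.2⁻¹ p.1, p.2)
  invFun p := (fr.ρ p.2 p.1, p.2)
  left_inv p := by simp [fr.ρ_ρ_inv]
  right_inv p := by simp [fr.ρ_inv_ρ]
  measurable_toFun := (fr.measurable_ρ.comp
    (measurable_snd.inv.prodMk measurable_fst)).prodMk measurable_snd
  measurable_invFun := (fr.measurable_ρ.comp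
    (measurable_snd.prodMk measurable_fst)).prodMk measurable_snd

theorem measurableEmbedding_dressed :
    MeasurableEmbedding fun a => (fr.dressed a, fr.q a) :=
  fr.untwist.measurableEmbedding.comp fr.measurableEmbedding

variable [IsProbabilityMeasure μ] [IsProbabilityMeasure ν]

/-- At fixed orientation `q` the map on `x` is `ρ q⁻¹`, which preserves `μ`; the whole is a skew
product once the factors are swapped. -/
theorem measurePreserving_untwist : MeasurePreserving fr.untwist (μ.prod ν) (μ.prod ν) := by
  have h : MeasurePreserving (fun p : Q × X => (p.1, fr.ρ p.1⁻¹ p.2)) (ν.prod μ) (ν.prod μ) :=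
    (MeasurePreserving.id ν).skew_product (g := fun q y => fr.ρ q⁻¹ y)
      (fr.measurable_ρ.comp (measurable_fst.inv.prodMk measurable_snd))
      (Filter.Eventually.of_forall fun q => (fr.measurePreserving_ρ q⁻¹).map_eq)
  exact Measure.measurePreserving_swap.comp (h.comp Measure.measurePreserving_swap)

theorem measurePreserving_dressed_prod :
    MeasurePreserving (fun a => (fr.dressed a, fr.q a)) m (μ.prod ν) :=
  fr.measurePreserving_untwist.comp fr.measurePreserving

theorem measurePreserving_dressed : MeasurePreserving fr.dressed m μ :=
  measurePreserving_fst.comp fr.measurePreserving_dressed_prod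

/-- The dressed coordinate forgets `q`, so it is not an embedding; measurability of the set is what
allows the statement to descend along the pushforward. -/
theorem ae_of_ae_dressed {p : X → Prop} (hp : MeasurableSet {y | p y})
    (h : ∀ᵐ a ∂m, p (fr.dressed a)) : ∀ᵐ y ∂μ, p y := by
  rw [← fr.measurePreserving_dressed.map_eq]
  exact (ae_map_iff fr.measurePreserving_dressed.aemeasurable hp).2 h

variable {K I J : Type*} [NormedAddCommGroup K] [InnerProductSpace ℂ K]

/-- Smearing the reduction against a state of the frame. -/
theorem integral_inner_reduction {ι : K →ₗᵢ[ℂ] Lp ℂ 2 μ} {V : Q → K ≃ₗᵢ[ℂ] K}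
    (hV : ∀ g, Implements ι (V g) (fr.ρ g⁻¹)) {F : Lp ℂ 2 μ} {z : K} (hz : IsDual ι F z)
    (χ : Lp ℂ 2 ν) (k : K) (ψ : Lp ℂ 2 m)
    (hψ : compL fr.measurePreserving_dressed (ι k) = ψ) :
    ∫ g, conj (χ g) * inner ℂ z (V g k) ∂ν = ∫ a, conj (F (fr.x a) * χ (fr.q a)) * ψ a ∂m := by
  have hπ : MeasurePreserving (fun p : X × Q => fr.ρ p.2⁻¹ p.1) (μ.prod ν) μ :=
    measurePreserving_fst.comp fr.measurePreserving_untwist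
  -- This is the integrand of the overlap in the coordinates `(x, q)`. Its slice at `q = g` gives
  -- the matrix element of `V g k`, so Fubini identifies the two sides.
  let Θ : X × Q → ℂ := fun p => conj (F p.1 * χ p.2) * ι k (fr.ρ p.2⁻¹ p.1)
  have hprod : MemLp (fun p : X × Q => F p.1 * χ p.2) 2 (μ.prod ν) :=
    memLp_two_mul_prod (Lp.memLp F) (Lp.memLp χ)
  have hkm : MemLp (fun p : X × Q => ι k (fr.ρ p.2⁻¹ p.1)) 2 (μ.prod ν) :=
    (Lp.memLp (ι k)).comp_measurePreserving hπ
  have hΘ : Integrable Θ (μ.prod ν) := MemLp.integrable_mul hprod.star hkm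
  calc ∫ g, conj (χ g) * inner ℂ z (V g k) ∂ν = ∫ g, ∫ x, Θ (x, g) ∂μ ∂ν := by
        refine integral_congr_ae (Filter.Eventually.of_forall fun g => ?_)
        change conj (χ g) * inner ℂ z (V g k) = ∫ x, Θ (x, g) ∂μ
        rw [hz, inner_Lp_eq_integral, ← integral_const_mul]
        refine integral_congr_ae ?_
        filter_upwards [hV g k] with x hx
        simp only [Θ, hx, Function.comp_apply, map_mul]
        ring
    _ = ∫ p, Θ p ∂(μ.prod ν) := (integral_prod_symm Θ hΘ).symm
    _ = ∫ a, Θ (fr.x a, fr.q a) ∂m :=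
        (fr.measurePreserving.integral_comp fr.measurableEmbedding Θ).symm
    _ = _ := by
        refine integral_congr_ae ?_
        filter_upwards [(compL_eq_iff _ _ _).1 hψ] with a ha
        rw [← ha]
        rfl

variable [MeasurableMul₂ Q]

/-- A wave function which is invariant under joint translations of the frame and the other
coordinates is a function of the relative coordinates. -/
theorem exists_comp_dressed [ν.IsMulRightInvariant] {ψ : Lp ℂ 2 m}
    (hψ : ∀ h, ∃ s : α → α,
      (∀ a, fr.x (s a) = fr.ρ h (fr.x a) ∧ fr.q (s a) = h * fr.q a) ∧ ψ ∘ s =ᵐ[m] ψ) :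
    ∃ y : Lp ℂ 2 μ, compL fr.measurePreserving_dressed y = ψ := by
  -- A measurable version of `ψ` on all of `X × Q` is needed: Fubini is applied there, while the
  -- coordinates give only an embedding into `X × Q`.
  obtain ⟨f, hf, hfψ⟩ := fr.measurableEmbedding_dressed.exists_stronglyMeasurable_extend
    (Lp.stronglyMeasurable ψ) fun _ => ⟨0⟩
  have hf' : ∀ a, f (fr.dressed a, fr.q a) = ψ a := fun a => congrFun hfψ a
  have hinv : ∀ h, ∀ᵐ p ∂(μ.prod ν), f (p.1, h * p.2) = f p := by
    intro h
    obtain ⟨s, hs, hsψ⟩ := hψ h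
    rw [← fr.measurePreserving_dressed_prod.map_eq, fr.measurableEmbedding_dressed.ae_map_iff]
    filter_upwards [hsψ] with a ha
    rw [Function.comp_apply] at ha
    rw [hf', ← ha, ← hf', fr.dressed_of_shift hs, (hs a).2]
  have hmeas : StronglyMeasurable fun z : (X × Q) × Q => f (z.1.1, z.2 * z.1.2) :=
    hf.comp_measurable ((measurable_fst.comp measurable_fst).prodMk
      (measurable_snd.mul (measurable_snd.comp measurable_fst)))
  have hset : MeasurableSet {z : (X × Q) × Q | f (z.1.1, z.2 * z.1.2) = f z.1} :=
    measurableSet_eq_fun hmeas.measurable (hf.comp_measurable measurable_fst).measurable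
  -- The exceptional null set depends on `h`; exchanging the quantifiers lets `h` be averaged at a
  -- fixed point `p`.
  have hinv' : ∀ᵐ p ∂(μ.prod ν), ∀ᵐ h ∂ν, f (p.1, h * p.2) = f p :=
    (Measure.ae_ae_comm hset).2 (Filter.Eventually.of_forall hinv)
  let F : X → ℂ := fun y => ∫ h, f (y, h) ∂ν
  have hF : StronglyMeasurable F := StronglyMeasurable.integral_prod_right (f := fun y h => f (y, h)) hf
  have hfF : f =ᵐ[μ.prod ν] F ∘ Prod.fst := by
    filter_upwards [hinv'] with p hp
    calc f p = ∫ _, f p ∂ν := by simp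
      _ = ∫ h, f (p.1, h * p.2) ∂ν := integral_congr_ae (hp.mono fun _ h => h.symm)
      -- The symmetry shifts the frame from the left, but averaging over the shift `h` at fixed
      -- `p.2` is a right translation. Hence right invariance of `ν`.
      _ = F p.1 := integral_mul_right_eq_self (fun h => f (p.1, h)) p.2
  have hmem : MemLp f 2 (μ.prod ν) := by
    rw [← fr.measurePreserving_dressed_prod.map_eq,
      fr.measurableEmbedding_dressed.memLp_map_measure_iff, hfψ]
    exact Lp.memLp ψ
  have hFmem : MemLp F 2 μ := by
    have h := (memLp_congr_ae hfF).1 hmem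
    have hmap := (measurePreserving_fst (μ := μ) (ν := ν)).map_eq
    rw [← memLp_map_measure_iff (by rw [hmap]; exact hF.aestronglyMeasurable)
      measurable_fst.aemeasurable, hmap] at h
    exact h
  refine ⟨hFmem.toLp F, (compL_eq_iff _ _ _).2 ?_⟩
  have h1 := fr.measurePreserving_dressed.quasiMeasurePreserving.ae_eq_comp hFmem.coeFn_toLp
  have h2 := fr.measurePreserving_dressed_prod.quasiMeasurePreserving.ae_eq_comp hfF
  filter_upwards [h1, h2] with a ha1 ha2
  rw [ha1, ← hf']
  exact ha2.symm

/-- The reduction of invariant wave functions to functions of the relative coordinates. -/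
theorem exists_reduction [ν.IsMulRightInvariant] {P : Submodule ℂ (Lp ℂ 2 m)} {s : I → α → α}
    (hs : ∀ i, MeasurePreserving (s i) m m) (hP : Represents P.subtypeₗᵢ s)
    {ι : K →ₗᵢ[ℂ] Lp ℂ 2 μ} {u : J → X → X} (hι : Represents ι u) (hu : ∀ j, Measurable (u j))
    (h1 : ∀ i, ∃ w : X → X, (∀ a, fr.dressed (s i a) = w (fr.dressed a)) ∧
      ∀ y : Lp ℂ 2 μ, (∀ j, y ∘ u j =ᵐ[μ] y) → y ∘ w =ᵐ[μ] y)
    (h2 : ∀ j, ∃ i, ∀ a, fr.dressed (s i a) = u j (fr.dressed a))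
    (h3 : ∀ h, ∃ i, ∀ a, fr.x (s i a) = fr.ρ h (fr.x a) ∧ fr.q (s i a) = h * fr.q a) :
    ∃ T : P ≃ₗᵢ[ℂ] K, ∀ ψ, compL fr.measurePreserving_dressed (ι (T ψ)) = ψ := by
  have hd := fr.measurePreserving_dressed.quasiMeasurePreserving
  refine exists_linearIsometryEquiv_of_range (j := P.subtypeₗᵢ)
    (k := (compL fr.measurePreserving_dressed).comp ι) fun ψ => ?_
  rw [hP ψ]
  constructor
  -- `h3` removes the dependence on the frame, and `h2` makes the remaining function invariant under
  -- every `u j`. The converse inclusion uses only `h1`.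
  · intro hψ
    obtain ⟨y, rfl⟩ := fr.exists_comp_dressed (ψ := ψ) fun h => by
      obtain ⟨i, hi⟩ := h3 h
      exact ⟨s i, hi, hψ i⟩
    obtain ⟨k, rfl⟩ := (hι y).2 fun j => by
      obtain ⟨i, hi⟩ := h2 j
      have hc := coeFn_compL fr.measurePreserving_dressed y
      have hset : MeasurableSet {z | (y ∘ u j) z = y z} :=
        measurableSet_eq_fun ((Lp.stronglyMeasurable y).measurable.comp (hu j))
          (Lp.stronglyMeasurable y).measurable
      refine fr.ae_of_ae_dressed hset ?_
      filter_upwards [hψ i, hc, (hs i).quasiMeasurePreserving.ae_eq_comp hc] with a ha1 ha2 ha3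
      rw [Function.comp_apply, ← hi a]
      exact ha3.symm.trans (ha1.trans ha2)
    exact ⟨k, rfl⟩
  · rintro ⟨k, rfl⟩ i
    obtain ⟨w, hw, hwy⟩ := h1 i
    have hc := coeFn_compL fr.measurePreserving_dressed (ι k)
    filter_upwards [hc, (hs i).quasiMeasurePreserving.ae_eq_comp hc,
      hd.ae_eq_comp (hwy (ι k) ((hι _).1 ⟨k, rfl⟩))] with a ha1 ha2 ha3
    refine ha2.trans (Eq.trans ?_ ha1.symm)
    refine Eq.trans ?_ ha3
    change ι k (fr.dressed (s i a)) = ι k (w (fr.dressed a))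
    rw [hw]

/-- Continuous functions with values in a Hilbert space agree if the smearings of their matrix
elements with a total set agree. -/
theorem eq_of_integral_inner_eq {Q K β : Type*} [TopologicalSpace Q] [CompactSpace Q]
    [MeasurableSpace Q] [BorelSpace Q] [SecondCountableTopology Q] {ν : Measure Q}
    [IsProbabilityMeasure ν] [ν.IsOpenPosMeasure] [NormedAddCommGroup K] [InnerProductSpace ℂ K]
    {f f' : Q → K} (hf : Continuous f) (hf' : Continuous f') {z : β → K}
    (hz : ∀ k, (∀ b, inner ℂ (z b) k = 0) → k = 0)
    (h : ∀ b (χ : Lp ℂ 2 ν), ∫ g, conj (χ g) * inner ℂ (z b) (f g) ∂ν =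
      ∫ g, conj (χ g) * inner ℂ (z b) (f' g) ∂ν) : f = f' := by
  funext g
  rw [← sub_eq_zero]
  refine hz _ fun b => ?_
  have hc : ∀ {e : Q → K}, Continuous e → Continuous fun g => inner ℂ (z b) (e g) := fun he =>
    continuous_const.inner he
  have hmem : ∀ {d : Q → ℂ}, Continuous d → MemLp d 2 ν := fun {d} hd => by
    obtain ⟨C, hC⟩ := (isCompact_range hd).isBounded.exists_norm_le
    exact MemLp.of_bound hd.aestronglyMeasurable C
      (Filter.Eventually.of_forall fun g => hC _ ⟨g, rfl⟩)
  set d : Q → ℂ := fun g => inner ℂ (z b) (f g - f' g) with hd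
  have hdc : Continuous d := hc (hf.sub hf')
  -- The smearing function is the difference of the two matrix elements itself, which is bounded by
  -- compactness; equality of smearings then says that its norm vanishes.
  let χ : Lp ℂ 2 ν := (hmem hdc).toLp d
  have hχ := h b χ
  have hint : ∀ {e : Q → K}, Continuous e →
      Integrable (fun g => conj (χ g) * inner ℂ (z b) (e g)) ν := fun he =>
    MemLp.integrable_mul (Lp.memLp χ).star (hmem (hc he))
  rw [← sub_eq_zero, ← integral_sub (hint hf) (hint hf')] at hχ
  have h0 : inner ℂ χ χ = 0 := by
    rw [inner_Lp_eq_integral, ← hχ]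
    refine integral_congr_ae ?_
    filter_upwards [(hmem hdc).coeFn_toLp] with g hg
    rw [← mul_sub, ← inner_sub_right, hg]
  have hχ0 : χ = 0 := inner_self_eq_zero.1 h0
  have hae : d =ᵐ[ν] fun _ => 0 := by
    have := (Lp.coeFn_zero ℂ 2 ν)
    rw [← hχ0] at this
    exact (hmem hdc).coeFn_toLp.symm.trans this
  exact congrFun ((Continuous.ae_eq_iff_eq ν hdc continuous_const).1 hae) g

/-- The Page–Wootters reduction relative to a frame: it exists, is unitary, unique and
equivariant. -/
theorem exists_pageWootters [TopologicalSpace X] [BorelSpace X] [R1Space X]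
    [TopologicalSpace Q] [IsTopologicalGroup Q] [CompactSpace Q] [BorelSpace Q]
    [SecondCountableTopology Q] [μ.InnerRegularCompactLTTop] [ν.IsOpenPosMeasure]
    [ν.IsMulRightInvariant] (hρ : Continuous (Function.uncurry fr.ρ))
    {P : Submodule ℂ (Lp ℂ 2 m)} {s : I → α → α}
    (hs : ∀ i, MeasurePreserving (s i) m m) (hP : Represents P.subtypeₗᵢ s)
    {ι : K →ₗᵢ[ℂ] Lp ℂ 2 μ} {u : J → X → X} (hι : Represents ι u) (hu : ∀ j, Measurable (u j))
    (h1 : ∀ i, ∃ w : X → X, (∀ a, fr.dressed (s i a) = w (fr.dressed a)) ∧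
      ∀ y : Lp ℂ 2 μ, (∀ j, y ∘ u j =ᵐ[μ] y) → y ∘ w =ᵐ[μ] y)
    (h2 : ∀ j, ∃ i, ∀ a, fr.dressed (s i a) = u j (fr.dressed a))
    (h3 : ∀ h, ∃ i, ∀ a, fr.x (s i a) = fr.ρ h (fr.x a) ∧ fr.q (s i a) = h * fr.q a)
    {V : Q → K ≃ₗᵢ[ℂ] K} (hV : ∀ g, Implements ι (V g) (fr.ρ g⁻¹))
    {β : Type*} {F : β → Lp ℂ 2 μ} {z : β → K} (hz : ∀ b, IsDual ι (F b) (z b))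
    (hF : ∀ y : Lp ℂ 2 μ, (∀ b, inner ℂ (F b) y = 0) → y = 0) :
    ∃ T : Q → (P ≃ₗᵢ[ℂ] K),
      (∀ ψ, Continuous fun g => T g ψ) ∧
      (∀ b (χ : Lp ℂ 2 ν) (ψ : P), ∫ g, conj (χ g) * inner ℂ (z b) (T g ψ) ∂ν =
        ∫ a, conj (F b (fr.x a) * χ (fr.q a)) * (ψ : Lp ℂ 2 m) a ∂m) ∧
      (∀ T' : Q → P → K, (∀ ψ, (Continuous fun g => T' g ψ) ∧
        ∀ b (χ : Lp ℂ 2 ν), ∫ g, conj (χ g) * inner ℂ (z b) (T' g ψ) ∂ν =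
          ∫ a, conj (F b (fr.x a) * χ (fr.q a)) * (ψ : Lp ℂ 2 m) a ∂m) →
        ∀ g ψ, T' g ψ = T g ψ) ∧
      ∀ h g ψ, T (h * g) ψ = V h (T g ψ) := by
  obtain ⟨T, hT⟩ := fr.exists_reduction hs hP hι hu h1 h2 h3
  have hcont : ∀ k, Continuous fun g => V g k := by
    intro k
    -- Strong continuity is tested on wave functions, where `V g` is composition with `ρ g⁻¹`, a map
    -- depending continuously on `g`.
    rw [ι.isometry.isUniformInducing.isInducing.continuous_iff]
    have heq : (ι ∘ fun g => V g k) = fun g => compL (fr.measurePreserving_ρ g⁻¹) (ι k) :=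
      funext fun g => (hV g).eq_compL _ k
    rw [heq]
    have hg : ∀ g, Continuous (fr.ρ g⁻¹) := fun g => hρ.comp (Continuous.prodMk_right g⁻¹)
    let c : C(Q × X, X) := ⟨fun p => fr.ρ p.1⁻¹ p.2,
      hρ.comp (show Continuous fun p : Q × X => (p.1⁻¹, p.2) by fun_prop)⟩
    exact Continuous.compMeasurePreservingLp (f := fun _ : Q => ι k) (g := fun g => c.curry g)
      continuous_const c.curry.continuous (fun g => fr.measurePreserving_ρ g⁻¹) (by simp)
  have hpw : ∀ b (χ : Lp ℂ 2 ν) (ψ : P), ∫ g, conj (χ g) * inner ℂ (z b) (V g (T ψ)) ∂ν =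
      ∫ a, conj (F b (fr.x a) * χ (fr.q a)) * (ψ : Lp ℂ 2 m) a ∂m := fun b χ ψ =>
    fr.integral_inner_reduction hV (hz b) χ (T ψ) ψ (hT ψ)
  -- `T ψ` is the function of the dressed coordinate, that is, the reduction at the identity
  -- orientation; `V g` carries it to orientation `g`.
  refine ⟨fun g => T.trans (V g), fun ψ => hcont (T ψ), hpw, fun T' hT' g ψ => ?_,
    fun h g ψ => ?_⟩
  · refine congrFun (eq_of_integral_inner_eq (ν := ν) (hT' ψ).1 (hcont (T ψ)) (z := z)
      (fun k hk => ?_) fun b χ => ((hT' ψ).2 b χ).trans (hpw b χ ψ).symm) g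
    rw [← map_eq_zero_iff ι ι.injective]
    exact hF _ fun b => by rw [← hz, hk]
  · change V (h * g) (T ψ) = V h (V g (T ψ))
    refine ι.injective (Lp.ext ?_)
    have hh := (fr.measurePreserving_ρ h⁻¹).quasiMeasurePreserving.ae_eq_comp (hV g (T ψ))
    filter_upwards [hV (h * g) (T ψ), hV h (V g (T ψ)), hh] with y h1 h2 h3
    rw [h1, h2, h3, mul_inv_rev]
    change ι (T ψ) _ = ι (T ψ) _
    rw [fr.ρ_mul]

end FrameCoords

end FrameReduction

/-! ### Wilson lines, their gauge behaviour, and the change of variables. -/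

section Geometry

variable {V E : Type*} {Γ : LinkSystem V E} {R : Region Γ} {G : Type*} [Group G]

theorem linkVar_congr_iff {e : E} {b : Bool} {a a' : E → G} :
    linkVar e b a = linkVar e b a' ↔ a e = a' e := by
  cases b <;> simp [linkVar]

theorem linkVar_act {e : E} {b : Bool} {v w : V} (hj : Γ.Joins e b v w) (h : V → G) (a : E → G) :
    linkVar e b (Γ.act h a) = h w * linkVar e b a * (h v)⁻¹ := by
  cases b
  · obtain ⟨rfl, rfl⟩ : Γ.tgt e = v ∧ Γ.src e = w := hj
    simp [linkVar, LinkSystem.act, mul_assoc]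
  · obtain ⟨rfl, rfl⟩ : Γ.src e = v ∧ Γ.tgt e = w := hj
    simp [linkVar, LinkSystem.act]

namespace ExtrinsicFrame

variable (Φ : ExtrinsicFrame R)

theorem wilson_zero (v : R.Corner) (a : E → G) : Φ.wilson v a 0 = 1 := rfl

theorem wilson_succ (v : R.Corner) (a : E → G) (i : Fin (Φ.len v + 1)) :
    Φ.wilson v a i.succ = linkVar (Φ.edge v i) (Φ.along v i) a * Φ.wilson v a i.castSucc := rfl

/-- Telescoping along the line. The factors `k` are indexed by positions and not by vertices, so
that the lemma serves both gauge transformations and independent translations of the node variables,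
even if a line revisits a vertex. -/
theorem wilson_eq_of_linkVar (v : R.Corner) (k : Fin (Φ.len v + 2) → G) {a a' : E → G}
    (h : ∀ i, linkVar (Φ.edge v i) (Φ.along v i) a' =
      k i.succ * linkVar (Φ.edge v i) (Φ.along v i) a * (k i.castSucc)⁻¹) (j : Fin (Φ.len v + 2)) :
    Φ.wilson v a' j = k j * Φ.wilson v a j * (k 0)⁻¹ := by
  induction j using Fin.induction with
  | zero => simp [wilson_zero]
  | succ i ih => rw [wilson_succ, wilson_succ, h, ih]; group

theorem wilson_act (v : R.Corner) (h : V → G) (a : E → G) (j : Fin (Φ.len v + 2)) :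
    Φ.wilson v (Γ.act h a) j = h (Φ.node v j) * Φ.wilson v a j * (h (Φ.node v 0))⁻¹ :=
  Φ.wilson_eq_of_linkVar v (fun j => h (Φ.node v j)) (fun i => linkVar_act (Φ.joins v i) h a) j

theorem complVar_act (h : V → G) (a : E → G) :
    Φ.complVar (Γ.act h a) = Φ.complLinks.act h (Φ.complVar a) := by
  funext d
  rcases d with e | p
  · rfl
  · exact Φ.wilson_act p.1 h a p.2.succ.castSucc

theorem var_act (h : V → G) (a : E → G) : Φ.var (Γ.act h a) = Φ.links.act h (Φ.var a) := by
  funext v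
  refine (Φ.wilson_act v h a _).trans ?_
  rw [Φ.finish]
  rfl

end ExtrinsicFrame

namespace IntrinsicFrame

variable (Ψ : IntrinsicFrame R)

theorem subVar_act (h : V → G) (a : E → G) :
    Ψ.subVar (Γ.act h a) = Ψ.subLinks.act h (Ψ.subVar a) := by
  funext d
  rcases d with e | e <;> rfl

variable [DecidableEq V]

theorem wilson_root (a : E → G) : Ψ.wilson Ψ.root a = 1 := by
  rw [wilson, Ψ.depth_root]
  rfl

theorem wilson_of_ne (v : {v : R.Corner // v ≠ Ψ.root}) (a : E → G) :
    Ψ.wilson v.1 a = linkVar (Ψ.edge v) (Ψ.along v) a * Ψ.wilson (Ψ.parent v) a := by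
  rw [wilson, Ψ.depth_parent v, wilsonAux, dif_pos v.2, wilson]

/-- Every step to the parent lowers the depth, so repeated steps end at the root. -/
theorem corner_induction {P : R.Corner → Prop} (root : P Ψ.root)
    (step : ∀ v : {v : R.Corner // v ≠ Ψ.root}, P (Ψ.parent v) → P v.1) (v : R.Corner) : P v := by
  by_cases hv : v = Ψ.root
  · rw [hv]; exact root
  · exact step ⟨v, hv⟩ (corner_induction root step (Ψ.parent ⟨v, hv⟩))
termination_by Ψ.depth v
decreasing_by exact (Ψ.depth_parent ⟨v, hv⟩).symm ▸ Nat.lt_succ_self _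

/-- Telescoping along the tree, used for gauge transformations and for translations of the tree
variables alike. -/
theorem wilson_eq_of_linkVar (k : R.Corner → G) {a a' : E → G}
    (h : ∀ v, linkVar (Ψ.edge v) (Ψ.along v) a' =
      k v.1 * linkVar (Ψ.edge v) (Ψ.along v) a * (k (Ψ.parent v))⁻¹) (v : R.Corner) :
    Ψ.wilson v a' = k v * Ψ.wilson v a * (k Ψ.root)⁻¹ := by
  induction v using Ψ.corner_induction with
  | root => simp [wilson_root]
  | step v ih => rw [wilson_of_ne, wilson_of_ne, h, ih]; group

theorem var_act (h : V → G) (a : E → G) : Ψ.var (Γ.act h a) = Ψ.links.act h (Ψ.var a) := by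
  funext v
  exact Ψ.wilson_eq_of_linkVar (fun v => h v) (fun v => linkVar_act (Ψ.joins v) h a) v.1

/-- Two vertices with a common tree edge coincide or are each other's parents; the latter would make
each one step deeper than the other. -/
theorem edge_injective : Function.Injective Ψ.edge := by
  intro v w hvw
  have hv := Ψ.joins v
  have hw := Ψ.joins w
  have hd := Ψ.depth_parent v
  have hd' := Ψ.depth_parent w
  rw [← hvw] at hw
  unfold LinkSystem.Joins at hv hw
  have key : v.1 = w.1 ∨ v.1 = Ψ.parent w ∧ w.1 = Ψ.parent v := by
    split_ifs at hv hw
    · exact Or.inl (Subtype.ext (hv.2.symm.trans hw.2))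
    · exact Or.inr ⟨Subtype.ext (hv.2.symm.trans hw.1), Subtype.ext (hw.2.symm.trans hv.1)⟩
    · exact Or.inr ⟨Subtype.ext (hv.2.symm.trans hw.1), Subtype.ext (hw.2.symm.trans hv.1)⟩
    · exact Or.inl (Subtype.ext (hv.2.symm.trans hw.2))
  rcases key with key | ⟨h1, h2⟩
  · exact Subtype.ext key
  · rw [h1] at hd; rw [h2] at hd'; omega

end IntrinsicFrame

variable [DecidableEq V] (Φ : ExtrinsicFrame R) (Ψ : IntrinsicFrame R)

/-- The frame variables determine the link variables. -/
theorem eq_of_frame_vars_eq {a a' : E → G} (h1 : Ψ.subVar a = Ψ.subVar a')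
    (h2 : Φ.complVar a = Φ.complVar a') (h3 : Ψ.var a = Ψ.var a') (h4 : Φ.var a = Φ.var a') :
    a = a' := by
  have hΨ : ∀ v, Ψ.wilson v a = Ψ.wilson v a' := by
    intro v
    by_cases hv : v = Ψ.root
    · rw [hv, Ψ.wilson_root, Ψ.wilson_root]
    · exact congrFun h3 ⟨v, hv⟩
  have hΦ : ∀ v j, Φ.wilson v a j = Φ.wilson v a' j := by
    intro v j
    cases j using Fin.cases with
    | zero => rfl
    | succ j =>
      cases j using Fin.lastCases with
      | last => exact congrFun h4 v
      | cast i => exact congrFun h2 (Sum.inr ⟨v, i⟩)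
  funext e
  cases he : R.ek e with
  | interior => exact congrFun h1 (Sum.inl ⟨e, he⟩)
  | corner =>
    by_cases hv : ∃ v, Ψ.edge v = e
    · obtain ⟨v, rfl⟩ := hv
      -- Wilson lines to consecutive nodes differ by one link factor, which is recovered by
      -- cancellation.
      have := hΨ v.1
      rw [Ψ.wilson_of_ne, Ψ.wilson_of_ne, hΨ (Ψ.parent v)] at this
      exact linkVar_congr_iff.1 (mul_right_cancel this)
    · exact congrFun h1 (Sum.inr ⟨e, he, not_exists.1 hv⟩)
  | exterior =>
    by_cases hp : ∃ p : (v : R.Corner) × Fin (Φ.len v + 1), Φ.edge p.1 p.2 = e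
    · obtain ⟨⟨v, i⟩, rfl⟩ := hp
      have := hΦ v i.succ
      rw [Φ.wilson_succ, Φ.wilson_succ, hΦ v i.castSucc] at this
      exact linkVar_congr_iff.1 (mul_right_cancel this)
    · exact congrFun h2 (Sum.inl ⟨e, he, not_exists.1 hp⟩)

/-- Every translation of the frame variables is induced by left and right translations of the link
variables. -/
theorem exists_translation (k₁ : Ψ.SubDof → G) (k₂ : Φ.ComplDof → G) (k₃ : Ψ.Dof → G)
    (k₄ : R.Corner → G) : ∃ t s : E → G, ∀ a : E → G,
      Ψ.subVar (fun e => t e * a e * (s e)⁻¹) = k₁ * Ψ.subVar a ∧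
      Φ.complVar (fun e => t e * a e * (s e)⁻¹) = k₂ * Φ.complVar a ∧
      Ψ.var (fun e => t e * a e * (s e)⁻¹) = k₃ * Ψ.var a ∧
      Φ.var (fun e => t e * a e * (s e)⁻¹) = k₄ * Φ.var a := by
  -- `κ` and `c` prescribe the desired left translation of the Wilson line at each vertex of the
  -- tree and at each position of a line. They are trivial at the starting points, so the telescoped
  -- right factor disappears.
  let κ : R.Corner → G := fun v => if hv : v ≠ Ψ.root then k₃ ⟨v, hv⟩ else 1
  let c : (v : R.Corner) → Fin (Φ.len v + 2) → G := fun v =>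
    Fin.cases 1 (Fin.lastCases (k₄ v) fun i => k₂ (Sum.inr ⟨v, i⟩))
  have hκ : ∀ v : Ψ.Dof, κ v.1 = k₃ v := fun v => dif_pos v.2
  have hκ0 : κ Ψ.root = 1 := dif_neg (not_not.2 rfl)
  have hc0 : ∀ v, c v 0 = 1 := fun v => rfl
  have hc1 : ∀ v (i : Fin (Φ.len v)), c v i.succ.castSucc = k₂ (Sum.inr ⟨v, i⟩) := fun v i => by
    rw [← Fin.succ_castSucc]
    exact Fin.lastCases_castSucc (motive := fun _ => G) i
  have hc2 : ∀ v, c v (Fin.last _) = k₄ v := fun v => by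
    rw [← Fin.succ_last]
    exact Fin.lastCases_last (motive := fun _ => G)
  -- `p` is the pair of left and right translations of the link `e`. An edge kept as a variable is
  -- translated on the left only; an edge of the tree or of a line receives the values at its two
  -- ends, exchanged if it is traversed against its orientation. The clauses are compatible because
  -- the kinds of edges exclude one another, tree edges are distinct and no edge is used twice by
  -- the lines.
  have hex : ∀ e, ∃ p : G × G,
      (∀ h : R.ek e = .interior, p = (k₁ (Sum.inl ⟨e, h⟩), 1)) ∧
      (∀ h : R.ek e = .corner ∧ ∀ v, Ψ.edge v ≠ e, p = (k₁ (Sum.inr ⟨e, h⟩), 1)) ∧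
      (∀ v, Ψ.edge v = e →
        p = if Ψ.along v then (κ v.1, κ (Ψ.parent v)) else (κ (Ψ.parent v), κ v.1)) ∧
      (∀ h : R.ek e = .exterior ∧
        ∀ p : (v : R.Corner) × Fin (Φ.len v + 1), Φ.edge p.1 p.2 ≠ e,
        p = (k₂ (Sum.inl ⟨e, h⟩), 1)) ∧
      (∀ v i, Φ.edge v i = e →
        p = if Φ.along v i then (c v i.succ, c v i.castSucc) else (c v i.castSucc, c v i.succ)) := by
    intro e
    have hΨe : ∀ v, Ψ.edge v = e → R.ek e = .corner := fun v hv => hv ▸ Ψ.corner v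
    have hΦe : ∀ v i, Φ.edge v i = e → R.ek e = .exterior := fun v i hv => hv ▸ Φ.exterior v i
    obtain he | he | he : R.ek e = .interior ∨ R.ek e = .corner ∨ R.ek e = .exterior := by
      cases R.ek e <;> simp
    · refine ⟨(k₁ (Sum.inl ⟨e, he⟩), 1), fun _ => rfl, fun h => ?_, fun v hv => ?_, fun h => ?_, fun v i hv => ?_⟩
      · cases he.symm.trans h.1
      · cases he.symm.trans (hΨe v hv)
      · cases he.symm.trans h.1
      · cases he.symm.trans (hΦe v i hv)
    · by_cases hv : ∃ v, Ψ.edge v = e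
      · obtain ⟨v, rfl⟩ := hv
        refine ⟨if Ψ.along v then (κ v.1, κ (Ψ.parent v)) else (κ (Ψ.parent v), κ v.1),
          fun h => ?_, fun h => ?_, fun w hw => ?_, fun h => ?_, fun w i hw => ?_⟩
        rotate_left 2
        · rw [Ψ.edge_injective hw]
        · cases he.symm.trans h.1
        · cases he.symm.trans (hΦe w i hw)
        · cases he.symm.trans h
        · exact absurd rfl (h.2 v)
      · refine ⟨(k₁ (Sum.inr ⟨e, he, not_exists.1 hv⟩), 1), fun h => ?_, fun h => rfl, fun w hw => ?_, fun h => ?_, fun w i hw => ?_⟩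
        · cases he.symm.trans h
        · exact absurd ⟨w, hw⟩ hv
        · cases he.symm.trans h.1
        · cases he.symm.trans (hΦe w i hw)
    · by_cases hp : ∃ p : (v : R.Corner) × Fin (Φ.len v + 1), Φ.edge p.1 p.2 = e
      · obtain ⟨⟨v, i⟩, rfl⟩ := hp
        refine ⟨if Φ.along v i then (c v i.succ, c v i.castSucc) else (c v i.castSucc, c v i.succ),
          fun h => ?_, fun h => ?_, fun w hw => ?_, fun h => ?_, fun w j hw => ?_⟩
        rotate_left 4
        · have : (⟨w, j⟩ : (v : R.Corner) × Fin (Φ.len v + 1)) = ⟨v, i⟩ := Φ.edge_disjoint hw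
          cases this
          rfl
        · cases he.symm.trans h
        · cases he.symm.trans h.1
        · cases he.symm.trans (hΨe w hw)
        · exact absurd rfl (h.2 ⟨v, i⟩)
      · refine ⟨(k₂ (Sum.inl ⟨e, he, not_exists.1 hp⟩), 1), fun h => ?_, fun h => ?_,
          fun w hw => ?_, fun h => rfl, fun w i hw => ?_⟩
        · cases he.symm.trans h
        · cases he.symm.trans h.1
        · cases he.symm.trans (hΨe w hw)
        · exact absurd ⟨⟨w, i⟩, hw⟩ hp
  choose p hp1 hp2 hp3 hp4 hp5 using hex
  refine ⟨fun e => (p e).1, fun e => (p e).2, fun a => ?_⟩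
  have hΨ := Ψ.wilson_eq_of_linkVar (a := a) (a' := fun e => (p e).1 * a e * (p e).2⁻¹) κ
    fun v => by
      have := hp3 _ v rfl
      cases hb : Ψ.along v <;> simp [hb] at this <;> simp [linkVar, this, mul_assoc]
  have hΦ := fun v => Φ.wilson_eq_of_linkVar (a := a) (a' := fun e => (p e).1 * a e * (p e).2⁻¹)
    v (c v) fun i => by
      have := hp5 _ v i rfl
      cases hb : Φ.along v i <;> simp [hb] at this <;> simp [linkVar, this, mul_assoc]
  refine ⟨?_, ?_, ?_, ?_⟩
  · funext d
    rcases d with ⟨e, he⟩ | ⟨e, he⟩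
    · simp [IntrinsicFrame.subVar, hp1 e he]
    · simp [IntrinsicFrame.subVar, hp2 e he]
  · funext d
    rcases d with ⟨e, he⟩ | ⟨v, i⟩
    · simp [ExtrinsicFrame.complVar, hp4 e he]
    · have := hΦ v i.succ.castSucc
      rw [hc0, hc1, inv_one, mul_one] at this
      exact this
  · funext v
    refine (hΨ v.1).trans ?_
    rw [hκ, hκ0, inv_one, mul_one]
    rfl
  · funext v
    refine (hΦ v _).trans ?_
    rw [hc0, hc2, inv_one, mul_one]
    rfl

end Geometry

/-! ### Haar measure in frame coordinates and representations on links. -/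

section LinkFrames

/-- A map to a compact group which intertwines measure-preserving maps with all left translations
pushes a probability measure forward to Haar measure. -/
theorem measurePreserving_of_translations {α Y : Type*} [MeasurableSpace α] [Group Y]
    [TopologicalSpace Y] [IsTopologicalGroup Y] [CompactSpace Y] [MeasurableSpace Y] [BorelSpace Y]
    {m : Measure α} [IsProbabilityMeasure m] {η : Measure Y} [IsProbabilityMeasure η]
    [η.IsHaarMeasure] {θ : α → Y} (hθ : Measurable θ)
    (h : ∀ k, ∃ s : α → α, MeasurePreserving s m m ∧ ∀ a, θ (s a) = k * θ a) :
    MeasurePreserving θ m η := by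
  refine ⟨hθ, ?_⟩
  have hp : IsProbabilityMeasure (m.map θ) := Measure.isProbabilityMeasure_map hθ.aemeasurable
  have hl : (m.map θ).IsMulLeftInvariant := ⟨fun k => by
    obtain ⟨s, hs, hsθ⟩ := h k
    rw [Measure.map_map (measurable_const_mul k) hθ,
      show (fun x => k * x) ∘ θ = θ ∘ s from funext fun a => (hsθ a).symm,
      ← Measure.map_map hθ hs.measurable, hs.map_eq]⟩
  have hh : (m.map θ).IsHaarMeasure :=
    Measure.isHaarMeasure_of_isCompact_nonempty_interior _ Set.univ isCompact_univ (by simp)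
      (by simp) (by simp)
  exact Measure.isHaarMeasure_eq_of_isProbabilityMeasure _ _

variable {V E D D₁ D₂ D₃ D₄ G : Type*} [Group G]

namespace LinkSystem

theorem act_mul_apply (Γ : LinkSystem V D) (h k : V → G) (a : D → G) :
    Γ.act (h * k) a = Γ.act h (Γ.act k a) :=
  (congrFun (Γ.act_comp_act h k) a).symm

theorem act_congr (Γ : LinkSystem V D) {h k : V → G} (hs : ∀ d, h (Γ.src d) = k (Γ.src d))
    (ht : ∀ d, h (Γ.tgt d) = k (Γ.tgt d)) : Γ.act h = Γ.act k := by
  funext a d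
  simp only [act, hs, ht]

theorem act_eq_id (Γ : LinkSystem V D) {h : V → G} (hs : ∀ d, h (Γ.src d) = 1)
    (ht : ∀ d, h (Γ.tgt d) = 1) : Γ.act h = id :=
  (Γ.act_congr (k := 1) hs ht).trans Γ.act_one

/-- Equal factors at the two ends of a link cancel in an Abelian group. The neutrality statements
rest on this. -/
theorem act_eq_id_of_comm (Γ : LinkSystem V D) (hG : ∀ x y : G, x * y = y * x) {h : V → G}
    (hst : ∀ d, h (Γ.src d) = h (Γ.tgt d)) : Γ.act h = id := by
  funext a d
  rw [act, hst, hG, ← mul_assoc, inv_mul_cancel, one_mul, id]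

theorem act_comm (Γ : LinkSystem V D) (hG : ∀ x y : G, x * y = y * x) (h k : V → G) (a : D → G) :
    Γ.act h (Γ.act k a) = Γ.act k (Γ.act h a) := by
  rw [← act_mul_apply, ← act_mul_apply, show h * k = k * h from funext fun v => hG _ _]

/-- The joint action of gauge transformations on three systems of links. -/
def act₃ (Γ₁ : LinkSystem V D₁) (Γ₂ : LinkSystem V D₂) (Γ₃ : LinkSystem V D₃) (h : V → G) :
    (D₁ → G) × ((D₂ → G) × (D₃ → G)) → (D₁ → G) × ((D₂ → G) × (D₃ → G)) :=
  Prod.map (Γ₁.act h) (Prod.map (Γ₂.act h) (Γ₃.act h))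

theorem act₃_mul (Γ₁ : LinkSystem V D₁) (Γ₂ : LinkSystem V D₂) (Γ₃ : LinkSystem V D₃)
    (h k : V → G) (y : (D₁ → G) × ((D₂ → G) × (D₃ → G))) :
    act₃ Γ₁ Γ₂ Γ₃ (h * k) y = act₃ Γ₁ Γ₂ Γ₃ h (act₃ Γ₁ Γ₂ Γ₃ k y) := by
  simp only [act₃, Prod.map, act_mul_apply]

theorem act₃_one (Γ₁ : LinkSystem V D₁) (Γ₂ : LinkSystem V D₂) (Γ₃ : LinkSystem V D₃)
    (y : (D₁ → G) × ((D₂ → G) × (D₃ → G))) : act₃ Γ₁ Γ₂ Γ₃ (1 : V → G) y = y := by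
  simp [act₃, Prod.map, act_one]

variable [TopologicalSpace G] [IsTopologicalGroup G]

theorem continuous_act_uncurry (Γ : LinkSystem V D) :
    Continuous fun p : (V → G) × (D → G) => Γ.act p.1 p.2 := by
  unfold act
  fun_prop

theorem continuous_act₃ (Γ₁ : LinkSystem V D₁) (Γ₂ : LinkSystem V D₂) (Γ₃ : LinkSystem V D₃)
    {Z : Type*} [TopologicalSpace Z] {e : Z → V → G} (he : Continuous e) :
    Continuous fun p : Z × ((D₁ → G) × ((D₂ → G) × (D₃ → G))) =>
      act₃ Γ₁ Γ₂ Γ₃ (e p.1) p.2 := by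
  have h1 := Γ₁.continuous_act_uncurry (G := G)
  have h2 := Γ₂.continuous_act_uncurry (G := G)
  have h3 := Γ₃.continuous_act_uncurry (G := G)
  have he' := he.comp (continuous_fst (X := Z) (Y := (D₁ → G) × ((D₂ → G) × (D₃ → G))))
  exact (h1.comp (he'.prodMk continuous_snd.fst)).prodMk
    ((h2.comp (he'.prodMk continuous_snd.snd.fst)).prodMk
      (h3.comp (he'.prodMk continuous_snd.snd.snd)))

variable [CompactSpace G] [SecondCountableTopology G] [T2Space G] [MeasurableSpace G]
  [BorelSpace G] [Fintype D] [Fintype D₁] [Fintype D₂] [Fintype D₃] [Fintype D₄] [Fintype E]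

theorem measurePreserving_act₃ (Γ₁ : LinkSystem V D₁) (Γ₂ : LinkSystem V D₂)
    (Γ₃ : LinkSystem V D₃) (h : V → G) : MeasurePreserving (act₃ Γ₁ Γ₂ Γ₃ h)
      ((haarPi G D₁).prod ((haarPi G D₂).prod (haarPi G D₃)))
      ((haarPi G D₁).prod ((haarPi G D₂).prod (haarPi G D₃))) :=
  (Γ₁.measurePreserving_act h).prod ((Γ₂.measurePreserving_act h).prod (Γ₃.measurePreserving_act h))

/-- The regularity needed for composition with a continuous family of measure-preserving maps to be
continuous in L². -/
theorem innerRegularCompactLTTop_haarPi₃ (G D₁ D₂ D₃ : Type*) [Group G] [TopologicalSpace G]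
    [IsTopologicalGroup G] [CompactSpace G] [SecondCountableTopology G] [T2Space G]
    [MeasurableSpace G] [BorelSpace G] [Fintype D₁] [Fintype D₂] [Fintype D₃] :
    ((haarPi G D₁).prod ((haarPi G D₂).prod (haarPi G D₃))).InnerRegularCompactLTTop :=
  inferInstance

theorem implements_gaugeU (Γ : LinkSystem V D) (h : V → G) :
    Implements LinearIsometry.id (Γ.gaugeU h) (Γ.act h⁻¹) := fun ψ =>
  coeFn_compL (Γ.measurePreserving_act h⁻¹) ψ

theorem implements_gaugeUPhys (Γ : LinkSystem V D) (S : Set V) (h : V → G) :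
    Implements (Γ.gauss G S).subtypeₗᵢ (Γ.gaugeUPhys S h) (Γ.act h⁻¹) := fun ψ =>
  coeFn_compL (Γ.measurePreserving_act h⁻¹) ψ.1

/-- Physical states are wave functions which are invariant under gauge transformations. -/
theorem represents_gauss (Γ : LinkSystem V D) (S : Set V) :
    Represents (Γ.gauss G S).subtypeₗᵢ
      fun h : {h : V → G // ∀ v ∉ S, h v = 1} => Γ.act h.1 := by
  intro F
  have key : ∀ h : V → G, Γ.gaugeU h F = F ↔ F ∘ Γ.act h⁻¹ =ᵐ[haarPi G D] F := fun h =>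
    compL_eq_iff (Γ.measurePreserving_act h⁻¹) F F
  have hinv : ∀ h : {h : V → G // ∀ v ∉ S, h v = 1}, ∀ v ∉ S, (h.1⁻¹ : V → G) v = 1 :=
    fun h v hv => by rw [Pi.inv_apply, h.2 v hv, inv_one]
  constructor
  · rintro ⟨ψ, rfl⟩ h
    have := (key _).1 (ψ.2 ⟨h.1⁻¹, hinv h⟩)
    rwa [inv_inv] at this
  · exact fun hF => ⟨⟨F, fun h => (key _).2 (hF ⟨h.1⁻¹, hinv h⟩)⟩, rfl⟩

/-- The tool for neutrality: it suffices to trade `h⁻¹` for a transformation supported on the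
constrained vertices with the same effect on the links. -/
theorem gaugeUPhys_eq_self (Λ : LinkSystem V D) {S : Set V}
    {h k : V → G} (hk : ∀ v ∉ S, k v = 1) (hhk : Λ.act h⁻¹ = Λ.act k) (f : Λ.gauss G S) :
    Λ.gaugeUPhys S h f = f := by
  refine Subtype.ext (Lp.ext ((Λ.implements_gaugeUPhys S h f).trans ?_))
  rw [hhk]
  exact (Λ.represents_gauss S f.1).1 ⟨f, rfl⟩ ⟨k, hk⟩

/-- Coordinates on the link variables given by three systems of links and a frame, on which a group
of gauge transformations acts by left translations. -/
def frameCoords (Γ₁ : LinkSystem V D₁) (Γ₂ : LinkSystem V D₂) (Γ₃ : LinkSystem V D₃)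
    (emb : (D₄ → G) →* (V → G)) (hemb : Continuous emb)
    (x : (E → G) → (D₁ → G) × ((D₂ → G) × (D₃ → G))) (hx : Continuous x)
    (q : (E → G) → D₄ → G) (hq : Continuous q)
    (hinj : Function.Injective fun a => (x a, q a))
    (htr : ∀ k : ((D₁ → G) × ((D₂ → G) × (D₃ → G))) × (D₄ → G), ∃ t s : E → G, ∀ a : E → G,
      (x fun e => t e * a e * (s e)⁻¹, q fun e => t e * a e * (s e)⁻¹) = k * (x a, q a)) :
    FrameCoords (haarPi G E) ((haarPi G D₁).prod ((haarPi G D₂).prod (haarPi G D₃)))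
      (haarPi G D₄) where
  x := x
  q := q
  measurePreserving := by
    have h₂₃ : ((haarPi G D₂).prod (haarPi G D₃)).IsHaarMeasure := inferInstance
    have h₁₂₃ : ((haarPi G D₁).prod ((haarPi G D₂).prod (haarPi G D₃))).IsHaarMeasure :=
      inferInstance
    have h₁₂₃₄ : (((haarPi G D₁).prod ((haarPi G D₂).prod (haarPi G D₃))).prod
      (haarPi G D₄)).IsHaarMeasure := Measure.prod.instIsHaarMeasure _ _
    refine measurePreserving_of_translations (hx.prodMk hq).measurable fun k => ?_
    obtain ⟨t, s, hts⟩ := htr k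
    -- Independent left and right translations of the links are gauge transformations of the graph
    -- in which each link has a source and a target of its own.
    let Γ' : LinkSystem (E ⊕ E) E := ⟨Sum.inl, Sum.inr⟩
    exact ⟨_, Γ'.measurePreserving_act (Sum.elim s t), hts⟩
  measurableEmbedding := ((hx.prodMk hq).isClosedEmbedding hinj).measurableEmbedding
  ρ h := act₃ Γ₁ Γ₂ Γ₃ (emb h)
  ρ_mul h k y := by rw [map_mul, act₃_mul]
  ρ_one y := by rw [map_one, act₃_one]
  measurable_ρ := (continuous_act₃ Γ₁ Γ₂ Γ₃ hemb).measurable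
  measurePreserving_ρ h := measurePreserving_act₃ Γ₁ Γ₂ Γ₃ (emb h)

end LinkSystem

end LinkFrames

/-! ### Continuity of the new variables. -/

section FrameContinuity

theorem IntrinsicFrame.continuous_subVar {V E G : Type*} {Γ : LinkSystem V E} {R : Region Γ}
    [TopologicalSpace G] (Ψ : IntrinsicFrame R) : Continuous fun a : E → G => Ψ.subVar a :=
  continuous_pi fun d => by
    rcases d with e | e <;> exact continuous_apply e.1

variable {V E : Type*} {Γ : LinkSystem V E} {R : Region Γ} {G : Type*} [Group G]
  [TopologicalSpace G] [IsTopologicalGroup G]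

theorem continuous_linkVar (e : E) (b : Bool) : Continuous fun a : E → G => linkVar e b a := by
  cases b
  · exact (continuous_apply e).inv
  · exact continuous_apply e

namespace ExtrinsicFrame

variable (Φ : ExtrinsicFrame R)

theorem continuous_wilson (v : R.Corner) (j : Fin (Φ.len v + 2)) :
    Continuous fun a : E → G => Φ.wilson v a j := by
  induction j using Fin.induction with
  | zero => exact continuous_const
  | succ i ih => exact (continuous_linkVar _ _).mul ih

theorem continuous_complVar : Continuous fun a : E → G => Φ.complVar a :=
  continuous_pi fun d => by
    rcases d with e | p
    · exact continuous_apply e.1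
    · exact Φ.continuous_wilson p.1 p.2.succ.castSucc

theorem continuous_var : Continuous fun a : E → G => Φ.var a :=
  continuous_pi fun v => Φ.continuous_wilson v _

end ExtrinsicFrame

namespace IntrinsicFrame

variable [DecidableEq V] (Ψ : IntrinsicFrame R)

theorem continuous_wilson (v : R.Corner) : Continuous fun a : E → G => Ψ.wilson v a := by
  induction v using Ψ.corner_induction with
  | root => simp only [wilson_root]; exact continuous_const
  | step v ih => simp only [wilson_of_ne]; exact (continuous_linkVar _ _).mul ih

theorem continuous_var : Continuous fun a : E → G => Ψ.var a :=
  continuous_pi fun v => Ψ.continuous_wilson v.1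

end IntrinsicFrame

end FrameContinuity

/-! ### Transport of represented spaces along changes of variables. -/

section RepresentationLemmas

variable {X Y : Type*} [MeasurableSpace X] [MeasurableSpace Y] {μ : Measure X} {ν : Measure Y}
  {A B I J : Type*} [NormedAddCommGroup A] [InnerProductSpace ℂ A]
  [NormedAddCommGroup B] [InnerProductSpace ℂ B]

theorem ae_eq_comp_comp {f : X → ℂ} {r s : X → X} (hs : MeasurePreserving s μ μ)
    (hfr : f ∘ r =ᵐ[μ] f) (hfs : f ∘ s =ᵐ[μ] f) : f ∘ (r ∘ s) =ᵐ[μ] f :=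
  (hs.quasiMeasurePreserving.ae_eq_comp hfr).trans hfs

theorem ae_eq_comp_iff_of_semiconj {f : X → ℂ} {e : Y ≃ᵐ X} (he : MeasurePreserving e ν μ)
    {u : X → X} {v : Y → Y} (h : ∀ y, u (e y) = e (v y)) :
    f ∘ u =ᵐ[μ] f ↔ (f ∘ e) ∘ v =ᵐ[ν] f ∘ e := by
  have h' : (f ∘ e) ∘ v = (f ∘ u) ∘ e := funext fun y => congrArg f (h y).symm
  rw [h']
  refine ⟨he.quasiMeasurePreserving.ae_eq_comp, fun hf => ?_⟩
  have hs := (he.symm e).quasiMeasurePreserving.ae_eq_comp hf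
  have hid : ∀ g : X → ℂ, (g ∘ e) ∘ e.symm = g := fun g => funext fun x => by simp
  rwa [hid, hid] at hs

/-- A measure-preserving change of variables which matches the symmetries of two families of
invariant wave functions induces a unitary between them. -/
theorem Represents.exists_equiv {ι : A →ₗᵢ[ℂ] Lp ℂ 2 μ} {κ : B →ₗᵢ[ℂ] Lp ℂ 2 ν} {u : I → X → X}
    {v : J → Y → Y} (hι : Represents ι u) (hκ : Represents κ v) {e : Y ≃ᵐ X}
    (he : MeasurePreserving e ν μ)
    (hv : ∀ j, MeasurePreserving (v j) ν ν)
    (huv : ∀ F : Lp ℂ 2 μ, (∀ i, F ∘ u i =ᵐ[μ] F) ↔ ∀ j, (F ∘ e) ∘ v j =ᵐ[ν] F ∘ e) :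
    ∃ W : A ≃ₗᵢ[ℂ] B, ∀ a, κ (W a) =ᵐ[ν] ι a ∘ e := by
  have hc : ∀ F : Lp ℂ 2 μ, (∀ j, compL he F ∘ v j =ᵐ[ν] compL he F) ↔
      ∀ i, F ∘ u i =ᵐ[μ] F := by
    intro F
    rw [huv F]
    refine forall_congr' fun j => ?_
    have h1 := coeFn_compL he F
    have h2 := (hv j).quasiMeasurePreserving.ae_eq_comp h1
    exact ⟨fun h => h2.symm.trans (h.trans h1), fun h => h2.trans (h.trans h1.symm)⟩
  obtain ⟨W, hW⟩ := exists_linearIsometryEquiv_of_range (j := (compL he).comp ι) (k := κ)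
    fun F' => by
      rw [hκ F']
      constructor
      · rintro ⟨a, rfl⟩
        exact (hc _).2 ((hι _).1 ⟨a, rfl⟩)
      · intro hF'
        have hF : compL he (compL (he.symm e) F') = F' := by
          refine (compL_eq_iff he _ _).2
            ((he.quasiMeasurePreserving.ae_eq_comp (coeFn_compL (he.symm e) F')).trans ?_)
          exact Filter.EventuallyEq.of_eq (funext fun y => by simp)
        rw [← hF, hc] at hF'
        obtain ⟨a, ha⟩ := (hι _).2 hF'
        exact ⟨a, (congrArg (compL he) ha).trans hF⟩
  exact ⟨W, fun a => by rw [hW]; exact coeFn_compL he _⟩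

theorem ae_l2mul_l2mul {α X Y Z : Type*} [MeasurableSpace α] [MeasurableSpace X]
    [MeasurableSpace Y] [MeasurableSpace Z] {m : Measure α} {μ : Measure X} {ν : Measure Y}
    {τ : Measure Z} [IsProbabilityMeasure μ] [IsProbabilityMeasure ν] [IsProbabilityMeasure τ]
    {x : α → X × (Y × Z)} (hx : MeasurePreserving x m (μ.prod (ν.prod τ)))
    (f : Lp ℂ 2 μ) (g : Lp ℂ 2 ν) (k : Lp ℂ 2 τ) :
    (fun a => l2mul μ (ν.prod τ) f (l2mul ν τ g k) (x a)) =ᵐ[m]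
      fun a => f (x a).1 * (g (x a).2.1 * k (x a).2.2) := by
  refine hx.quasiMeasurePreserving.ae_eq_comp (g' := fun p => f p.1 * (g p.2.1 * k p.2.2)) ?_
  filter_upwards [coeFn_l2mul f (l2mul ν τ g k), comp_snd_ae_eq (μ := μ) (coeFn_l2mul g k)]
    with p h1 h2
  exact h1.trans (congrArg (f p.1 * ·) h2)

/-- Commutation of the point maps is carried to the operators by injectivity of `ι`. -/
theorem Implements.comm {ι : A →ₗᵢ[ℂ] Lp ℂ 2 μ} {U V : A → A} {r s : X → X}
    (hU : Implements ι U r) (hV : Implements ι V s) (hr : MeasurePreserving r μ μ)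
    (hs : MeasurePreserving s μ μ) (hrs : ∀ x, r (s x) = s (r x)) (a : A) :
    U (V a) = V (U a) := by
  refine ι.injective (Lp.ext ?_)
  have h1 := (hU (V a)).trans (hr.quasiMeasurePreserving.ae_eq_comp (hV a))
  have h2 := (hV (U a)).trans (hs.quasiMeasurePreserving.ae_eq_comp (hU a))
  refine h1.trans (Filter.EventuallyEq.trans ?_ h2.symm)
  exact Filter.EventuallyEq.of_eq (funext fun x => congrArg (ι a) (hrs x).symm)

theorem Implements.fixedVectorsRestrict {ι : A →ₗᵢ[ℂ] Lp ℂ 2 μ} {U : I → A ≃ₗᵢ[ℂ] A}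
    {V : A ≃ₗᵢ[ℂ] A} {r : X → X} (h : Implements ι V r) (hV : ∀ i x, V (U i x) = U i (V x)) :
    Implements (ι.comp (fixedVectors U).subtypeₗᵢ) (fixedVectorsRestrict U V hV) r :=
  fun a => h a

theorem HTensor.congr_congr {A A' A'' B B' B'' : Type*}
    [NormedAddCommGroup A] [InnerProductSpace ℂ A] [NormedAddCommGroup B] [InnerProductSpace ℂ B]
    [NormedAddCommGroup A'] [InnerProductSpace ℂ A']
    [NormedAddCommGroup B'] [InnerProductSpace ℂ B']
    [NormedAddCommGroup A''] [InnerProductSpace ℂ A'']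
    [NormedAddCommGroup B''] [InnerProductSpace ℂ B''] (u : A ≃ₗᵢ[ℂ] A') (u' : A' ≃ₗᵢ[ℂ] A'')
    (w : B ≃ₗᵢ[ℂ] B') (w' : B' ≃ₗᵢ[ℂ] B'') (x : HTensor A B) :
    HTensor.congr u' w' (HTensor.congr u w x) = HTensor.congr (u.trans u') (w.trans w') x := by
  refine HTensor.ext_clm
    (f := (HTensor.congr u' w').toLinearIsometry.toContinuousLinearMap.comp
      (HTensor.congr u w).toLinearIsometry.toContinuousLinearMap)
    (g := (HTensor.congr (u.trans u') (w.trans w')).toLinearIsometry.toContinuousLinearMap)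
    (fun a b => ?_) x
  change HTensor.congr u' w' (HTensor.congr u w (htmul a b)) =
    HTensor.congr (u.trans u') (w.trans w') (htmul a b)
  rw [HTensor.congr_htmul, HTensor.congr_htmul, HTensor.congr_htmul]
  rfl

end RepresentationLemmas

/-! ### Gauge transformations by position of their vertices. -/

section RegionGauge

variable {V E : Type*} {Γ : LinkSystem V E} {R : Region Γ} {G : Type*} [Group G]

namespace Region

/-- The restriction of a gauge transformation to the vertices of a given kind. -/
def part (R : Region Γ) (κ : VertexKind) (h : V → G) : V → G :=
  fun v => if R.vk v = κ then h v else 1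

theorem part_of_eq {κ : VertexKind} {v : V} (hv : R.vk v = κ) (h : V → G) :
    R.part κ h v = h v := if_pos hv

theorem part_of_ne {κ : VertexKind} {v : V} (hv : R.vk v ≠ κ) (h : V → G) :
    R.part κ h v = 1 := if_neg hv

theorem part_supported (κ : VertexKind) (h : V → G) : ∀ v ∉ R.verts κ, R.part κ h v = 1 :=
  fun _ hv => part_of_ne hv h

theorem eq_one_of_supported {κ : VertexKind} (hκ : κ ≠ .boundary) {h : V → G}
    (hh : ∀ v ∉ R.verts κ, h v = 1) : ∀ v ∉ R.bulk, h v = 1 := fun v hv =>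
  hh v fun hv' => hv fun hv'' => hκ (hv'.symm.trans hv'')

theorem part_eq_self {κ : VertexKind} {h : V → G} (hh : ∀ v ∉ R.verts κ, h v = 1) :
    R.part κ h = h := by
  funext v
  by_cases hv : R.vk v = κ
  · exact R.part_of_eq hv h
  · rw [R.part_of_ne hv, hh v hv]

theorem part_eq_one {κ κ' : VertexKind} (hκ : κ ≠ κ') {h : V → G}
    (hh : ∀ v ∉ R.verts κ, h v = 1) : R.part κ' h = 1 := by
  funext v
  by_cases hv : R.vk v = κ'
  · exact (R.part_of_eq hv h).trans (hh v fun hv' => hκ (hv'.symm.trans hv))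
  · exact R.part_of_ne hv h

theorem cornerGauge_of_corner (h : R.Corner → G) {v : V} (hv : R.vk v = .corner) :
    R.cornerGauge h v = h ⟨v, hv⟩ := dif_pos hv

theorem cornerGauge_of_ne (h : R.Corner → G) {v : V} (hv : R.vk v ≠ .corner) :
    R.cornerGauge h v = 1 := dif_neg hv

/-- Gauge transformations of the corner, as gauge transformations of the lattice. -/
def cornerGaugeHom (R : Region Γ) : (R.Corner → G) →* (V → G) where
  toFun := R.cornerGauge
  map_one' := by funext v; unfold cornerGauge; split_ifs <;> rfl
  map_mul' h k := by
    funext v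
    rw [Pi.mul_apply]
    unfold cornerGauge
    split_ifs
    · rfl
    · rw [mul_one]

theorem cornerGauge_mul (h k : R.Corner → G) :
    R.cornerGauge (h * k) = R.cornerGauge h * R.cornerGauge k := R.cornerGaugeHom.map_mul h k

theorem cornerGauge_inv (h : R.Corner → G) : R.cornerGauge h⁻¹ = (R.cornerGauge h)⁻¹ :=
  R.cornerGaugeHom.map_inv h

theorem continuous_cornerGauge [TopologicalSpace G] :
    Continuous (R.cornerGauge : (R.Corner → G) → V → G) :=
  continuous_pi fun v => by
    unfold cornerGauge
    split_ifs
    · exact continuous_apply _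
    · exact continuous_const

theorem cornerGauge_supported (h : R.Corner → G) : ∀ v ∉ R.bulk, R.cornerGauge h v = 1 :=
  fun v hv => R.cornerGauge_of_ne h fun hv' => hv fun hv'' => by rw [hv'] at hv''; cases hv''

theorem uniform_of_corner (g : G) {v : V} (hv : R.vk v = .corner) : R.uniform g v = g :=
  R.cornerGauge_of_corner _ hv

theorem uniform_of_ne (g : G) {v : V} (hv : R.vk v ≠ .corner) : R.uniform g v = 1 :=
  R.cornerGauge_of_ne _ hv

theorem uniform_inv (g : G) : R.uniform g⁻¹ = (R.uniform g)⁻¹ := R.cornerGauge_inv fun _ => g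

end Region

theorem ExtrinsicFrame.node_ne_interior (Φ : ExtrinsicFrame R) (v : R.Corner)
    (j : Fin (Φ.len v + 2)) : R.vk (Φ.node v j) ≠ .interior := by
  cases j using Fin.cases with
  | zero => rw [Φ.start]; simp
  | succ i =>
    have h1 := R.exterior_edge _ (Φ.exterior v i)
    have h2 := Φ.joins v i
    unfold LinkSystem.Joins at h2
    split_ifs at h2
    · rw [← h2.2]; exact h1.2
    · rw [← h2.2]; exact h1.1

theorem ExtrinsicFrame.complLinks_ne_interior (Φ : ExtrinsicFrame R) (d : Φ.ComplDof) :
    R.vk (Φ.complLinks.src d) ≠ .interior ∧ R.vk (Φ.complLinks.tgt d) ≠ .interior := by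
  rcases d with e | p
  · exact R.exterior_edge _ e.2.1
  · exact ⟨Φ.node_ne_interior _ _, Φ.node_ne_interior _ _⟩

theorem IntrinsicFrame.subLinks_vk (Ψ : IntrinsicFrame R) (d : Ψ.SubDof) :
    (R.vk (Ψ.subLinks.src d) = .interior ∨ R.vk (Ψ.subLinks.src d) = .corner) ∧
      (R.vk (Ψ.subLinks.tgt d) = .interior ∨ R.vk (Ψ.subLinks.tgt d) = .corner) := by
  rcases d with e | e
  · exact R.interior_edge _ e.2
  · exact (R.corner_edge _ e.2.1).imp Or.inr Or.inr

theorem IntrinsicFrame.subLinks_act_congr (Ψ : IntrinsicFrame R) {h k : V → G}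
    (hi : ∀ v, R.vk v = .interior → h v = k v) (hc : ∀ v, R.vk v = .corner → h v = k v) :
    Ψ.subLinks.act h = Ψ.subLinks.act k :=
  Ψ.subLinks.act_congr (fun d => (Ψ.subLinks_vk d).1.elim (hi _) (hc _))
    fun d => (Ψ.subLinks_vk d).2.elim (hi _) (hc _)

/-- All ends of links of sub are interior or on the corner, and the constant `g` acts trivially.
Dividing by it moves the uniform transformation from the corner to the inverse one on the interior.
-/
theorem IntrinsicFrame.subLinks_act_part_mul (Ψ : IntrinsicFrame R)
    (hG : ∀ x y : G, x * y = y * x) (h : V → G) (g : G) :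
    Ψ.subLinks.act (R.part .interior h * R.uniform g) =
      Ψ.subLinks.act (R.part .interior (h * fun _ => g⁻¹)) := by
  have h1 : Ψ.subLinks.act (R.part .interior h * R.uniform g) =
      Ψ.subLinks.act (R.part .interior (h * fun _ => g⁻¹) * fun _ => g) :=
    Ψ.subLinks_act_congr (fun v hv => by simp [R.part_of_eq hv, R.uniform_of_ne, hv])
      fun v hv => by simp [R.part_of_ne, R.uniform_of_corner, hv]
  rw [h1, ← LinkSystem.act_comp_act, Ψ.subLinks.act_eq_id_of_comm hG (h := fun _ => g) fun _ => rfl]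
  rfl

theorem ExtrinsicFrame.complLinks_act_congr (Φ : ExtrinsicFrame R) {h k : V → G}
    (hhk : ∀ v, R.vk v ≠ .interior → h v = k v) : Φ.complLinks.act h = Φ.complLinks.act k :=
  Φ.complLinks.act_congr (fun d => hhk _ (Φ.complLinks_ne_interior d).1)
    fun d => hhk _ (Φ.complLinks_ne_interior d).2

theorem ExtrinsicFrame.links_act_congr (Φ : ExtrinsicFrame R) {h k : V → G}
    (hb : ∀ v, R.vk v = .boundary → h v = k v) (hc : ∀ v, R.vk v = .corner → h v = k v) :
    Φ.links.act h = Φ.links.act k :=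
  Φ.links.act_congr (fun v => hb _ (Φ.start v)) fun v => hc _ v.2

/-- The lines start on the global boundary, where the transformation is trivial, so no right factor
occurs. -/
theorem ExtrinsicFrame.links_act_cornerGauge (Φ : ExtrinsicFrame R) (h g : R.Corner → G) :
    Φ.links.act (R.cornerGauge h) g = h * g := by
  funext v
  have h1 : R.cornerGauge h (Φ.node v 0) = 1 :=
    R.cornerGauge_of_ne h (by rw [Φ.start]; simp)
  change R.cornerGauge h v * g v * (R.cornerGauge h (Φ.node v 0))⁻¹ = h v * g v
  rw [h1, R.cornerGauge_of_corner h v.2, inv_one, mul_one]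

/-- The gauge transformations supported on the corner vertices other than the root. -/
def IntrinsicFrame.gauge [DecidableEq V] (Ψ : IntrinsicFrame R) (q : Ψ.Dof → G) : V → G :=
  R.cornerGauge fun v => if hv : v ≠ Ψ.root then q ⟨v, hv⟩ else 1

section

variable [DecidableEq V] (Ψ : IntrinsicFrame R)

theorem IntrinsicFrame.gauge_root (q : Ψ.Dof → G) : Ψ.gauge q Ψ.root = 1 :=
  (R.cornerGauge_of_corner _ Ψ.root.2).trans (dif_neg (not_not.2 rfl))

theorem IntrinsicFrame.gauge_dof (q : Ψ.Dof → G) (v : Ψ.Dof) : Ψ.gauge q v.1 = q v :=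
  (R.cornerGauge_of_corner _ v.1.2).trans (dif_pos v.2)

theorem IntrinsicFrame.gauge_of_ne (q : Ψ.Dof → G) {v : V} (hv : R.vk v ≠ .corner) :
    Ψ.gauge q v = 1 := R.cornerGauge_of_ne _ hv

/-- The gauge transformations of the corner off the root, as gauge transformations of the
lattice. -/
def IntrinsicFrame.gaugeHom : (Ψ.Dof → G) →* (V → G) where
  toFun := Ψ.gauge
  map_one' := by
    refine Eq.trans (congrArg R.cornerGauge ?_) R.cornerGaugeHom.map_one
    funext v
    split_ifs <;> rfl
  map_mul' h k := by
    refine Eq.trans (congrArg R.cornerGauge ?_) (R.cornerGauge_mul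
      (fun v => if hv : v ≠ Ψ.root then h ⟨v, hv⟩ else 1)
      fun v => if hv : v ≠ Ψ.root then k ⟨v, hv⟩ else 1)
    funext v
    rw [Pi.mul_apply]
    split_ifs
    · rfl
    · rw [mul_one]

theorem IntrinsicFrame.gauge_inv (q : Ψ.Dof → G) : Ψ.gauge q⁻¹ = (Ψ.gauge q)⁻¹ :=
  Ψ.gaugeHom.map_inv q

theorem IntrinsicFrame.continuous_gauge [TopologicalSpace G] :
    Continuous (Ψ.gauge : (Ψ.Dof → G) → V → G) :=
  R.continuous_cornerGauge.comp <| continuous_pi fun v => by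
    split_ifs
    · exact continuous_apply _
    · exact continuous_const

theorem IntrinsicFrame.links_act_gauge (h l : Ψ.Dof → G) : Ψ.links.act (Ψ.gauge h) l = h * l := by
  funext v
  change Ψ.gauge h v.1 * l v * (Ψ.gauge h Ψ.root)⁻¹ = h v * l v
  rw [Ψ.gauge_root, Ψ.gauge_dof, inv_one, mul_one]

end

end RegionGauge

/-! ### Reduction relative to the extrinsic frame. -/

section Extrinsic

variable {V E : Type*} [Fintype V] [DecidableEq V] [Fintype E] [DecidableEq E]
  {Γ : LinkSystem V E} {R : Region Γ} (Φ : ExtrinsicFrame R) (Ψ : IntrinsicFrame R)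
  {G : Type*} [Group G] [TopologicalSpace G] [IsTopologicalGroup G] [CompactSpace G]
  [SecondCountableTopology G] [T2Space G] [MeasurableSpace G] [BorelSpace G]

/-- The coordinates of the lattice relative to the extrinsic frame. -/
def extrinsicCoords : FrameCoords (haarPi G E)
    ((haarPi G Ψ.SubDof).prod ((haarPi G Φ.ComplDof).prod (haarPi G Ψ.Dof)))
    (haarPi G R.Corner) :=
  LinkSystem.frameCoords Ψ.subLinks Φ.complLinks Ψ.links R.cornerGaugeHom R.continuous_cornerGauge
    (fun a => (Ψ.subVar a, Φ.complVar a, Ψ.var a))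
    (Ψ.continuous_subVar.prodMk (Φ.continuous_complVar.prodMk Ψ.continuous_var))
    Φ.var Φ.continuous_var
    (fun a a' h => by
      simp only [Prod.mk.injEq] at h
      exact eq_of_frame_vars_eq Φ Ψ h.1.1 h.1.2.1 h.1.2.2 h.2)
    fun k => by
      obtain ⟨t, s, hts⟩ := exists_translation Φ Ψ k.1.1 k.1.2.1 k.1.2.2 k.2
      refine ⟨t, s, fun a => ?_⟩
      obtain ⟨h1, h2, h3, h4⟩ := hts a
      rw [h1, h2, h3, h4]
      rfl

theorem extrinsicCoords_x_act (h : V → G) (a : E → G) :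
    (extrinsicCoords Φ Ψ).x (Γ.act h a) =
      LinkSystem.act₃ Ψ.subLinks Φ.complLinks Ψ.links h ((extrinsicCoords Φ Ψ).x a) :=
  Prod.ext (Ψ.subVar_act h a) (Prod.ext (Φ.complVar_act h a) (Ψ.var_act h a))

/-- The frame variables acquire `h` on the left, and their inverse in the dressing cancels `h` on
the corner. The links of the intrinsic frame have corner ends only, so nothing acts on them; sub
retains the interior part of `h` and compl the exterior part. -/
theorem extrinsicCoords_dressed_act {h : V → G} (hb : ∀ v ∉ R.bulk, h v = 1) (a : E → G) :
    (extrinsicCoords Φ Ψ).dressed (Γ.act h a) =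
      Prod.map (Ψ.subLinks.act (R.part .interior h))
        (Prod.map (Φ.complLinks.act (R.part .exterior h)) id)
        ((extrinsicCoords Φ Ψ).dressed a) := by
  have hb' : ∀ v, R.vk v = .boundary → h v = 1 := fun v hv => hb v fun hv' => hv' hv
  have hq : Φ.var (Γ.act h a) = (fun v : R.Corner => h v) * Φ.var a := by
    rw [Φ.var_act]
    funext v
    change h v * _ * (h (Φ.node v 0))⁻¹ = _
    rw [hb' _ (Φ.start v), inv_one, mul_one]
    rfl
  change LinkSystem.act₃ _ _ _ (R.cornerGauge (Φ.var (Γ.act h a))⁻¹)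
    ((extrinsicCoords Φ Ψ).x (Γ.act h a)) = Prod.map _ _
      (LinkSystem.act₃ _ _ _ (R.cornerGauge (Φ.var a)⁻¹) ((extrinsicCoords Φ Ψ).x a))
  rw [extrinsicCoords_x_act, ← LinkSystem.act₃_mul, hq]
  generalize (extrinsicCoords Φ Ψ).x a = x
  generalize Φ.var a = g
  obtain ⟨x₁, x₂, x₃⟩ := x
  simp only [LinkSystem.act₃, Prod.map]
  refine Prod.ext ?_ (Prod.ext ?_ ?_)
  · dsimp only
    rw [← LinkSystem.act_mul_apply]
    refine congrFun (Ψ.subLinks_act_congr (fun v hv => ?_) fun v hv => ?_) _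
    · simp [R.part_of_eq hv, R.cornerGauge_of_ne, hv]
    · simp [R.part_of_ne, R.cornerGauge_of_corner, hv]
  · dsimp only
    rw [← LinkSystem.act_mul_apply]
    refine congrFun (Φ.complLinks_act_congr fun v hv => ?_) _
    cases hk : R.vk v with
    | interior => exact absurd hk hv
    | corner => simp [R.part_of_ne, R.cornerGauge_of_corner, hk]
    | exterior => simp [R.part_of_eq hk, R.cornerGauge_of_ne, hk]
    | boundary => simp [R.part_of_ne, R.cornerGauge_of_ne, hk, hb' v hk]
  · dsimp only
    have hc : ∀ v : R.Corner, (R.cornerGauge ((fun v : R.Corner => h v) * g)⁻¹ * h : V → G) v =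
        R.cornerGauge g⁻¹ v := fun v => by
      simp [R.cornerGauge_of_corner, v.2]
    exact congrFun (Ψ.links.act_congr (fun _ => hc Ψ.root) fun v => hc v.1) x₃

/-- The reduction relative to the extrinsic frame. -/
theorem exists_extrinsicPW :
    ∃ T : (R.Corner → G) →
        (R.Hphys G ≃ₗᵢ[ℂ] HTensor (Ψ.Hsub G) (HTensor (Φ.Hcompl G) (Ψ.H G))),
      IsExtrinsicPW Φ Ψ (fun g ψ => T g ψ) ∧
      (∀ T', IsExtrinsicPW Φ Ψ T' → ∀ g ψ, T' g ψ = T g ψ) ∧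
      (∀ (h g : R.Corner → G) (ψ : R.Hphys G), T (h * g) ψ =
        HTensor.congr (Ψ.subLinks.gaugeUPhys (R.verts .interior) (R.cornerGauge h))
          (HTensor.congr (Φ.complLinks.gaugeUPhys (R.verts .exterior) (R.cornerGauge h))
            (Ψ.links.gaugeU (R.cornerGauge h))) (T g ψ)) := by
  let fr : FrameCoords (haarPi G E) _ _ := extrinsicCoords Φ Ψ
  have hcompl := (Φ.complLinks.represents_gauss (G := G) (R.verts .exterior)).tensor
    (represents_id (μ := haarPi G Ψ.Dof)) (fun h => Φ.complLinks.measurePreserving_act h.1)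
    (fun e => e.elim)
  have hmpc : ∀ j, MeasurePreserving (Sum.elim
      (fun h : {h : V → G // ∀ v ∉ R.verts .exterior, h v = 1} =>
        Prod.map (Φ.complLinks.act h.1) (id : (Ψ.Dof → G) → Ψ.Dof → G))
      (fun e : Empty => Prod.map id (Empty.elim e)) j)
      ((haarPi G Φ.ComplDof).prod (haarPi G Ψ.Dof))
      ((haarPi G Φ.ComplDof).prod (haarPi G Ψ.Dof)) := by
    rintro (h | e)
    · exact (Φ.complLinks.measurePreserving_act h.1).prod (.id _)
    · exact e.elim
  have hrep := (Ψ.subLinks.represents_gauss (G := G) (R.verts .interior)).tensor hcompl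
    (fun h => Ψ.subLinks.measurePreserving_act h.1) hmpc
  have hmpu : ∀ j, MeasurePreserving (Sum.elim
      (fun h : {h : V → G // ∀ v ∉ R.verts .interior, h v = 1} =>
        Prod.map (Ψ.subLinks.act h.1)
          (id : (Φ.ComplDof → G) × (Ψ.Dof → G) → (Φ.ComplDof → G) × (Ψ.Dof → G)))
      (fun j => Prod.map id (Sum.elim
      (fun h : {h : V → G // ∀ v ∉ R.verts .exterior, h v = 1} =>
        Prod.map (Φ.complLinks.act h.1) (id : (Ψ.Dof → G) → Ψ.Dof → G))
      (fun e : Empty => Prod.map id (Empty.elim e)) j)) j)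
      ((haarPi G Ψ.SubDof).prod ((haarPi G Φ.ComplDof).prod (haarPi G Ψ.Dof)))
      ((haarPi G Ψ.SubDof).prod ((haarPi G Φ.ComplDof).prod (haarPi G Ψ.Dof))) := by
    rintro (h | j)
    · exact (Ψ.subLinks.measurePreserving_act h.1).prod (.id _)
    · exact (MeasurePreserving.id _).prod (hmpc j)
  have := LinkSystem.innerRegularCompactLTTop_haarPi₃ G Ψ.SubDof Φ.ComplDof Ψ.Dof
  obtain ⟨T, hc, hpw, huniq, hequi⟩ := fr.exists_pageWootters
    (LinkSystem.continuous_act₃ Ψ.subLinks Φ.complLinks Ψ.links R.continuous_cornerGauge)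
    (fun h : {h : V → G // ∀ v ∉ R.bulk, h v = 1} => Γ.measurePreserving_act h.1)
    (Γ.represents_gauss R.bulk) hrep (fun j => (hmpu j).measurable)
    -- The dressed action is an interior symmetry composed with an exterior one, each imposed on its
    -- own tensor factor.
    (fun h => ⟨_, extrinsicCoords_dressed_act Φ Ψ h.2, fun y hy => by
      have h1 := hy (Sum.inl ⟨R.part .interior h.1, R.part_supported _ _⟩)
      have h2 := hy (Sum.inr (Sum.inl ⟨R.part .exterior h.1, R.part_supported _ _⟩))
      exact ae_eq_comp_comp (hmpu (Sum.inr (Sum.inl ⟨R.part .exterior h.1,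
        R.part_supported _ _⟩))) h1 h2⟩)
    (fun j => by
      rcases j with h | h | e
      · refine ⟨⟨h.1, R.eq_one_of_supported (by simp) h.2⟩, fun a => ?_⟩
        rw [extrinsicCoords_dressed_act Φ Ψ (R.eq_one_of_supported (by simp) h.2), R.part_eq_self h.2,
          R.part_eq_one (κ' := .exterior) (by simp) h.2, LinkSystem.act_one, Prod.map_id]
        rfl
      · refine ⟨⟨h.1, R.eq_one_of_supported (by simp) h.2⟩, fun a => ?_⟩
        rw [extrinsicCoords_dressed_act Φ Ψ (R.eq_one_of_supported (by simp) h.2), R.part_eq_self h.2,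
          R.part_eq_one (κ' := .interior) (by simp) h.2, LinkSystem.act_one]
        rfl
      · exact e.elim)
    (fun h => ⟨⟨R.cornerGauge h, R.cornerGauge_supported h⟩, fun a =>
      ⟨extrinsicCoords_x_act Φ Ψ _ a, (Φ.var_act _ a).trans (Φ.links_act_cornerGauge h _)⟩⟩)
    (V := fun h => HTensor.congr
      (Ψ.subLinks.gaugeUPhys (R.verts .interior) (R.cornerGauge h))
      (HTensor.congr (Φ.complLinks.gaugeUPhys (R.verts .exterior) (R.cornerGauge h))
        (Ψ.links.gaugeU (R.cornerGauge h))))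
    (fun h => by
      have := (Ψ.subLinks.implements_gaugeUPhys (R.verts .interior) (R.cornerGauge h)).tensor
        ((Φ.complLinks.implements_gaugeUPhys (R.verts .exterior) (R.cornerGauge h)).tensor
          (Ψ.links.implements_gaugeU (R.cornerGauge h)) (Φ.complLinks.measurePreserving_act _)
          (Ψ.links.measurePreserving_act _)) (Ψ.subLinks.measurePreserving_act _)
          ((Φ.complLinks.measurePreserving_act _).prod (Ψ.links.measurePreserving_act _))
      rw [← R.cornerGauge_inv] at this
      exact this)
    (β := LinkL2 G Ψ.SubDof × LinkL2 G Φ.ComplDof × Ψ.H G)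
    (F := fun b => l2mul _ _ b.1 (l2mul _ _ b.2.1 b.2.2))
    (z := fun b => htmul ((Ψ.Hsub G).orthogonalProjectionOnto b.1)
            (htmul ((Φ.Hcompl G).orthogonalProjectionOnto b.2.1) b.2.2))
    (fun b => (isDual_orthogonalProjection _ _).tensor
      ((isDual_orthogonalProjection _ _).tensor (isDual_id _)))
    (fun y hy => eq_zero_of_inner_l2mul_l2mul y fun f g k => hy (f, g, k))
  have hov : ∀ (b : LinkL2 G Ψ.SubDof × LinkL2 G Φ.ComplDof × Ψ.H G) (χ : Φ.H G)
      (ψ : LinkL2 G E), ∫ a, conj (l2mul (haarPi G Ψ.SubDof) _ b.1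
        (l2mul (haarPi G Φ.ComplDof) (haarPi G Ψ.Dof) b.2.1 b.2.2) (fr.x a) * χ (fr.q a)) * ψ a
          ∂(haarPi G E) = frameOverlap Φ Ψ b.1 b.2.1 b.2.2 χ ψ := by
    intro b χ ψ
    refine integral_congr_ae ?_
    filter_upwards [ae_l2mul_l2mul (measurePreserving_fst.comp fr.measurePreserving)
      b.1 b.2.1 b.2.2] with a ha
    refine congrArg (fun z => conj (z * χ (fr.q a)) * ψ a) (ha.trans ?_)
    exact (mul_assoc _ _ _).symm
  refine ⟨T, fun ψ => ⟨hc ψ, fun f k l χ => (hpw (f, k, l) χ ψ).trans (hov (f, k, l) χ ψ)⟩,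
    fun T' hT' => huniq T' fun ψ => ⟨(hT' ψ).1, fun b χ =>
      ((hT' ψ).2 b.1 b.2.1 b.2.2 χ).trans (hov b χ ψ).symm⟩, hequi⟩

end Extrinsic

/-! ### Splitting of the region and its neutrality in the Abelian case. -/

section Splitting

variable {V E : Type*} [Fintype V] [DecidableEq V] [Fintype E] [DecidableEq E]
  {Γ : LinkSystem V E} {R : Region Γ} (Ψ : IntrinsicFrame R)
  {G : Type*} [Group G] [TopologicalSpace G] [IsTopologicalGroup G] [CompactSpace G]
  [SecondCountableTopology G] [T2Space G] [MeasurableSpace G] [BorelSpace G]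

/-- The region splits into its interior and the corner edges off the intrinsic frame. -/
theorem exists_subSplitting :
    ∃ S : HTensor (R.Hint G) (LinkL2 G Ψ.RestDof) ≃ₗᵢ[ℂ] Ψ.Hsub G,
      (∀ (f : R.Hint G) (k : LinkL2 G Ψ.RestDof),
        ((S (htmul f k) : LinkL2 G Ψ.SubDof) : (Ψ.SubDof → G) → ℂ) =ᵐ[haarPi G Ψ.SubDof]
          fun a => (f : LinkL2 G R.IntDof) (a ∘ Sum.inl) * k (a ∘ Sum.inr)) ∧
      (∀ (h : R.Corner → G) x,
        S (HTensor.congr (R.intLinks.gaugeUPhys (R.verts .interior) (R.cornerGauge h))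
          (Ψ.restLinks.gaugeU (R.cornerGauge h)) x) =
        Ψ.subLinks.gaugeUPhys (R.verts .interior) (R.cornerGauge h) (S x)) := by
  let e : (Ψ.SubDof → G) ≃ᵐ (R.IntDof → G) × (Ψ.RestDof → G) :=
    MeasurableEquiv.sumPiEquivProdPi fun _ => G
  have he : MeasurePreserving e (haarPi G Ψ.SubDof)
      ((haarPi G R.IntDof).prod (haarPi G Ψ.RestDof)) :=
    measurePreserving_sumPiEquivProdPi fun _ => haarProb G
  have hact : ∀ (h : V → G) (a : Ψ.SubDof → G),
      Prod.map (R.intLinks.act h) (Ψ.restLinks.act h) (e a) = e (Ψ.subLinks.act h a) :=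
    fun h a => rfl
  -- Corner edges have no interior end, so the interior constraints concern the first factor alone.
  have hint : ∀ h : {h : V → G // ∀ v ∉ R.verts .interior, h v = 1},
      Ψ.restLinks.act h.1 = id := fun h => by
    have hv : ∀ v, R.vk v = .corner → h.1 v = 1 := fun v hv => h.2 v fun hv' => by
      cases hv.symm.trans hv'
    exact Ψ.restLinks.act_eq_id (fun d => hv _ (R.corner_edge _ d.2.1).1)
      fun d => hv _ (R.corner_edge _ d.2.1).2
  have hrep := (R.intLinks.represents_gauss (G := G) (R.verts .interior)).tensor
    (represents_id (μ := haarPi G Ψ.RestDof)) (fun h => R.intLinks.measurePreserving_act h.1)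
    (fun e => e.elim)
  obtain ⟨S, hS⟩ := hrep.exists_equiv
    (Ψ.subLinks.represents_gauss (G := G) (R.verts .interior)) he
    (fun h => Ψ.subLinks.measurePreserving_act h.1) fun F => by
      have key : ∀ h : {h : V → G // ∀ v ∉ R.verts .interior, h v = 1},
          F ∘ Prod.map (R.intLinks.act h.1) id =ᵐ[(haarPi G R.IntDof).prod (haarPi G Ψ.RestDof)] F ↔
          (F ∘ e) ∘ Ψ.subLinks.act h.1 =ᵐ[haarPi G Ψ.SubDof] F ∘ e := fun h =>
        ae_eq_comp_iff_of_semiconj he fun a => by rw [← hact, hint]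
      constructor
      · exact fun hF h => (key h).1 (hF (Sum.inl h))
      · rintro hF (h | e)
        · exact (key h).2 (hF h)
        · exact e.elim
  refine ⟨S, fun f k => ?_, fun h x => ?_⟩
  · refine (hS (htmul f k)).trans ?_
    rw [tensorRep_htmul]
    exact he.quasiMeasurePreserving.ae_eq_comp (coeFn_l2mul _ _)
  · refine Subtype.ext (Lp.ext ?_)
    have h1 := hS (HTensor.congr (R.intLinks.gaugeUPhys (R.verts .interior) (R.cornerGauge h))
      (Ψ.restLinks.gaugeU (R.cornerGauge h)) x)
    have h2 := he.quasiMeasurePreserving.ae_eq_comp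
      (((R.intLinks.implements_gaugeUPhys (R.verts .interior) (R.cornerGauge h)).tensor
        (Ψ.restLinks.implements_gaugeU (R.cornerGauge h)) (R.intLinks.measurePreserving_act _)
        (Ψ.restLinks.measurePreserving_act _)) x)
    have h3 := Ψ.subLinks.implements_gaugeUPhys (R.verts .interior) (R.cornerGauge h) (S x)
    have h4 := (Ψ.subLinks.measurePreserving_act
      (R.cornerGauge h)⁻¹).quasiMeasurePreserving.ae_eq_comp (hS x)
    exact h1.trans (h2.trans (h4.symm.trans h3.symm))

theorem IntrinsicFrame.subNeutral (hG : ∀ x y : G, x * y = y * x) : Ψ.SubNeutral G := fun g f =>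
  -- The operator composes with the inverse transformation, so `subLinks_act_part_mul` is used for
  -- `g⁻¹`; this produces the double inverse.
  Ψ.subLinks.gaugeUPhys_eq_self (R.part_supported .interior (1 * fun _ => g⁻¹⁻¹))
    (by
      rw [← Ψ.subLinks_act_part_mul hG, ← R.uniform_inv]
      refine congrArg _ (funext fun v => ?_)
      unfold Region.part
      simp) f

end Splitting

/-! ### Neutrality of the complement. -/

section Neutral

variable {V E : Type*} [Fintype V] [Fintype E] [DecidableEq E]
  {Γ : LinkSystem V E} {R : Region Γ} (Φ : ExtrinsicFrame R)
  {G : Type*} [Group G] [TopologicalSpace G] [IsTopologicalGroup G] [CompactSpace G]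
  [SecondCountableTopology G] [T2Space G] [MeasurableSpace G] [BorelSpace G]

theorem ExtrinsicFrame.complNeutral (hG : ∀ x y : G, x * y = y * x)
    (hb : ∀ d : Φ.ComplDof, R.vk (Φ.complLinks.src d) = .boundary ↔
      R.vk (Φ.complLinks.tgt d) = .boundary) : Φ.ComplNeutral G := fun g k =>
  Φ.complLinks.gaugeUPhys_eq_self (R.part_supported .exterior fun _ => g)
    (by
      -- `c` takes equal values at both ends of every link of compl, because no such link joins the
      -- boundary to the rest; it therefore acts trivially. Modulo `c`, the inverse uniform corner
      -- transformation is the exterior constant `g`.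
      let c : V → G := fun v => if R.vk v = .boundary then 1 else g⁻¹
      have h1 : Φ.complLinks.act (R.uniform g)⁻¹ =
          Φ.complLinks.act ((R.part .exterior fun _ => g) * c) :=
        Φ.complLinks_act_congr fun v hv => by
          cases hk : R.vk v with
          | interior => exact absurd hk hv
          | corner => simp [c, R.part_of_ne, R.uniform_of_corner, hk]
          | exterior => simp [c, R.part_of_eq hk, R.uniform_of_ne, hk]
          | boundary => simp [c, R.part_of_ne, R.uniform_of_ne, hk]
      rw [h1, ← LinkSystem.act_comp_act, Φ.complLinks.act_eq_id_of_comm hG (h := c) fun d => ?_]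
      · rfl
      · simp only [c, hb d]) k

end Neutral

/-! ### Jointly invariant states of complement and extrinsic frame. -/

section Outside

variable {V E : Type*} [Fintype V] [Fintype E] [DecidableEq E]
  {Γ : LinkSystem V E} {R : Region Γ} (Φ : ExtrinsicFrame R)
  {G : Type*} [Group G] [TopologicalSpace G] [IsTopologicalGroup G] [CompactSpace G]
  [SecondCountableTopology G] [T2Space G] [MeasurableSpace G] [BorelSpace G]

/-- The symmetries of the wave functions of complement and extrinsic frame. -/
def outSymm : ({h : V → G // ∀ v ∉ R.verts .exterior, h v = 1} ⊕ Empty) ⊕ G →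
    (Φ.ComplDof → G) × (R.Corner → G) → (Φ.ComplDof → G) × (R.Corner → G) :=
  Sum.elim (Sum.elim (fun h => Prod.map (Φ.complLinks.act h.1) id)
    fun e => Prod.map id (Empty.elim e))
    fun g => Prod.map (Φ.complLinks.act (R.uniform g)⁻¹) (Φ.links.act (R.uniform g)⁻¹)

theorem measurePreserving_outSymm (j) : MeasurePreserving (outSymm (G := G) Φ j)
    ((haarPi G Φ.ComplDof).prod (haarPi G R.Corner))
    ((haarPi G Φ.ComplDof).prod (haarPi G R.Corner)) := by
  rcases j with (h | e) | g
  · exact (Φ.complLinks.measurePreserving_act h.1).prod (.id _)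
  · exact e.elim
  · exact (Φ.complLinks.measurePreserving_act _).prod (Φ.links.measurePreserving_act _)

variable (G) in
/-- The representation of the states of complement and extrinsic frame by wave functions. -/
noncomputable abbrev complFrameRep : HTensor (Φ.Hcompl G) (Φ.H G) →ₗᵢ[ℂ]
    Lp ℂ 2 ((haarPi G Φ.ComplDof).prod (haarPi G R.Corner)) :=
  tensorRep (Φ.Hcompl G).subtypeₗᵢ LinearIsometry.id

variable (G) in
/-- The representation of the jointly invariant states of complement and extrinsic frame by wave
functions. -/
noncomputable abbrev outRep : Φ.Hout G →ₗᵢ[ℂ]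
    Lp ℂ 2 ((haarPi G Φ.ComplDof).prod (haarPi G R.Corner)) :=
  (complFrameRep Φ G).comp (Φ.Hout G).subtypeₗᵢ

/-- The gauge transformation `h` of complement and extrinsic frame. -/
noncomputable abbrev complFrameU (h : V → G) :
    HTensor (Φ.Hcompl G) (Φ.H G) ≃ₗᵢ[ℂ] HTensor (Φ.Hcompl G) (Φ.H G) :=
  HTensor.congr (Φ.complLinks.gaugeUPhys (R.verts .exterior) h) (Φ.links.gaugeU h)

theorem implements_complFrameU (h : V → G) : Implements (complFrameRep Φ G) (complFrameU Φ h)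
    (Prod.map (Φ.complLinks.act h⁻¹) (Φ.links.act h⁻¹)) :=
  (Φ.complLinks.implements_gaugeUPhys _ h).tensor (Φ.links.implements_gaugeU h)
    (Φ.complLinks.measurePreserving_act _) (Φ.links.measurePreserving_act _)

theorem complFrameU_comm (hG : ∀ x y : G, x * y = y * x) (h k : V → G)
    (x : HTensor (Φ.Hcompl G) (Φ.H G)) :
    complFrameU Φ h (complFrameU Φ k x) = complFrameU Φ k (complFrameU Φ h x) :=
  (implements_complFrameU Φ h).comm (implements_complFrameU Φ k)
    ((Φ.complLinks.measurePreserving_act _).prod (Φ.links.measurePreserving_act _))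
    ((Φ.complLinks.measurePreserving_act _).prod (Φ.links.measurePreserving_act _))
    (fun _ => Prod.ext (Φ.complLinks.act_comm hG _ _ _) (Φ.links.act_comm hG _ _ _)) x

/-- The restriction of a gauge transformation to the jointly invariant states of complement and
extrinsic frame. -/
noncomputable def outU (hG : ∀ x y : G, x * y = y * x) (h : V → G) : Φ.Hout G ≃ₗᵢ[ℂ] Φ.Hout G :=
  fixedVectorsRestrict _ (complFrameU Φ h) fun _ => complFrameU_comm Φ hG _ _

theorem implements_outU (hG : ∀ x y : G, x * y = y * x) (h : V → G) :
    Implements (outRep Φ G) (outU Φ hG h)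
      (Prod.map (Φ.complLinks.act h⁻¹) (Φ.links.act h⁻¹)) :=
  (implements_complFrameU Φ h).fixedVectorsRestrict _

theorem represents_outRep : Represents (outRep Φ G) (outSymm Φ) :=
  ((Φ.complLinks.represents_gauss (G := G) (R.verts .exterior)).tensor
    (represents_id (μ := haarPi G R.Corner)) (fun h => Φ.complLinks.measurePreserving_act h.1)
    (fun e => e.elim)).fixedVectors fun g => implements_complFrameU Φ (R.uniform g)

end Outside

/-! ### Reduction relative to the intrinsic frame, Abelian case. -/

section Intrinsic

variable {V E : Type*} [Fintype V] [DecidableEq V] [Fintype E] [DecidableEq E]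
  {Γ : LinkSystem V E} {R : Region Γ} (Φ : ExtrinsicFrame R) (Ψ : IntrinsicFrame R)
  {G : Type*} [Group G] [TopologicalSpace G] [IsTopologicalGroup G] [CompactSpace G]
  [SecondCountableTopology G] [T2Space G] [MeasurableSpace G] [BorelSpace G]

/-- The coordinates of the lattice relative to the intrinsic frame. -/
def intrinsicCoords : FrameCoords (haarPi G E)
    ((haarPi G Ψ.SubDof).prod ((haarPi G Φ.ComplDof).prod (haarPi G R.Corner)))
    (haarPi G Ψ.Dof) :=
  LinkSystem.frameCoords Ψ.subLinks Φ.complLinks Φ.links Ψ.gaugeHom Ψ.continuous_gauge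
    (fun a => (Ψ.subVar a, Φ.complVar a, Φ.var a))
    (Ψ.continuous_subVar.prodMk (Φ.continuous_complVar.prodMk Φ.continuous_var))
    Ψ.var Ψ.continuous_var
    (fun a a' h => by
      simp only [Prod.mk.injEq] at h
      exact eq_of_frame_vars_eq Φ Ψ h.1.1 h.1.2.1 h.2 h.1.2.2)
    fun k => by
      obtain ⟨t, s, hts⟩ := exists_translation Φ Ψ k.1.1 k.1.2.1 k.2 k.1.2.2
      refine ⟨t, s, fun a => ?_⟩
      obtain ⟨h1, h2, h3, h4⟩ := hts a
      rw [h1, h2, h3, h4]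
      rfl

theorem intrinsicCoords_x_act (h : V → G) (a : E → G) :
    (intrinsicCoords Φ Ψ).x (Γ.act h a) =
      LinkSystem.act₃ Ψ.subLinks Φ.complLinks Φ.links h ((intrinsicCoords Φ Ψ).x a) :=
  Prod.ext (Ψ.subVar_act h a) (Prod.ext (Φ.complVar_act h a) (Φ.var_act h a))

/-- The tree variables acquire `h v` on the left and `(h Ψ.root)⁻¹` on the right; after dressing,
every corner vertex retains the same factor `h Ψ.root`. On sub this uniform transformation is
converted into an interior one. -/
theorem intrinsicCoords_dressed_act (hG : ∀ x y : G, x * y = y * x) {h : V → G}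
    (hb : ∀ v ∉ R.bulk, h v = 1) (a : E → G) :
    (intrinsicCoords Φ Ψ).dressed (Γ.act h a) =
      Prod.map (Ψ.subLinks.act (R.part .interior (h * fun _ => (h Ψ.root)⁻¹)))
        (Prod.map (Φ.complLinks.act (R.part .exterior h) ∘
          Φ.complLinks.act (R.uniform (h Ψ.root))) (Φ.links.act (R.uniform (h Ψ.root))))
        ((intrinsicCoords Φ Ψ).dressed a) := by
  have hb' : ∀ v, R.vk v = .boundary → h v = 1 := fun v hv => hb v fun hv' => hv' hv
  -- This identity is checked vertex by vertex without commutativity, which enters only in the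
  -- conversion on sub.
  have hq : (Ψ.gauge (Ψ.var (Γ.act h a))⁻¹ * h : V → G) =
      R.part .interior h * R.part .exterior h * R.uniform (h Ψ.root) *
        Ψ.gauge (Ψ.var a)⁻¹ := by
    rw [Ψ.var_act]
    generalize Ψ.var a = l
    funext v
    cases hk : R.vk v with
    | interior => simp [Ψ.gauge_of_ne, R.part_of_eq hk, R.part_of_ne, R.uniform_of_ne, hk]
    | exterior => simp [Ψ.gauge_of_ne, R.part_of_eq hk, R.part_of_ne, R.uniform_of_ne, hk]
    | boundary => simp [Ψ.gauge_of_ne, R.part_of_ne, R.uniform_of_ne, hk, hb' v hk]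
    | corner =>
      by_cases hv : (⟨v, hk⟩ : R.Corner) = Ψ.root
      · obtain rfl : v = Ψ.root.1 := congrArg Subtype.val hv
        simp [Ψ.gauge_root, R.part_of_ne, R.uniform_of_corner, hk]
      · have hd : ∀ q : Ψ.Dof → G, Ψ.gauge q v = q ⟨⟨v, hk⟩, hv⟩ := fun q => Ψ.gauge_dof q ⟨_, hv⟩
        simp [hd, R.part_of_ne, R.uniform_of_corner, hk, LinkSystem.act, IntrinsicFrame.links,
          mul_assoc]
  change LinkSystem.act₃ _ _ _ (Ψ.gauge (Ψ.var (Γ.act h a))⁻¹)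
    ((intrinsicCoords Φ Ψ).x (Γ.act h a)) = Prod.map _ _
      (LinkSystem.act₃ _ _ _ (Ψ.gauge (Ψ.var a)⁻¹) ((intrinsicCoords Φ Ψ).x a))
  rw [intrinsicCoords_x_act, ← LinkSystem.act₃_mul, hq, LinkSystem.act₃_mul]
  generalize LinkSystem.act₃ Ψ.subLinks Φ.complLinks Φ.links (Ψ.gauge (Ψ.var a)⁻¹)
    ((intrinsicCoords Φ Ψ).x a) = x
  obtain ⟨x₁, x₂, x₃⟩ := x
  simp only [LinkSystem.act₃, Prod.map]
  refine Prod.ext ?_ (Prod.ext ?_ ?_)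
  · dsimp only
    rw [← Ψ.subLinks_act_part_mul hG]
    refine congrFun (Ψ.subLinks_act_congr (fun v hv => ?_) fun v hv => ?_) _
    · simp [R.part_of_ne (κ := .exterior), hv]
    · simp [R.part_of_ne, hv]
  · dsimp only
    rw [LinkSystem.act_comp_act]
    refine congrFun (Φ.complLinks_act_congr fun v hv => ?_) _
    simp [R.part_of_ne hv]
  · dsimp only
    refine congrFun (Φ.links_act_congr (fun v hv => ?_) fun v hv => ?_) _
    · simp [R.part_of_ne, hv]
    · simp [R.part_of_ne, hv]

/-- The symmetries of the wave functions of region, complement and extrinsic frame. -/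
def intrinsicSymm : {h : V → G // ∀ v ∉ R.verts .interior, h v = 1} ⊕
    (({h : V → G // ∀ v ∉ R.verts .exterior, h v = 1} ⊕ Empty) ⊕ G) →
    (Ψ.SubDof → G) × (Φ.ComplDof → G) × (R.Corner → G) →
      (Ψ.SubDof → G) × (Φ.ComplDof → G) × (R.Corner → G) :=
  Sum.elim (fun h => Prod.map (Ψ.subLinks.act h.1) id) fun j => Prod.map id (outSymm Φ j)

theorem measurePreserving_intrinsicSymm (j) : MeasurePreserving (intrinsicSymm (G := G) Φ Ψ j)
    ((haarPi G Ψ.SubDof).prod ((haarPi G Φ.ComplDof).prod (haarPi G R.Corner)))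
    ((haarPi G Ψ.SubDof).prod ((haarPi G Φ.ComplDof).prod (haarPi G R.Corner))) := by
  rcases j with h | j
  · exact (Ψ.subLinks.measurePreserving_act h.1).prod (.id _)
  · exact (MeasurePreserving.id _).prod (measurePreserving_outSymm Φ j)

theorem represents_subOut : Represents (tensorRep (Ψ.Hsub G).subtypeₗᵢ (outRep Φ G))
    (intrinsicSymm Φ Ψ) :=
  (Ψ.subLinks.represents_gauss (G := G) (R.verts .interior)).tensor
    (represents_outRep (G := G) Φ) (fun h => Ψ.subLinks.measurePreserving_act h.1)
    (measurePreserving_outSymm Φ)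

/-- No constraint is imposed on the reduced states beyond those coming from bulk gauge invariance;
with `exists_comp_dressed_intrinsic` the two sets of constraints match. -/
theorem exists_dressed_intrinsicSymm (hG : ∀ x y : G, x * y = y * x) (j) :
    ∃ h : {h : V → G // ∀ v ∉ R.bulk, h v = 1}, ∀ a, (intrinsicCoords Φ Ψ).dressed (Γ.act h.1 a) =
      intrinsicSymm Φ Ψ j ((intrinsicCoords Φ Ψ).dressed a) := by
  have hroot : ∀ κ, κ ≠ VertexKind.corner → ∀ h : V → G, (∀ v ∉ R.verts κ, h v = 1) →
      h Ψ.root = 1 := fun κ hκ h hh => hh _ fun hv => hκ (hv.symm.trans Ψ.root.2)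
  have hu1 : R.uniform (1 : G) = 1 := R.cornerGaugeHom.map_one
  rcases j with h | (h | e) | g
  · refine ⟨⟨h.1, R.eq_one_of_supported (by simp) h.2⟩, fun a => ?_⟩
    have h1 : (h.1 * fun _ => (h.1 Ψ.root)⁻¹) = h.1 := by
      rw [hroot _ (by simp) _ h.2]; funext v; simp
    rw [intrinsicCoords_dressed_act Φ Ψ hG (R.eq_one_of_supported (by simp) h.2), h1,
      hroot _ (by simp) _ h.2, hu1, R.part_eq_self h.2,
      R.part_eq_one (κ' := .exterior) (by simp) h.2, LinkSystem.act_one, LinkSystem.act_one]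
    rfl
  · refine ⟨⟨h.1, R.eq_one_of_supported (by simp) h.2⟩, fun a => ?_⟩
    have h1 : (h.1 * fun _ => (h.1 Ψ.root)⁻¹) = h.1 := by
      rw [hroot _ (by simp) _ h.2]; funext v; simp
    rw [intrinsicCoords_dressed_act Φ Ψ hG (R.eq_one_of_supported (by simp) h.2), h1,
      hroot _ (by simp) _ h.2, hu1, R.part_eq_self h.2,
      R.part_eq_one (κ' := .interior) (by simp) h.2, LinkSystem.act_one, LinkSystem.act_one,
      LinkSystem.act_one]
    rfl
  · exact e.elim
  -- The joint uniform symmetry is induced by the transformation equal to `g⁻¹` on the whole region,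
  -- corner and interior, so that sub is unaffected. The inverse matches the convention in
  -- `outSymm`.
  · have hb : ∀ v ∉ R.bulk,
        ((R.part .interior fun _ => g⁻¹) * R.uniform g⁻¹ : V → G) v = 1 := fun v hv => by
      rw [Pi.mul_apply, R.eq_one_of_supported (by simp) (R.part_supported .interior _) v hv,
        one_mul]
      exact R.cornerGauge_supported _ v hv
    refine ⟨⟨_, hb⟩, fun a => ?_⟩
    have h0 : ((R.part .interior fun _ => g⁻¹) * R.uniform g⁻¹ : V → G) Ψ.root = g⁻¹ := by
      have := Ψ.root.2
      simp [R.part_of_ne, R.uniform_of_corner, this]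
    have h1 : R.part .interior (((R.part .interior fun _ => g⁻¹) * R.uniform g⁻¹ : V → G) *
        fun _ => g⁻¹⁻¹) = 1 := by
      funext v
      by_cases hv : R.vk v = .interior
      · simp [R.part_of_eq hv, R.uniform_of_ne, hv]
      · exact R.part_of_ne hv _
    have h2 : R.part .exterior ((R.part .interior fun _ => g⁻¹) * R.uniform g⁻¹ : V → G) =
        1 := by
      funext v
      by_cases hv : R.vk v = .exterior
      · simp [R.part_of_eq hv, R.part_of_ne, R.uniform_of_ne, hv]
      · exact R.part_of_ne hv _
    rw [intrinsicCoords_dressed_act Φ Ψ hG hb, h0, h1, h2, LinkSystem.act_one,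
      LinkSystem.act_one, R.uniform_inv]
    rfl

theorem exists_comp_dressed_intrinsic (hG : ∀ x y : G, x * y = y * x)
    (h : {h : V → G // ∀ v ∉ R.bulk, h v = 1}) :
    ∃ w, (∀ a, (intrinsicCoords Φ Ψ).dressed (Γ.act h.1 a) =
        w ((intrinsicCoords Φ Ψ).dressed a)) ∧
      ∀ y : Lp ℂ 2 ((haarPi G Ψ.SubDof).prod ((haarPi G Φ.ComplDof).prod (haarPi G R.Corner))),
        (∀ j, y ∘ intrinsicSymm Φ Ψ j =ᵐ[(haarPi G Ψ.SubDof).prod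
          ((haarPi G Φ.ComplDof).prod (haarPi G R.Corner))] y) →
        y ∘ w =ᵐ[(haarPi G Ψ.SubDof).prod ((haarPi G Φ.ComplDof).prod (haarPi G R.Corner))] y := by
  refine ⟨_, intrinsicCoords_dressed_act Φ Ψ hG h.2, fun y hy => ?_⟩
  let j₂ : ({h : V → G // ∀ v ∉ R.verts .exterior, h v = 1} ⊕ Empty) ⊕ G :=
    .inl (.inl ⟨_, R.part_supported .exterior h.1⟩)
  -- The root value is inverted because `outSymm` acts by inverse uniform transformations.
  let j₃ : ({h : V → G // ∀ v ∉ R.verts .exterior, h v = 1} ⊕ Empty) ⊕ G :=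
    .inr (h.1 Ψ.root)⁻¹
  have h4 := ae_eq_comp_comp ((measurePreserving_intrinsicSymm Φ Ψ (.inr j₂)).comp
      (measurePreserving_intrinsicSymm Φ Ψ (.inr j₃)))
    (hy (.inl ⟨_, R.part_supported .interior (h.1 * fun _ => (h.1 Ψ.root)⁻¹)⟩))
    (ae_eq_comp_comp (r := intrinsicSymm Φ Ψ (.inr j₂)) (s := intrinsicSymm Φ Ψ (.inr j₃))
      (measurePreserving_intrinsicSymm Φ Ψ _) (hy _) (hy _))
  simp only [intrinsicSymm, outSymm, j₂, j₃, Sum.elim_inl, Sum.elim_inr, ← R.uniform_inv, inv_inv] at h4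
  exact h4

theorem integral_eq_frameOverlap (f : LinkL2 G Ψ.SubDof) (k : LinkL2 G Φ.ComplDof) (χ : Φ.H G)
    (l : Ψ.H G) (ψ : LinkL2 G E) :
    ∫ a, conj (l2mul (haarPi G Ψ.SubDof) _ f (l2mul (haarPi G Φ.ComplDof) (haarPi G R.Corner) k χ)
      ((intrinsicCoords Φ Ψ).x a) * l ((intrinsicCoords Φ Ψ).q a)) * ψ a ∂(haarPi G E) =
    frameOverlap Φ Ψ f k l χ ψ := by
  refine integral_congr_ae ?_
  filter_upwards [ae_l2mul_l2mul (measurePreserving_fst.comp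
    (intrinsicCoords (G := G) Φ Ψ).measurePreserving) f k χ] with a ha
  refine congrArg (fun z => conj z * ψ a)
    ((congrArg (· * l ((intrinsicCoords Φ Ψ).q a)) ha).trans ?_)
  change f (Ψ.subVar a) * (k (Φ.complVar a) * χ (Φ.var a)) * l (Ψ.var a) =
    f (Ψ.subVar a) * k (Φ.complVar a) * l (Ψ.var a) * χ (Φ.var a)
  ring

/-- The gauge transformation `Ψ.gauge h` of region, complement and extrinsic frame. -/
noncomputable abbrev intrinsicU (hG : ∀ x y : G, x * y = y * x) (h : Ψ.Dof → G) :
    HTensor (Ψ.Hsub G) (Φ.Hout G) ≃ₗᵢ[ℂ] HTensor (Ψ.Hsub G) (Φ.Hout G) :=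
  HTensor.congr (Ψ.subLinks.gaugeUPhys (R.verts .interior) (Ψ.gauge h))
    (outU Φ hG (Ψ.gauge h))

theorem implements_intrinsicU (hG : ∀ x y : G, x * y = y * x) (h : Ψ.Dof → G) :
    Implements (tensorRep (Ψ.Hsub G).subtypeₗᵢ (outRep Φ G)) (intrinsicU Φ Ψ hG h)
      ((intrinsicCoords Φ Ψ).ρ h⁻¹) := by
  have hr : (intrinsicCoords Φ Ψ).ρ h⁻¹ = Prod.map (Ψ.subLinks.act (Ψ.gauge h)⁻¹)
      (Prod.map (Φ.complLinks.act (Ψ.gauge h)⁻¹) (Φ.links.act (Ψ.gauge h)⁻¹)) :=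
    congrArg (LinkSystem.act₃ Ψ.subLinks Φ.complLinks Φ.links) (Ψ.gauge_inv h)
  have h1 := (Ψ.subLinks.implements_gaugeUPhys (R.verts .interior) (Ψ.gauge h)).tensor
    (implements_outU Φ hG (Ψ.gauge h)) (Ψ.subLinks.measurePreserving_act _)
    ((Φ.complLinks.measurePreserving_act _).prod (Φ.links.measurePreserving_act _))
  exact fun a => (h1 a).trans (Filter.EventuallyEq.of_eq (congrArg _ hr.symm))

theorem isDual_subOut (f : LinkL2 G Ψ.SubDof) (k : LinkL2 G Φ.ComplDof) (χ : Φ.H G) :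
    IsDual (tensorRep (Ψ.Hsub G).subtypeₗᵢ (outRep Φ G)) (l2mul _ _ f (l2mul _ _ k χ))
      (htmul ((Ψ.Hsub G).orthogonalProjectionOnto f)
        ((Φ.Hout G).orthogonalProjectionOnto
          (htmul ((Φ.Hcompl G).orthogonalProjectionOnto k) χ))) :=
  (isDual_orthogonalProjection _ _).tensor
    (((isDual_orthogonalProjection _ _).tensor (isDual_id _)).restrict _)

/-- The reduction relative to the intrinsic frame, for an Abelian group. -/
theorem exists_intrinsicPW (hG : ∀ x y : G, x * y = y * x) :
    ∃ T : (Ψ.Dof → G) → (R.Hphys G ≃ₗᵢ[ℂ] HTensor (Ψ.Hsub G) (Φ.Hout G)),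
      IsIntrinsicPW Φ Ψ (fun g ψ => T g ψ) ∧
      (∀ T', IsIntrinsicPW Φ Ψ T' → ∀ g ψ, T' g ψ = T g ψ) ∧
      ∀ (h g : Ψ.Dof → G) (ψ : R.Hphys G), T (h * g) ψ = intrinsicU Φ Ψ hG h (T g ψ) := by
  have := LinkSystem.innerRegularCompactLTTop_haarPi₃ G Ψ.SubDof Φ.ComplDof R.Corner
  have key := (intrinsicCoords (G := G) Φ Ψ).exists_pageWootters
    (LinkSystem.continuous_act₃ Ψ.subLinks Φ.complLinks Φ.links Ψ.continuous_gauge)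
    (fun h : {h : V → G // ∀ v ∉ R.bulk, h v = 1} => Γ.measurePreserving_act h.1)
    (Γ.represents_gauss R.bulk) (represents_subOut Φ Ψ)
    (fun j => (measurePreserving_intrinsicSymm Φ Ψ j).measurable)
    (exists_comp_dressed_intrinsic Φ Ψ hG) (exists_dressed_intrinsicSymm Φ Ψ hG)
    (fun h => ⟨⟨Ψ.gauge h, R.cornerGauge_supported _⟩, fun a =>
      ⟨intrinsicCoords_x_act Φ Ψ _ a, (Ψ.var_act _ a).trans (Ψ.links_act_gauge h _)⟩⟩)
    (implements_intrinsicU Φ Ψ hG)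
    (V := intrinsicU Φ Ψ hG) (β := LinkL2 G Ψ.SubDof × LinkL2 G Φ.ComplDof × Φ.H G)
    (F := fun b => l2mul _ _ b.1 (l2mul _ _ b.2.1 b.2.2))
    (z := fun b => htmul ((Ψ.Hsub G).orthogonalProjectionOnto b.1)
            ((Φ.Hout G).orthogonalProjectionOnto
              (htmul ((Φ.Hcompl G).orthogonalProjectionOnto b.2.1) b.2.2)))
    (fun b => isDual_subOut Φ Ψ b.1 b.2.1 b.2.2)
    (fun y hy => eq_zero_of_inner_l2mul_l2mul y fun f g k => hy (f, g, k))
  refine key.imp fun T hT => ⟨fun ψ => ⟨hT.1 ψ, fun f k l χ => (hT.2.1 (f, k, χ) l ψ).trans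
      (integral_eq_frameOverlap Φ Ψ f k χ l ψ)⟩,
    fun T' hT' => hT.2.2.1 T' fun ψ => ⟨(hT' ψ).1, fun b l => ((hT' ψ).2 b.1 b.2.1 l b.2.2).trans
      (integral_eq_frameOverlap Φ Ψ b.1 b.2.1 b.2.2 l ψ).symm⟩, hT.2.2.2⟩

end Intrinsic

/-! ### Dressing the complement by a Wilson line of the extrinsic frame. -/

section Twist

variable {V E : Type*} {Γ : LinkSystem V E} {R : Region Γ} (Φ : ExtrinsicFrame R)
  {G : Type*} [Group G]

/-- The dressing of the complement by the frame variable at a corner vertex. -/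
def frameTwist (v : R.Corner) (p : (Φ.ComplDof → G) × (R.Corner → G)) :
    (Φ.ComplDof → G) × (R.Corner → G) :=
  (Φ.complLinks.act (R.uniform (p.2 v)) p.1, p.2)

theorem outSymm_inl_frameTwist (hG : ∀ x y : G, x * y = y * x) (v : R.Corner) (j)
    (p : (Φ.ComplDof → G) × (R.Corner → G)) :
    outSymm Φ (.inl j) (frameTwist Φ v p) = frameTwist Φ v (outSymm Φ (.inl j) p) := by
  rcases j with h | e
  · exact Prod.ext (Φ.complLinks.act_comm hG _ _ _) rfl
  · exact e.elim

/-- The shift of the frame variable at `v` by `g⁻¹` already supplies the action on compl, so in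
dressed variables the uniform transformation moves the frame alone. -/
theorem outSymm_inr_frameTwist (v : R.Corner) (g : G)
    (p : (Φ.ComplDof → G) × (R.Corner → G)) :
    outSymm Φ (.inr g) (frameTwist Φ v p) =
      frameTwist Φ v (Prod.map id (Φ.links.act (R.uniform g)⁻¹) p) := by
  have h1 : Φ.links.act (R.uniform g)⁻¹ p.2 v = g⁻¹ * p.2 v := by
    rw [← R.uniform_inv]
    exact congrFun (Φ.links_act_cornerGauge (fun _ => g⁻¹) p.2) v
  refine Prod.ext ?_ rfl
  change Φ.complLinks.act (R.uniform g)⁻¹ (Φ.complLinks.act (R.uniform (p.2 v)) p.1) =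
    Φ.complLinks.act (R.uniform (Φ.links.act (R.uniform g)⁻¹ p.2 v)) p.1
  rw [h1, ← LinkSystem.act_mul_apply, ← R.uniform_inv]
  exact congrArg (fun h => Φ.complLinks.act h p.1)
    (R.cornerGauge_mul (fun _ => g⁻¹) fun _ => p.2 v).symm

/-- Such an `h` is trivial at both ends of the line to `v` and so leaves the dressing variable
unchanged. -/
theorem map_act_frameTwist (hG : ∀ x y : G, x * y = y * x) {v : R.Corner} {h : V → G}
    (hv : h v = 1) (hb : ∀ w ∉ R.bulk, h w = 1) (p : (Φ.ComplDof → G) × (R.Corner → G)) :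
    Prod.map (Φ.complLinks.act h) (Φ.links.act h) (frameTwist Φ v p) =
      frameTwist Φ v (Prod.map (Φ.complLinks.act h) (Φ.links.act h) p) := by
  have h1 : Φ.links.act h p.2 v = p.2 v := by
    have h2 : h (Φ.node v 0) = 1 := hb _ fun h' => h' (Φ.start v)
    change h v * p.2 v * (h (Φ.node v 0))⁻¹ = p.2 v
    rw [hv, h2, one_mul, inv_one, mul_one]
  refine Prod.ext ?_ rfl
  change Φ.complLinks.act h (Φ.complLinks.act (R.uniform (p.2 v)) p.1) =
    Φ.complLinks.act (R.uniform (Φ.links.act h p.2 v)) (Φ.complLinks.act h p.1)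
  rw [h1, Φ.complLinks.act_comm hG]

variable [TopologicalSpace G] [IsTopologicalGroup G]

theorem continuous_frameTwist (v : R.Corner) : Continuous (frameTwist (G := G) Φ v) := by
  have h1 : Continuous fun p : (Φ.ComplDof → G) × (R.Corner → G) => R.uniform (p.2 v) :=
    R.continuous_cornerGauge.comp (f := fun p : (Φ.ComplDof → G) × (R.Corner → G) =>
      fun _ => p.2 v) (by fun_prop)
  exact (Φ.complLinks.continuous_act_uncurry.comp (h1.prodMk continuous_fst)).prodMk
    continuous_snd

end Twist

section

variable {V E : Type*} [Fintype V] {Γ : LinkSystem V E} {R : Region Γ} (Φ : ExtrinsicFrame R)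
  {G : Type*} [Group G] [TopologicalSpace G] [IsTopologicalGroup G] [CompactSpace G]
  [SecondCountableTopology G] [T2Space G] [MeasurableSpace G] [BorelSpace G]

theorem measurePreserving_linksSymm (j : Empty ⊕ G) : MeasurePreserving
    (Sum.elim Empty.elim (fun g => Φ.links.act (R.uniform g)⁻¹) j)
    (haarPi G R.Corner) (haarPi G R.Corner) := by
  rcases j with e | g
  · exact e.elim
  · exact Φ.links.measurePreserving_act _

end

/-! ### The unitary separating the joint uniform constraint. -/

section TwistMeasure

variable {V E : Type*} [Fintype V] [Fintype E] [DecidableEq E]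
  {Γ : LinkSystem V E} {R : Region Γ} (Φ : ExtrinsicFrame R)
  {G : Type*} [Group G] [TopologicalSpace G] [IsTopologicalGroup G] [CompactSpace G]
  [SecondCountableTopology G] [T2Space G] [MeasurableSpace G] [BorelSpace G]

theorem measurePreserving_frameTwist (v : R.Corner) : MeasurePreserving (frameTwist (G := G) Φ v)
    ((haarPi G Φ.ComplDof).prod (haarPi G R.Corner))
    ((haarPi G Φ.ComplDof).prod (haarPi G R.Corner)) := by
  have hm : Measurable (Function.uncurry fun (x : R.Corner → G) (c : Φ.ComplDof → G) =>
      Φ.complLinks.act (R.uniform (x v)) c) :=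
    ((continuous_frameTwist Φ v).fst.comp continuous_swap).measurable
  have := (MeasurePreserving.id (haarPi G R.Corner)).skew_product hm
    (.of_forall fun x => (Φ.complLinks.measurePreserving_act (R.uniform (x v))).map_eq)
  exact Measure.measurePreserving_swap.comp (this.comp Measure.measurePreserving_swap)

/-- The dressing of the complement as a change of variables. -/
def frameTwistEquiv (v : R.Corner) :
    (Φ.ComplDof → G) × (R.Corner → G) ≃ᵐ (Φ.ComplDof → G) × (R.Corner → G) where
  toFun := frameTwist Φ v
  invFun p := (Φ.complLinks.act (R.uniform (p.2 v)⁻¹) p.1, p.2)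
  left_inv p := Prod.ext (by
    change Φ.complLinks.act (R.uniform (p.2 v)⁻¹) (Φ.complLinks.act (R.uniform (p.2 v)) p.1) = p.1
    rw [R.uniform_inv, ← LinkSystem.act_mul_apply, inv_mul_cancel, LinkSystem.act_one, id]) rfl
  right_inv p := Prod.ext (by
    change Φ.complLinks.act (R.uniform (p.2 v)) (Φ.complLinks.act (R.uniform (p.2 v)⁻¹) p.1) = p.1
    rw [R.uniform_inv, ← LinkSystem.act_mul_apply, mul_inv_cancel, LinkSystem.act_one, id]) rfl
  measurable_toFun := (continuous_frameTwist Φ v).measurable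
  measurable_invFun := by
    have h1 : Continuous fun p : (Φ.ComplDof → G) × (R.Corner → G) => R.uniform (p.2 v)⁻¹ :=
      R.continuous_cornerGauge.comp (f := fun p : (Φ.ComplDof → G) × (R.Corner → G) =>
        fun _ => (p.2 v)⁻¹) (by fun_prop)
    exact ((Φ.complLinks.continuous_act_uncurry.comp (h1.prodMk continuous_fst)).prodMk
      continuous_snd).measurable

variable (G) in
/-- The representation by wave functions of the states of complement and extrinsic frame for which
the extrinsic frame is invariant. -/
noncomputable abbrev complInvRep : HTensor (Φ.Hcompl G) (Φ.Hinv G) →ₗᵢ[ℂ]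
    Lp ℂ 2 ((haarPi G Φ.ComplDof).prod (haarPi G R.Corner)) :=
  tensorRep (Φ.Hcompl G).subtypeₗᵢ (LinearIsometry.id.comp (Φ.Hinv G).subtypeₗᵢ)

/-- The symmetries of the wave functions of complement and invariant extrinsic frame. -/
def complInvSymm : {h : V → G // ∀ v ∉ R.verts .exterior, h v = 1} ⊕ (Empty ⊕ G) →
    (Φ.ComplDof → G) × (R.Corner → G) → (Φ.ComplDof → G) × (R.Corner → G) :=
  Sum.elim (fun h => Prod.map (Φ.complLinks.act h.1) id) fun j => Prod.map id
    (Sum.elim Empty.elim (fun g => Φ.links.act (R.uniform g)⁻¹) j)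

theorem measurePreserving_complInvSymm (j) : MeasurePreserving (complInvSymm (G := G) Φ j)
    ((haarPi G Φ.ComplDof).prod (haarPi G R.Corner))
    ((haarPi G Φ.ComplDof).prod (haarPi G R.Corner)) := by
  rcases j with h | j
  · exact (Φ.complLinks.measurePreserving_act h.1).prod (.id _)
  · exact (MeasurePreserving.id _).prod (measurePreserving_linksSymm Φ j)

theorem represents_complInvRep : Represents (complInvRep Φ G) (complInvSymm Φ) :=
  (Φ.complLinks.represents_gauss (G := G) (R.verts .exterior)).tensor
    ((represents_id (μ := haarPi G R.Corner)).fixedVectors fun g =>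
      Φ.links.implements_gaugeU (R.uniform g))
    (fun h => Φ.complLinks.measurePreserving_act h.1) (measurePreserving_linksSymm Φ)

/-- The restriction of a gauge transformation to the invariant states of the extrinsic frame. -/
noncomputable def invU (hG : ∀ x y : G, x * y = y * x) (h : V → G) : Φ.Hinv G ≃ₗᵢ[ℂ] Φ.Hinv G :=
  fixedVectorsRestrict _ (Φ.links.gaugeU h) fun g => (Φ.links.implements_gaugeU h).comm
    (Φ.links.implements_gaugeU (R.uniform g)) (Φ.links.measurePreserving_act _)
    (Φ.links.measurePreserving_act _) (Φ.links.act_comm hG _ _)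

theorem implements_complInvU (hG : ∀ x y : G, x * y = y * x) (h : V → G) :
    Implements (complInvRep Φ G)
      (HTensor.congr (Φ.complLinks.gaugeUPhys (R.verts .exterior) h) (invU Φ hG h))
      (Prod.map (Φ.complLinks.act h⁻¹) (Φ.links.act h⁻¹)) :=
  (Φ.complLinks.implements_gaugeUPhys _ h).tensor
    ((Φ.links.implements_gaugeU h).fixedVectorsRestrict _)
    (Φ.complLinks.measurePreserving_act _) (Φ.links.measurePreserving_act _)

/-- The dressing turns joint uniform invariance into invariance of the extrinsic frame alone and
leaves the exterior constraints as they are. -/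
theorem exists_outEquiv (hG : ∀ x y : G, x * y = y * x) (v : R.Corner) :
    ∃ W : Φ.Hout G ≃ₗᵢ[ℂ] HTensor (Φ.Hcompl G) (Φ.Hinv G), ∀ a, complInvRep Φ G (W a)
      =ᵐ[(haarPi G Φ.ComplDof).prod (haarPi G R.Corner)] outRep Φ G a ∘ frameTwist Φ v := by
  refine (represents_outRep Φ).exists_equiv (represents_complInvRep Φ)
    (e := frameTwistEquiv Φ v) (measurePreserving_frameTwist Φ v)
    (measurePreserving_complInvSymm Φ) fun F => ?_
  have h1 := fun j => ae_eq_comp_iff_of_semiconj (f := F) (e := frameTwistEquiv Φ v)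
    (measurePreserving_frameTwist Φ v) (outSymm_inl_frameTwist Φ hG v j)
  have h2 := fun g => ae_eq_comp_iff_of_semiconj (f := F) (e := frameTwistEquiv Φ v)
    (measurePreserving_frameTwist Φ v) (outSymm_inr_frameTwist Φ v g)
  constructor
  · rintro hF (h | e | g)
    · exact (h1 (.inl h)).1 (hF _)
    · exact e.elim
    · exact (h2 g).1 (hF _)
  · rintro hF ((h | e) | g)
    · exact (h1 (.inl h)).2 (hF (.inl h))
    · exact e.elim
    · exact (h2 g).2 (hF (.inr (.inr g)))

/-- The reason why `W` preserves multilocality: transformations trivial at `v` commute with the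
dressing and still act factorwise afterwards. -/
theorem outEquiv_outU (hG : ∀ x y : G, x * y = y * x) {v : R.Corner}
    {W : Φ.Hout G ≃ₗᵢ[ℂ] HTensor (Φ.Hcompl G) (Φ.Hinv G)} (hW : ∀ a, complInvRep Φ G (W a)
      =ᵐ[(haarPi G Φ.ComplDof).prod (haarPi G R.Corner)] outRep Φ G a ∘ frameTwist Φ v)
    {h : V → G} (hv : h v = 1) (hb : ∀ w ∉ R.bulk, h w = 1) (a : Φ.Hout G) :
    W (outU Φ hG h a) =
      HTensor.congr (Φ.complLinks.gaugeUPhys (R.verts .exterior) h) (invU Φ hG h) (W a) := by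
  refine (complInvRep Φ G).injective (Lp.ext ?_)
  have hm := (Φ.complLinks.measurePreserving_act h⁻¹).prod (Φ.links.measurePreserving_act h⁻¹)
  have h1 := (hW (outU Φ hG h a)).trans
    ((measurePreserving_frameTwist Φ v).quasiMeasurePreserving.ae_eq_comp
      (implements_outU Φ hG h a))
  have h2 := (implements_complInvU Φ hG h (W a)).trans
    (hm.quasiMeasurePreserving.ae_eq_comp (hW a))
  refine h1.trans (Filter.EventuallyEq.trans ?_ h2.symm)
  exact .of_eq (funext fun p => congrArg (outRep Φ G a) (map_act_frameTwist Φ hG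
    (by rw [Pi.inv_apply, hv, inv_one]) (fun w hw => by rw [Pi.inv_apply, hb w hw, inv_one]) p))

/-- For fixed frame variables the dressing is a uniform transformation of compl, which fixes `k`;
Fubini assembles the slices. -/
theorem comp_frameTwist_ae_eq (hN : Φ.ComplNeutral G) (v : R.Corner) (k : Φ.Hcompl G) :
    (fun p => (k : LinkL2 G Φ.ComplDof) (frameTwist Φ v p).1)
      =ᵐ[(haarPi G Φ.ComplDof).prod (haarPi G R.Corner)]
        fun p => (k : LinkL2 G Φ.ComplDof) p.1 := by
  have hk : Measurable (k : LinkL2 G Φ.ComplDof) := (Lp.stronglyMeasurable _).measurable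
  have hs : MeasurableSet {p : (Φ.ComplDof → G) × (R.Corner → G) |
      (k : LinkL2 G Φ.ComplDof) (frameTwist Φ v p).1 = (k : LinkL2 G Φ.ComplDof) p.1} :=
    measurableSet_eq_fun (hk.comp (continuous_frameTwist Φ v).measurable.fst)
      (hk.comp measurable_fst)
  refine (Measure.ae_prod_iff_ae_ae hs).2 ((Measure.ae_ae_comm hs).2 (.of_forall fun x => ?_))
  have h1 := Φ.complLinks.implements_gaugeUPhys (R.verts .exterior) (R.uniform (x v)⁻¹) k
  rw [hN, R.uniform_inv, inv_inv] at h1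
  exact h1.symm

/-- By neutrality a product of a state of compl with an invariant frame state is jointly invariant
and insensitive to the dressing, so `W` returns the same product. -/
theorem outEquiv_symm_htmul (hN : Φ.ComplNeutral G) {v : R.Corner}
    {W : Φ.Hout G ≃ₗᵢ[ℂ] HTensor (Φ.Hcompl G) (Φ.Hinv G)} (hW : ∀ a, complInvRep Φ G (W a)
      =ᵐ[(haarPi G Φ.ComplDof).prod (haarPi G R.Corner)] outRep Φ G a ∘ frameTwist Φ v)
    (k : Φ.Hcompl G) (χ : Φ.Hinv G) :
    (W.symm (htmul k χ) : HTensor (Φ.Hcompl G) (Φ.H G)) = htmul k (χ : Φ.H G) := by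
  have hmem : htmul k (χ : Φ.H G) ∈ Φ.Hout G := fun g => by
    rw [HTensor.congr_htmul, hN g k, χ.2 g]
  have key : W ⟨_, hmem⟩ = htmul k χ := by
    refine (complInvRep Φ G).injective (Lp.ext ?_)
    have h1 : outRep Φ G ⟨_, hmem⟩ = l2mul _ _ (k : LinkL2 G Φ.ComplDof) (χ : Φ.H G) :=
      tensorRep_htmul _ _ _ _
    have h2 : complInvRep Φ G (htmul k χ) = l2mul _ _ (k : LinkL2 G Φ.ComplDof) (χ : Φ.H G) :=
      tensorRep_htmul _ _ _ _
    have h3 := hW ⟨_, hmem⟩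
    rw [h1] at h3
    rw [h2]
    filter_upwards [h3, coeFn_l2mul (k : LinkL2 G Φ.ComplDof) (χ : Φ.H G),
      (measurePreserving_frameTwist Φ v).quasiMeasurePreserving.ae_eq_comp
        (coeFn_l2mul (k : LinkL2 G Φ.ComplDof) (χ : Φ.H G)),
      comp_frameTwist_ae_eq Φ hN v k] with p e1 e2 e3 e4
    rw [e1, e3, e2]
    exact congrArg (· * (χ : Φ.H G) p.2) e4
  rw [← key, W.symm_apply_apply]

end TwistMeasure

/-! ### Multilocal equivalence and assembly of the theorem. -/

/-- If two unitaries differ by a product unitary and `W` splits its second factor, then their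
compositions with `W` represent the same tensor product structure. -/
theorem sameTPS_trans_congr {H A B C D : Type*}
    [NormedAddCommGroup H] [InnerProductSpace ℂ H]
    [NormedAddCommGroup A] [InnerProductSpace ℂ A] [NormedAddCommGroup B] [InnerProductSpace ℂ B]
    [NormedAddCommGroup C] [InnerProductSpace ℂ C] [NormedAddCommGroup D] [InnerProductSpace ℂ D]
    {T T' : H ≃ₗᵢ[ℂ] HTensor A B} {u : A ≃ₗᵢ[ℂ] A} {b : B ≃ₗᵢ[ℂ] B} {W : B ≃ₗᵢ[ℂ] HTensor C D}
    {v : C ≃ₗᵢ[ℂ] C} {w : D ≃ₗᵢ[ℂ] D} (hT : ∀ x, T' x = HTensor.congr u b (T x))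
    (hW : ∀ y, W (b y) = HTensor.congr v w (W y)) :
    SameTPS (T.trans (HTensor.congr (LinearIsometryEquiv.refl ℂ A) W))
      (T'.trans (HTensor.congr (LinearIsometryEquiv.refl ℂ A) W)) := by
  refine ⟨u, v, w, fun x => ?_⟩
  change HTensor.congr _ W (T' x) =
    HTensor.congr u (HTensor.congr v w) (HTensor.congr (LinearIsometryEquiv.refl ℂ A) W (T x))
  have h1 : u.trans (LinearIsometryEquiv.refl ℂ A) = (LinearIsometryEquiv.refl ℂ A).trans u :=
    LinearIsometryEquiv.ext fun _ => rfl
  have h2 : b.trans W = W.trans (HTensor.congr v w) := LinearIsometryEquiv.ext hW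
  rw [hT, HTensor.congr_congr, HTensor.congr_congr, h1, h2]

theorem mainTheorem3 {V E G : Type*} [Fintype V] [DecidableEq V] [Fintype E] [DecidableEq E]
    [Group G] [TopologicalSpace G] [IsTopologicalGroup G] [CompactSpace G]
    [SecondCountableTopology G] [T2Space G] [MeasurableSpace G] [BorelSpace G]
    (Γ : LinkSystem V E) (R : Region Γ) (Φ : ExtrinsicFrame R) (Ψ : IntrinsicFrame R) :
    -- extrinsic frame: the reduction is unitary and its class is independent of the orientation
    (∃ T : (R.Corner → G) →
        (R.Hphys G ≃ₗᵢ[ℂ] HTensor (Ψ.Hsub G) (HTensor (Φ.Hcompl G) (Ψ.H G))),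
      IsExtrinsicPW Φ Ψ (fun g ψ => T g ψ) ∧
      (∀ T', IsExtrinsicPW Φ Ψ T' → ∀ g ψ, T' g ψ = T g ψ) ∧
      (∀ (h g : R.Corner → G) (ψ : R.Hphys G), T (h * g) ψ =
        HTensor.congr (Ψ.subLinks.gaugeUPhys (R.verts .interior) (R.cornerGauge h))
          (HTensor.congr (Φ.complLinks.gaugeUPhys (R.verts .exterior) (R.cornerGauge h))
            (Ψ.links.gaugeU (R.cornerGauge h))) (T g ψ)) ∧
      (∀ g g' : R.Corner → G, SameTPS (T g) (T g'))) ∧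
    -- the regional factor splits further into the interior and the corner off the intrinsic frame
    (∃ S : HTensor (R.Hint G) (LinkL2 G Ψ.RestDof) ≃ₗᵢ[ℂ] Ψ.Hsub G,
      (∀ (f : R.Hint G) (k : LinkL2 G Ψ.RestDof),
        ((S (htmul f k) : LinkL2 G Ψ.SubDof) : (Ψ.SubDof → G) → ℂ) =ᵐ[haarPi G Ψ.SubDof]
          fun a => (f : LinkL2 G R.IntDof) (a ∘ Sum.inl) * k (a ∘ Sum.inr)) ∧
      (∀ (h : R.Corner → G) x,
        S (HTensor.congr (R.intLinks.gaugeUPhys (R.verts .interior) (R.cornerGauge h))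
          (Ψ.restLinks.gaugeU (R.cornerGauge h)) x) =
        Ψ.subLinks.gaugeUPhys (R.verts .interior) (R.cornerGauge h) (S x))) ∧
    -- Abelian case: the intrinsic frame
    ((∀ x y : G, x * y = y * x) →
      Ψ.SubNeutral G ∧
      ((∀ d : Φ.ComplDof, R.vk (Φ.complLinks.src d) = .boundary ↔
        R.vk (Φ.complLinks.tgt d) = .boundary) → Φ.ComplNeutral G) ∧
      ∃ T : (Ψ.Dof → G) → (R.Hphys G ≃ₗᵢ[ℂ] HTensor (Ψ.Hsub G) (Φ.Hout G)),
        IsIntrinsicPW Φ Ψ (fun g ψ => T g ψ) ∧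
        (∀ T', IsIntrinsicPW Φ Ψ T' → ∀ g ψ, T' g ψ = T g ψ) ∧
        ∃ W : Φ.Hout G ≃ₗᵢ[ℂ] HTensor (Φ.Hcompl G) (Φ.Hinv G),
          (∀ g g' : Ψ.Dof → G,
            SameTPS ((T g).trans (HTensor.congr (LinearIsometryEquiv.refl ℂ (Ψ.Hsub G)) W))
              ((T g').trans (HTensor.congr (LinearIsometryEquiv.refl ℂ (Ψ.Hsub G)) W))) ∧
          (Φ.ComplNeutral G → ∀ (k : Φ.Hcompl G) (χ : Φ.Hinv G),
            (W.symm (htmul k χ) : HTensor (Φ.Hcompl G) (Φ.H G)) = htmul k (χ : Φ.H G))) := by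
  refine ⟨?_, exists_subSplitting Ψ, fun hG => ⟨Ψ.subNeutral hG, Φ.complNeutral hG, ?_⟩⟩
  · refine (exists_extrinsicPW Φ Ψ (G := G)).imp fun T hT => ⟨hT.1, hT.2.1, hT.2.2, fun g g' => ?_⟩
    refine ⟨Ψ.subLinks.gaugeUPhys (R.verts .interior) (R.cornerGauge (g' * g⁻¹)),
      Φ.complLinks.gaugeUPhys (R.verts .exterior) (R.cornerGauge (g' * g⁻¹)),
      Ψ.links.gaugeU (R.cornerGauge (g' * g⁻¹)), fun x => ?_⟩
    have h1 := hT.2.2 (g' * g⁻¹) g x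
    rw [inv_mul_cancel_right] at h1
    exact h1
  · refine (exists_intrinsicPW Φ Ψ hG).imp fun T hT => ⟨hT.1, hT.2.1, ?_⟩
    have hT' : ∀ g g' x, T g' x = intrinsicU Φ Ψ hG (g' * g⁻¹) (T g x) := fun g g' x =>
      (congrArg (T · x) (inv_mul_cancel_right g' g).symm).trans (hT.2.2 (g' * g⁻¹) g x)
    -- The dressing must be taken at the root, because the transformations `Ψ.gauge` that change the
    -- orientation are trivial exactly there among all corner vertices in general.
    exact (exists_outEquiv Φ hG Ψ.root).imp fun W hW => ⟨fun g g' => sameTPS_trans_congr (hT' g g')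
      (outEquiv_outU Φ hG hW (Ψ.gauge_root _) fun w hw => R.cornerGauge_supported _ w hw),
      fun hN => outEquiv_symm_htmul Φ hN hW⟩
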